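/- Let $Y$ be a smooth algebraic variety over $\mathbb{C}$ of dimension $2d$ with a symplectic form $\omega$, i.e. a closed non-degenerate 2-form. Let $V\subset Y$ be a smooth closed Lagrangian subvariety with ideal sheaf $\mathcal{I}\subset\mathcal{O}_Y$, i.e. $\dim V=d$ and $\omega|_V=0$. The form $\omega$ identifies $T_Y$ with $\Omega^1_Y$ and so induces a form $\Theta$ on $\Omega^1_Y$ and a Poisson bracket $\{f,g\}=\Theta(df\wedge dg)$ on $\mathcal{O}_Y$; this bracket induces maps $\mathcal{O}_Y/\mathcal{I}^{n+1}\times\mathcal{O}_Y/\mathcal{I}^{n+1}\to\mathcal{O}_Y/\mathcal{I}^n$ and hence a Poisson bracket on the completion $\varprojlim_n\mathcal{O}_Y/\mathcal{I}^n$. For an open $U\subset V$ let $\prod_{n\ge 0}\mathrm{Sym}^n T_U$ carry the product of the (completed) symmetric algebra of the tangent sheaf $T_U$ and the Poisson bracket determined by the Leibniz rule, applied degree by degree, and by $\{f,g\}=0$, $\{\partial,f\}=\partial(f)$ and $\{\partial,\partial'\}=[\partial,\partial']$ for local sections $f,g$ of $\mathcal{O}_U$ and $\partial,\partial'$ of $T_U$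 (the bracket of the completed cotangent bundle of $U$). Then every point $p\in V$ has an affine open neighbourhood $U\subset V$ such that $\bigl(\varprojlim_n\mathcal{O}_Y/\mathcal{I}^n\bigr)|_U$ is isomorphic to $\prod_{n\ge 0}\mathrm{Sym}^n T_U$ as a sheaf of Poisson algebras over $\mathbb{C}$ on $U$. -/

import Mathlib

open AlgebraicGeometry CategoryTheory TopologicalSpace
noncomputable section
namespace LagrangianNeighborhood

section SymmetricAlgebra

variable {A L : Type*} [CommRing A] [AddCommGroup L] [Module A L]

/-- The homogeneous part `Sym^n_A L` of the symmetric algebra. -/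
def symPart (A L : Type*) [CommRing A] [AddCommGroup L] [Module A L] (n : ℕ) :
    Submodule A (SymmetricAlgebra A L) :=
  (LinearMap.range (SymmetricAlgebra.ι A L)) ^ n

lemma exists_algebraMap_of_mem {b : SymmetricAlgebra A L} (hb : b ∈ symPart A L 0) :
    ∃ a : A, algebraMap A _ a = b := by
  simpa [symPart] using hb

lemma algebraMap_mem_symPart (a : A) :
    algebraMap A (SymmetricAlgebra A L) a ∈ symPart A L 0 := by
  simp [symPart]

lemma ι_mem_symPart (x : L) : SymmetricAlgebra.ι A L x ∈ symPart A L 1 := by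
  simp [symPart]

lemma mul_mem_symPart {i j n : ℕ} (h : i + j = n) {a b : SymmetricAlgebra A L}
    (ha : a ∈ symPart A L i) (hb : b ∈ symPart A L j) : a * b ∈ symPart A L n := by
  subst h
  unfold symPart
  rw [pow_add]
  exact Submodule.mul_mem_mul ha hb

variable (A L) in
/-- The ring `∏_n Sym^n_A L`: its elements are the sequences `(a_n)` with `a_n ∈ Sym^n_A L`,
written as power series `∑ a_n X^n`, so that the product is the Cauchy product
`(ab)_n = ∑_{i+j=n} a_i b_j`. -/
def completedSym : Subalgebra A (PowerSeries (SymmetricAlgebra A L)) where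
  carrier := {F | ∀ n, PowerSeries.coeff n F ∈ symPart A L n}
  mul_mem' := fun {F G} hF hG n => by
    rw [PowerSeries.coeff_mul]
    exact sum_mem fun p hp =>
      mul_mem_symPart (Finset.HasAntidiagonal.mem_antidiagonal.1 hp) (hF _) (hG _)
  add_mem' := fun {F G} hF hG n => by
    rw [map_add]
    exact add_mem (hF n) (hG n)
  algebraMap_mem' := fun a n => by
    rw [PowerSeries.algebraMap_apply, PowerSeries.coeff_C]
    split_ifs with h
    · rw [h]; exact algebraMap_mem_symPart a
    · exact zero_mem _

variable (A L) in
/-- The type `∏_n Sym^n_A L`. -/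
def CompletedSym : Type _ := completedSym A L

instance : CommRing (CompletedSym A L) := inferInstanceAs (CommRing (completedSym A L))

instance : Algebra A (CompletedSym A L) := inferInstanceAs (Algebra A (completedSym A L))

instance [Algebra ℂ A] : Algebra ℂ (CompletedSym A L) :=
  ((algebraMap A (CompletedSym A L)).comp (algebraMap ℂ A)).toAlgebra

section Functoriality

variable {A' L' : Type*} [CommRing A'] [AddCommGroup L'] [Module A' L']

/-- The map `Sym_A L → Sym_{A'} L'` induced by a semilinear map `L → L'`. -/
def symMap (σ : A →+* A') (f : L →ₛₗ[σ] L') : SymmetricAlgebra A L →+* SymmetricAlgebra A' L' :=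
  letI : Algebra A (SymmetricAlgebra A' L') :=
    ((algebraMap A' (SymmetricAlgebra A' L')).comp σ).toAlgebra
  (SymmetricAlgebra.lift
    { toFun := fun x => SymmetricAlgebra.ι A' L' (f x)
      map_add' := fun x y => by simp
      map_smul' := fun a x => by
        rw [LinearMap.map_smulₛₗ, map_smul, Algebra.smul_def, Algebra.smul_def]
        rfl } : SymmetricAlgebra A L →ₐ[A] SymmetricAlgebra A' L').toRingHom

lemma symMap_algebraMap (σ : A →+* A') (f : L →ₛₗ[σ] L') (a : A) :
    symMap σ f (algebraMap A _ a) = algebraMap A' _ (σ a) := by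
  let _ : Algebra A (SymmetricAlgebra A' L') :=
    ((algebraMap A' (SymmetricAlgebra A' L')).comp σ).toAlgebra
  exact AlgHom.commutes (SymmetricAlgebra.lift _) a

lemma symMap_ι (σ : A →+* A') (f : L →ₛₗ[σ] L') (x : L) :
    symMap σ f (SymmetricAlgebra.ι A L x) = SymmetricAlgebra.ι A' L' (f x) := by
  let _ : Algebra A (SymmetricAlgebra A' L') :=
    ((algebraMap A' (SymmetricAlgebra A' L')).comp σ).toAlgebra
  exact SymmetricAlgebra.lift_ι_apply _ x

lemma symMap_mem_symPart (σ : A →+* A') (f : L →ₛₗ[σ] L') {n : ℕ} {a : SymmetricAlgebra A L}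
    (ha : a ∈ symPart A L n) : symMap σ f a ∈ symPart A' L' n := by
  induction ha using Submodule.pow_induction_on_left' with
  | algebraMap r => rw [symMap_algebraMap]; exact algebraMap_mem_symPart _
  | add x y i hx hy ihx ihy => rw [map_add]; exact add_mem ihx ihy
  | mem_mul m hm i x hx ih =>
    obtain ⟨y, rfl⟩ := hm
    rw [map_mul, symMap_ι]
    exact mul_mem_symPart (by omega) (ι_mem_symPart _) ih

/-- The map `∏_n Sym^n_A L → ∏_n Sym^n_{A'} L'` induced by a semilinear map `L → L'`. -/
def CompletedSym.map (σ : A →+* A') (f : L →ₛₗ[σ] L') : CompletedSym A L →+* CompletedSym A' L' :=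
  ((PowerSeries.map (symMap σ f)).comp (completedSym A L).val.toRingHom).codRestrict
    (completedSym A' L') fun F n => by
      change PowerSeries.coeff n (PowerSeries.map (symMap σ f) F.1) ∈ _
      rw [PowerSeries.coeff_map]
      exact symMap_mem_symPart σ f (F.2 n)

lemma CompletedSym.map_algebraMap (σ : A →+* A') (f : L →ₛₗ[σ] L') (a : A) :
    map σ f (algebraMap A _ a) = algebraMap A' _ (σ a) := by
  apply Subtype.ext
  change PowerSeries.map (symMap σ f) (algebraMap A (PowerSeries (SymmetricAlgebra A L)) a) =
    algebraMap A' (PowerSeries (SymmetricAlgebra A' L')) (σ a)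
  rw [PowerSeries.algebraMap_apply, PowerSeries.algebraMap_apply, PowerSeries.map_C,
    symMap_algebraMap]

end Functoriality

/-- A derivation of `Sym_A L` is determined by its values on `A` and on `L`. -/
lemma derivation_ext {D E : Derivation ℤ (SymmetricAlgebra A L) (SymmetricAlgebra A L)}
    (h0 : ∀ a : A, D (algebraMap A _ a) = E (algebraMap A _ a))
    (h1 : ∀ x : L, D (SymmetricAlgebra.ι A L x) = E (SymmetricAlgebra.ι A L x)) : D = E := by
  ext b
  induction b using SymmetricAlgebra.induction with
  | algebraMap r => exact h0 r
  | ι x => exact h1 x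
  | mul a b ha hb => rw [Derivation.leibniz, Derivation.leibniz, ha, hb]
  | add a b ha hb => rw [map_add, map_add, ha, hb]

/-- The ring of dual numbers over `Sym_A L`. -/
def Dual (A L : Type*) [CommRing A] [AddCommGroup L] [Module A L] : Type _ :=
  TrivSqZeroExt (SymmetricAlgebra A L) (SymmetricAlgebra A L)

instance : CommRing (Dual A L) :=
  inferInstanceAs (CommRing (TrivSqZeroExt (SymmetricAlgebra A L) (SymmetricAlgebra A L)))

/-- The dual number `a + bε`. -/
def Dual.mk (a b : SymmetricAlgebra A L) : Dual A L := TrivSqZeroExt.inl a + TrivSqZeroExt.inr b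

/-- The component `a` of `a + bε`. -/
def Dual.fst : Dual A L →+* SymmetricAlgebra A L :=
  (TrivSqZeroExt.fstHom (SymmetricAlgebra A L) (SymmetricAlgebra A L)
    (SymmetricAlgebra A L)).toRingHom

/-- The component `b` of `a + bε`. -/
def Dual.snd : Dual A L →+ SymmetricAlgebra A L :=
  (TrivSqZeroExt.sndHom (SymmetricAlgebra A L) (SymmetricAlgebra A L)).toAddMonoidHom

@[simp] lemma Dual.fst_mk (a b : SymmetricAlgebra A L) : (Dual.mk a b).fst = a := by
  change TrivSqZeroExt.fst (TrivSqZeroExt.inl a + TrivSqZeroExt.inr b) = a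
  simp

@[simp] lemma Dual.snd_mk (a b : SymmetricAlgebra A L) : (Dual.mk a b).snd = b := by
  change TrivSqZeroExt.snd (TrivSqZeroExt.inl a + TrivSqZeroExt.inr b) = b
  simp

lemma Dual.snd_mul (x y : Dual A L) : (x * y).snd = x.fst * y.snd + y.fst * x.snd := by
  have h := TrivSqZeroExt.snd_mul (R := SymmetricAlgebra A L) (M := SymmetricAlgebra A L) x y
  rw [smul_eq_mul, op_smul_eq_smul, smul_eq_mul] at h
  exact h

lemma Dual.ext {x y : Dual A L} (h : x.fst = y.fst) (h' : x.snd = y.snd) : x = y :=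
  TrivSqZeroExt.ext h h'

/-- Values `d₀` on `A` and `d₁` on `L` that satisfy the Leibniz rule extend to a derivation
of `Sym_A L`. -/
lemma exists_derivation (d₀ : A →+ SymmetricAlgebra A L) (d₁ : L →+ SymmetricAlgebra A L)
    (h₀ : ∀ a b, d₀ (a * b) = algebraMap A _ a * d₀ b + algebraMap A _ b * d₀ a)
    (h₁ : ∀ a x, d₁ (a • x) = algebraMap A _ a * d₁ x + SymmetricAlgebra.ι A L x * d₀ a) :
    ∃ D : Derivation ℤ (SymmetricAlgebra A L) (SymmetricAlgebra A L),
      (∀ a, D (algebraMap A _ a) = d₀ a) ∧ ∀ x, D (SymmetricAlgebra.ι A L x) = d₁ x := by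
  have d₀1 : d₀ 1 = 0 := by simpa using h₀ 1 1
  let φ : A →+* Dual A L :=
    { toFun := fun a => Dual.mk (algebraMap A _ a) (d₀ a)
      map_one' := Dual.ext (by simp) (by
        rw [Dual.snd_mk, d₀1]; rfl)
      map_zero' := Dual.ext (by simp) (by simp)
      map_add' := fun a b => Dual.ext (by simp) (by simp)
      map_mul' := fun a b => Dual.ext (by simp) (by simp [Dual.snd_mul, h₀]) }
  let _ : Algebra A (Dual A L) := φ.toAlgebra
  let ψ : L →ₗ[A] Dual A L :=
    { toFun := fun x => Dual.mk (SymmetricAlgebra.ι A L x) (d₁ x)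
      map_add' := fun a b => Dual.ext (by simp) (by simp)
      map_smul' := fun a x => by
        rw [Algebra.smul_def]
        change _ = Dual.mk (algebraMap A _ a) (d₀ a) * _
        exact Dual.ext (by simp [Algebra.smul_def]) (by simp [Dual.snd_mul, h₁]) }
  let Φ := SymmetricAlgebra.lift ψ
  have hΦ0 : ∀ a, Φ (algebraMap A _ a) = Dual.mk (algebraMap A _ a) (d₀ a) :=
    fun a => Φ.commutes a
  have hΦ1 : ∀ x, Φ (SymmetricAlgebra.ι A L x) = Dual.mk (SymmetricAlgebra.ι A L x) (d₁ x) :=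
    fun x => SymmetricAlgebra.lift_ι_apply ψ x
  have hfst : ∀ b, (Φ b).fst = b := by
    intro b
    induction b using SymmetricAlgebra.induction with
    | algebraMap r => rw [hΦ0, Dual.fst_mk]
    | ι x => rw [hΦ1, Dual.fst_mk]
    | mul a b ha hb => rw [map_mul, map_mul, ha, hb]
    | add a b ha hb => rw [map_add, map_add, ha, hb]
  let D : Derivation ℤ (SymmetricAlgebra A L) (SymmetricAlgebra A L) :=
    Derivation.mk' (Dual.snd.comp (Φ : _ →+* Dual A L).toAddMonoidHom).toIntLinearMap
      (fun a b => by
        change (Φ (a * b)).snd = a • (Φ b).snd + b • (Φ a).snd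
        rw [map_mul, Dual.snd_mul, hfst, hfst, smul_eq_mul, smul_eq_mul])
  refine ⟨D, fun a => ?_, fun x => ?_⟩
  · change (Φ _).snd = _
    rw [hΦ0, Dual.snd_mk]
  · change (Φ _).snd = _
    rw [hΦ1, Dual.snd_mk]

/-- The derivation of `Sym_A L` extending `d₀` on `A` and `d₁` on `L`. -/
def extend (d₀ : A →+ SymmetricAlgebra A L) (d₁ : L →+ SymmetricAlgebra A L)
    (h₀ : ∀ a b, d₀ (a * b) = algebraMap A _ a * d₀ b + algebraMap A _ b * d₀ a)
    (h₁ : ∀ a x, d₁ (a • x) = algebraMap A _ a * d₁ x + SymmetricAlgebra.ι A L x * d₀ a) :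
    Derivation ℤ (SymmetricAlgebra A L) (SymmetricAlgebra A L) :=
  (exists_derivation d₀ d₁ h₀ h₁).choose

section
variable {d₀ : A →+ SymmetricAlgebra A L} {d₁ : L →+ SymmetricAlgebra A L}
    {h₀ : ∀ a b, d₀ (a * b) = algebraMap A _ a * d₀ b + algebraMap A _ b * d₀ a}
    {h₁ : ∀ a x, d₁ (a • x) = algebraMap A _ a * d₁ x + SymmetricAlgebra.ι A L x * d₀ a}

lemma extend_algebraMap (a : A) : extend d₀ d₁ h₀ h₁ (algebraMap A _ a) = d₀ a :=
  (exists_derivation d₀ d₁ h₀ h₁).choose_spec.1 a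

lemma extend_ι (x : L) : extend d₀ d₁ h₀ h₁ (SymmetricAlgebra.ι A L x) = d₁ x :=
  (exists_derivation d₀ d₁ h₀ h₁).choose_spec.2 x
end

/-- A derivation that has degree `j - 1` on generators has degree `j - 1`. -/
lemma derivation_mem_symPart (D : Derivation ℤ (SymmetricAlgebra A L) (SymmetricAlgebra A L))
    (j : ℕ) (h0 : j = 0 → ∀ a : A, D (algebraMap A _ a) = 0)
    (h0' : ∀ k, j = k + 1 → ∀ a : A, D (algebraMap A _ a) ∈ symPart A L k)
    (h1 : ∀ x : L, D (SymmetricAlgebra.ι A L x) ∈ symPart A L j)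
    {i : ℕ} {a : SymmetricAlgebra A L} (ha : a ∈ symPart A L i) :
    ∀ n, i + j = n + 1 → D a ∈ symPart A L n := by
  induction ha using Submodule.pow_induction_on_left' with
  | algebraMap r => exact fun n hn => h0' n (by omega) r
  | add x y i hx hy ihx ihy =>
    intro n hn
    rw [map_add]
    exact add_mem (ihx n hn) (ihy n hn)
  | mem_mul m hm i x hx ih =>
    intro n hn
    obtain ⟨y, rfl⟩ := hm
    rw [Derivation.leibniz, smul_eq_mul, smul_eq_mul]
    refine add_mem ?_ (mul_mem_symPart (by omega) hx (h1 y))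
    rcases n with _ | n
    · obtain ⟨r, rfl⟩ := exists_algebraMap_of_mem (A := A) (L := L) (b := x)
        (by rw [show i = 0 by omega] at hx; exact hx)
      rw [h0 (by omega), mul_zero]
      exact zero_mem _
    · exact mul_mem_symPart (by omega) (ι_mem_symPart y) (ih n (by omega))

end SymmetricAlgebra

section SymmetricAlgebraBracket

variable {A L : Type*} [CommRing A] [LieRing L] [Module A L]

variable [LieRingModule L A] [LieRinehartRing A L]

/-- `{a, -}` for `a ∈ A`: it is zero on `A` and `{a, x} = -x(a)` for `x ∈ L`. -/
def adScalar (a : A) : Derivation ℤ (SymmetricAlgebra A L) (SymmetricAlgebra A L) :=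
  extend 0
    { toFun := fun x => -algebraMap A _ ⁅x, a⁆
      map_zero' := by simp
      map_add' := fun x y => by simp [add_comm] }
    (fun _ _ => by simp)
    (fun b x => by simp)

/-- `{x, -}` for `x ∈ L`: `{x, b} = x(b)` for `b ∈ A` and `{x, y} = [x, y]` for `y ∈ L`. -/
def adVector (x : L) : Derivation ℤ (SymmetricAlgebra A L) (SymmetricAlgebra A L) :=
  extend
    { toFun := fun b => algebraMap A _ ⁅x, b⁆
      map_zero' := by simp
      map_add' := fun a b => by simp }
    { toFun := fun y => SymmetricAlgebra.ι A L ⁅x, y⁆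
      map_zero' := by simp
      map_add' := fun y z => by simp }
    (fun a b => by simp [mul_comm])
    (fun a y => by simp [Algebra.smul_def, mul_comm])

lemma adScalar_algebraMap (a b : A) : adScalar (L := L) a (algebraMap A _ b) = 0 :=
  extend_algebraMap b

lemma adScalar_ι (a : A) (x : L) :
    adScalar a (SymmetricAlgebra.ι A L x) = -algebraMap A _ ⁅x, a⁆ := extend_ι x

lemma adVector_algebraMap (x : L) (b : A) :
    adVector x (algebraMap A (SymmetricAlgebra A L) b) = algebraMap A _ ⁅x, b⁆ := extend_algebraMap b

lemma adVector_ι (x y : L) :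
    adVector x (SymmetricAlgebra.ι A L y) = SymmetricAlgebra.ι A L ⁅x, y⁆ := extend_ι y

lemma adScalar_add (a b : A) : adScalar (L := L) (a + b) = adScalar a + adScalar b :=
  derivation_ext (fun _ => by simp [adScalar_algebraMap])
    (fun x => by simp [adScalar_ι, add_comm])

lemma adScalar_mul (a b : A) : adScalar (L := L) (a * b) =
    algebraMap A (SymmetricAlgebra A L) a • adScalar b +
      algebraMap A (SymmetricAlgebra A L) b • adScalar a :=
  derivation_ext (fun _ => by simp [adScalar_algebraMap])
    (fun x => by simp [adScalar_ι, Algebra.smul_def]; ring)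

lemma adVector_add (x y : L) : adVector (A := A) (x + y) = adVector x + adVector y :=
  derivation_ext (fun _ => by simp [adVector_algebraMap])
    (fun z => by simp [adVector_ι])

lemma adVector_smul (a : A) (x : L) : adVector (A := A) (a • x) =
    algebraMap A (SymmetricAlgebra A L) a • adVector x +
      SymmetricAlgebra.ι A L x • adScalar a :=
  derivation_ext (fun b => by
      simp [adVector_algebraMap, adScalar_algebraMap, Algebra.smul_def])
    (fun y => by
      have h : ⁅a • x, y⁆ = a • ⁅x, y⁆ - ⁅y, a⁆ • x := by
        rw [← lie_skew, LieRinehartRing.leibniz_smul_right, ← lie_skew x y, smul_neg]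
        abel
      rw [adVector_ι, h]
      simp [adVector_ι, adScalar_ι, Algebra.smul_def]
      ring)

/-- `{-, b}` for `b ∈ Sym_A L`. -/
def adRight (b : SymmetricAlgebra A L) :
    Derivation ℤ (SymmetricAlgebra A L) (SymmetricAlgebra A L) :=
  extend
    { toFun := fun a => adScalar a b
      map_zero' := by simpa using congrArg (· b) (adScalar_add (L := L) (0 : A) 0)
      map_add' := fun a a' => by rw [adScalar_add]; rfl }
    { toFun := fun x => adVector x b
      map_zero' := by simpa using congrArg (· b) (adVector_add (A := A) (0 : L) 0)
      map_add' := fun x y => by rw [adVector_add]; rfl }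
    (fun a a' => by simp [adScalar_mul, Algebra.smul_def])
    (fun a x => by simp [adVector_smul, Algebra.smul_def])

/-- The canonical Poisson bracket on `Sym_A L` (for `L` the vector fields on `Spec A`: on the
functions on the cotangent bundle that are polynomial along the fibres). It is the biderivation
with `{a, b} = 0`, `{x, a} = x(a)` and `{x, y} = [x, y]` for `a, b ∈ A` and `x, y ∈ L`. -/
def symBracket (a b : SymmetricAlgebra A L) : SymmetricAlgebra A L := adRight b a

lemma symBracket_algebraMap_left (a : A) (b : SymmetricAlgebra A L) :
    symBracket (algebraMap A _ a) b = adScalar a b := extend_algebraMap a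

lemma symBracket_ι_left (x : L) (b : SymmetricAlgebra A L) :
    symBracket (SymmetricAlgebra.ι A L x) b = adVector x b := extend_ι x

lemma symBracket_algebraMap_algebraMap (a b : A) :
    symBracket (algebraMap A (SymmetricAlgebra A L) a) (algebraMap A _ b) = 0 := by
  rw [symBracket_algebraMap_left, adScalar_algebraMap]

lemma symBracket_ι_algebraMap (x : L) (a : A) :
    symBracket (SymmetricAlgebra.ι A L x) (algebraMap A _ a) = algebraMap A _ ⁅x, a⁆ := by
  rw [symBracket_ι_left, adVector_algebraMap]

lemma symBracket_ι_ι (x y : L) :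
    symBracket (SymmetricAlgebra.ι A L x) (SymmetricAlgebra.ι A L y) =
      SymmetricAlgebra.ι A L ⁅x, y⁆ := by
  rw [symBracket_ι_left, adVector_ι]

lemma symBracket_add_left (a a' b : SymmetricAlgebra A L) :
    symBracket (a + a') b = symBracket a b + symBracket a' b := map_add _ _ _

lemma symBracket_mul_left (a a' b : SymmetricAlgebra A L) :
    symBracket (a * a') b = a * symBracket a' b + a' * symBracket a b :=
  Derivation.leibniz _ _ _

lemma symBracket_add_right (a b b' : SymmetricAlgebra A L) :
    symBracket a (b + b') = symBracket a b + symBracket a b' := by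
  have : adRight (b + b') = adRight b + adRight b' := derivation_ext
    (fun a => by
      change symBracket _ _ = symBracket _ _ + symBracket _ _
      simp [symBracket_algebraMap_left])
    (fun x => by
      change symBracket _ _ = symBracket _ _ + symBracket _ _
      simp [symBracket_ι_left])
  exact congrArg (· a) this

lemma symBracket_mul_right (a b b' : SymmetricAlgebra A L) :
    symBracket a (b * b') = b * symBracket a b' + b' * symBracket a b := by
  have : adRight (b * b') = b • adRight b' + b' • adRight b := derivation_ext
    (fun a => by
      change symBracket _ _ = b * symBracket _ _ + b' * symBracket _ _
      simp [symBracket_algebraMap_left])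
    (fun x => by
      change symBracket _ _ = b * symBracket _ _ + b' * symBracket _ _
      simp [symBracket_ι_left])
  exact congrArg (· a) this

/-- The bracket has degree `-1`. -/
lemma symBracket_mem_symPart {i j n : ℕ} (h : i + j = n + 1) {a b : SymmetricAlgebra A L}
    (ha : a ∈ symPart A L i) (hb : b ∈ symPart A L j) : symBracket a b ∈ symPart A L n := by
  refine derivation_mem_symPart (adRight b) j ?_ ?_ ?_ ha n h
  · rintro rfl r
    obtain ⟨s, rfl⟩ := exists_algebraMap_of_mem hb
    exact symBracket_algebraMap_algebraMap r s
  · intro k hk r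
    change symBracket _ _ ∈ _
    rw [symBracket_algebraMap_left]
    refine derivation_mem_symPart (adScalar r) 0 (fun _ s => adScalar_algebraMap r s)
      (by omega) (fun x => ?_) hb k (by omega)
    rw [adScalar_ι]
    exact neg_mem (algebraMap_mem_symPart _)
  · intro x
    change symBracket _ _ ∈ _
    rw [symBracket_ι_left]
    refine derivation_mem_symPart (adVector x) 1 (by omega) (fun k hk s => ?_)
      (fun y => ?_) hb j rfl
    · rw [adVector_algebraMap, show k = 0 by omega]
      exact algebraMap_mem_symPart _
    · rw [adVector_ι]
      exact ι_mem_symPart _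

/-- The Poisson bracket of `∏_n Sym^n_A L`: as `{Sym^i, Sym^j} ⊆ Sym^{i+j-1}`, the component of
degree `n` of `{a, b}` is `∑_{i+j=n+1} {a_i, b_j}`. -/
def CompletedSym.bracket (F G : CompletedSym A L) : CompletedSym A L :=
  ⟨PowerSeries.mk fun n => ∑ p ∈ Finset.HasAntidiagonal.antidiagonal (n + 1),
      symBracket (PowerSeries.coeff p.1 F.1) (PowerSeries.coeff p.2 G.1), fun n => by
    rw [PowerSeries.coeff_mk]
    exact sum_mem fun p hp =>
      symBracket_mem_symPart (Finset.HasAntidiagonal.mem_antidiagonal.1 hp) (F.2 _) (G.2 _)⟩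

lemma CompletedSym.coeff_bracket (F G : CompletedSym A L) (n : ℕ) :
    PowerSeries.coeff n (F.bracket G).1 =
      ∑ p ∈ Finset.HasAntidiagonal.antidiagonal (n + 1),
        symBracket (PowerSeries.coeff p.1 F.1) (PowerSeries.coeff p.2 G.1) := by
  change PowerSeries.coeff n (PowerSeries.mk fun n =>
    ∑ p ∈ Finset.HasAntidiagonal.antidiagonal (n + 1),
      symBracket (PowerSeries.coeff p.1 F.1) (PowerSeries.coeff p.2 G.1)) = _
  rw [PowerSeries.coeff_mk]

section Functoriality

variable {A' L' : Type*} [CommRing A'] [LieRing L'] [Module A' L']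
  [LieRingModule L' A'] [LieRinehartRing A' L']

lemma symMap_symBracket (σ : A →+* A')
    (f : L →ₛₗ[σ] L') (hlie : ∀ x y, f ⁅x, y⁆ = ⁅f x, f y⁆)
    (hanchor : ∀ (x : L) (a : A), σ ⁅x, a⁆ = ⁅f x, σ a⁆) (a b : SymmetricAlgebra A L) :
    symMap σ f (symBracket a b) = symBracket (symMap σ f a) (symMap σ f b) := by
  induction a using SymmetricAlgebra.induction with
  | algebraMap r =>
    induction b using SymmetricAlgebra.induction with
    | algebraMap s => simp [symMap_algebraMap, symBracket_algebraMap_algebraMap]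
    | ι y => simp [symMap_algebraMap, symMap_ι, symBracket_algebraMap_left, adScalar_ι, hanchor]
    | mul b b' hb hb' => simp only [map_mul, map_add, symBracket_mul_right, hb, hb']
    | add b b' hb hb' => simp only [map_add, symBracket_add_right, hb, hb']
  | ι x =>
    induction b using SymmetricAlgebra.induction with
    | algebraMap s => simp [symMap_algebraMap, symMap_ι, symBracket_ι_algebraMap, hanchor]
    | ι y => simp [symMap_ι, symBracket_ι_ι, hlie]
    | mul b b' hb hb' => simp only [map_mul, map_add, symBracket_mul_right, hb, hb']
    | add b b' hb hb' => simp only [map_add, symBracket_add_right, hb, hb']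
  | mul a a' ha ha' => simp only [map_mul, map_add, symBracket_mul_left, ha, ha']
  | add a a' ha ha' => simp only [map_add, symBracket_add_left, ha, ha']

lemma CompletedSym.map_bracket (σ : A →+* A')
    (f : L →ₛₗ[σ] L') (hlie : ∀ x y, f ⁅x, y⁆ = ⁅f x, f y⁆)
    (hanchor : ∀ (x : L) (a : A), σ ⁅x, a⁆ = ⁅f x, σ a⁆) (F G : CompletedSym A L) :
    map σ f (F.bracket G) = (map σ f F).bracket (map σ f G) := by
  apply Subtype.ext
  refine PowerSeries.ext fun n => ?_
  change PowerSeries.coeff n (PowerSeries.map (symMap σ f) (F.bracket G).1) = _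
  rw [PowerSeries.coeff_map, coeff_bracket, coeff_bracket, map_sum]
  refine Finset.sum_congr rfl fun p _ => ?_
  rw [symMap_symBracket σ f hlie hanchor]
  change _ = symBracket (PowerSeries.coeff p.1 (PowerSeries.map (symMap σ f) F.1))
    (PowerSeries.coeff p.2 (PowerSeries.map (symMap σ f) G.1))
  rw [PowerSeries.coeff_map, PowerSeries.coeff_map]

end Functoriality

end SymmetricAlgebraBracket
section Schemes

/-- The base `Spec ℂ`. -/
abbrev SpecC : Scheme.{0} := Spec (CommRingCat.of ℂ)

/-- The sections of the structure sheaf of a scheme over `ℂ` form `ℂ`-algebras. -/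
instance sectionsAlgebra (X : Scheme.{0}) [X.Over SpecC] (W : X.Opens) : Algebra ℂ Γ(X, W) :=
  ((Scheme.ΓSpecIso (CommRingCat.of ℂ)).inv ≫
    (X ↘ SpecC).appTop ≫ X.presheaf.map (homOfLE (le_top : W ≤ ⊤)).op).hom.toAlgebra

variable {X Y V : Scheme.{0}} [X.Over SpecC] [Y.Over SpecC] [V.Over SpecC]

/-- Restriction of functions. -/
def res {W W' : X.Opens} (h : W' ≤ W) : Γ(X, W) →ₐ[ℂ] Γ(X, W') where
  __ := (X.presheaf.map (homOfLE h).op).hom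
  commutes' z := by
    change ((Scheme.ΓSpecIso (CommRingCat.of ℂ)).inv ≫ (X ↘ SpecC).appTop ≫
      X.presheaf.map (homOfLE (le_top : W ≤ ⊤)).op ≫ X.presheaf.map (homOfLE h).op).hom z = _
    rw [← Functor.map_comp]
    rfl

lemma res_res {W W' W'' : X.Opens} (h : W' ≤ W) (h' : W'' ≤ W') (f : Γ(X, W)) :
    res h' (res h f) = res (h'.trans h) f := by
  change (X.presheaf.map (homOfLE h).op ≫ X.presheaf.map (homOfLE h').op).hom f = _
  rw [← Functor.map_comp]
  rfl

lemma res_self {W : X.Opens} (h : W ≤ W) (f : Γ(X, W)) : res h f = f := by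
  change (X.presheaf.map (𝟙 _)).hom f = _
  simp

/-! ### Vector fields and 2-forms -/

variable (X) in
/-- The vector fields on an open `W`, as families of derivations of all `Γ(X, W')`, `W' ≤ W`. -/
def vectorFields (W : X.Opens) :
    AddSubgroup (∀ W' : {W' : X.Opens // W' ≤ W}, Derivation ℂ Γ(X, W'.1) Γ(X, W'.1)) where
  carrier := {D | ∀ (W' W'' : {W' : X.Opens // W' ≤ W}) (h : W''.1 ≤ W'.1) (f : Γ(X, W'.1)),
    res h (D W' f) = D W'' (res h f)}
  add_mem' := fun hD hE W' W'' h f => by simp [hD W' W'' h f, hE W' W'' h f]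
  zero_mem' := fun W' W'' h f => by simp
  neg_mem' := fun hD W' W'' h f => by simp [hD W' W'' h f]

variable (X) in
/-- The Lie algebra `Γ(W, T_X)` of vector fields on `W`: the `ℂ`-derivations of the sheaf of
rings `𝒪_X|_W`. -/
def VectorField (W : X.Opens) : Type := vectorFields X W

namespace VectorField

variable {W W' W'' : X.Opens}

instance : AddCommGroup (VectorField X W) := inferInstanceAs (AddCommGroup (vectorFields X W))

/-- The derivation of `Γ(X, W')` given by a vector field on `W ≥ W'`. -/
def der (D : VectorField X W) (W' : X.Opens) (h : W' ≤ W) : Derivation ℂ Γ(X, W') Γ(X, W') :=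
  D.1 ⟨W', h⟩

lemma res_der (D : VectorField X W) (h : W' ≤ W) (h' : W'' ≤ W') (f : Γ(X, W')) :
    res h' (D.der W' h f) = D.der W'' (h'.trans h) (res h' f) :=
  D.2 ⟨W', h⟩ ⟨W'', h'.trans h⟩ h' f

@[ext] lemma ext {D E : VectorField X W} (h : ∀ W' h f, D.der W' h f = E.der W' h f) : D = E :=
  Subtype.ext (funext fun W' => Derivation.ext fun f => h W'.1 W'.2 f)

@[simp] lemma add_der (D E : VectorField X W) (h : W' ≤ W) (f : Γ(X, W')) :
    (D + E).der W' h f = D.der W' h f + E.der W' h f := rfl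

@[simp] lemma zero_der (h : W' ≤ W) (f : Γ(X, W')) :
    (0 : VectorField X W).der W' h f = 0 := rfl

/-- The commutator of derivations. -/
instance : Bracket (VectorField X W) (VectorField X W) where
  bracket D E := ⟨fun W' => ⁅D.1 W', E.1 W'⁆, fun W' W'' h f => by
    have hD := D.2 W' W'' h
    have hE := E.2 W' W'' h
    simp only [Derivation.commutator_apply, map_sub, hD, hE]⟩

lemma lie_der (D E : VectorField X W) (h : W' ≤ W) (f : Γ(X, W')) :
    ⁅D, E⁆.der W' h f = D.der W' h (E.der W' h f) - E.der W' h (D.der W' h f) :=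
  Derivation.commutator_apply _

instance : LieRing (VectorField X W) where
  add_lie D E F := Subtype.ext (funext fun W' => add_lie (D.1 W') (E.1 W') (F.1 W'))
  lie_add D E F := Subtype.ext (funext fun W' => lie_add (D.1 W') (E.1 W') (F.1 W'))
  lie_self D := Subtype.ext (funext fun W' => lie_self (D.1 W'))
  leibniz_lie D E F := Subtype.ext (funext fun W' => leibniz_lie (D.1 W') (E.1 W') (F.1 W'))

instance : SMul Γ(X, W) (VectorField X W) where
  smul a D := ⟨fun W' => res W'.2 a • D.1 W', fun W' W'' h f => by
    have hD := D.2 W' W'' h f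
    simp only [Derivation.smul_apply, smul_eq_mul, map_mul, hD]
    rw [res_res]⟩

@[simp] lemma smul_der (a : Γ(X, W)) (D : VectorField X W) (h : W' ≤ W) (f : Γ(X, W')) :
    (a • D).der W' h f = res h a * D.der W' h f := rfl

instance : Module Γ(X, W) (VectorField X W) where
  one_smul D := by ext; simp
  mul_smul a b D := by ext; simp [mul_assoc]
  smul_zero a := by ext; simp
  smul_add a D E := by ext; simp [mul_add]
  add_smul a b D := by ext; simp [add_mul]
  zero_smul D := by ext; simp

/-- Functions as a module over the vector fields: `⁅D, f⁆ = D(f)`. -/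
instance : LieRingModule (VectorField X W) Γ(X, W) where
  bracket D f := D.der W le_rfl f
  add_lie D E f := rfl
  lie_add D f g := map_add _ _ _
  leibniz_lie D E f := by
    change D.der W _ (E.der W _ f) = ⁅D, E⁆.der W _ f + E.der W _ (D.der W _ f)
    rw [lie_der, sub_add_cancel]

lemma lie_def (D : VectorField X W) (f : Γ(X, W)) : ⁅D, f⁆ = D.der W le_rfl f := rfl

instance : LieRinehartRing Γ(X, W) (VectorField X W) where
  lie_smul_eq_mul' a b D := by simp [lie_def, res_self]
  leibniz_mul_right' D a b := by simp [lie_def, mul_comm]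
  leibniz_smul_right' D E a := by
    ext W' h f
    simp only [lie_der, smul_der, add_der, Derivation.leibniz, smul_eq_mul, lie_def, res_der]
    ring

/-- Restriction of vector fields. -/
def restrict (D : VectorField X W) (h : W' ≤ W) : VectorField X W' :=
  ⟨fun W'' => D.1 ⟨W''.1, W''.2.trans h⟩, fun W₁ W₂ h' f =>
    D.2 ⟨W₁.1, W₁.2.trans h⟩ ⟨W₂.1, W₂.2.trans h⟩ h' f⟩

@[simp] lemma restrict_der (D : VectorField X W) (h : W' ≤ W) (h' : W'' ≤ W') (f : Γ(X, W'')) :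
    (D.restrict h).der W'' h' f = D.der W'' (h'.trans h) f := rfl

/-- Restriction of vector fields, as a semilinear map. -/
def restrictₛₗ (h : W' ≤ W) :
    VectorField X W →ₛₗ[(res h : Γ(X, W) →ₐ[ℂ] Γ(X, W')).toRingHom] VectorField X W' where
  toFun D := D.restrict h
  map_add' D E := rfl
  map_smul' a D := by
    ext W'' h' f
    change res _ a * _ = res _ (res h a) * _
    rw [res_res]
    rfl

end VectorField

variable (X) in
/-- A 2-form, given by its values on vector fields: an alternating `𝒪_X`-bilinear morphism of
sheaves `T_X × T_X → 𝒪_X`. On a smooth `X` these are the sections of `∧² Ω¹_X`. -/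
structure TwoForm where
  app : ∀ W : X.Opens, VectorField X W →ₗ[Γ(X, W)] VectorField X W →ₗ[Γ(X, W)] Γ(X, W)
  app_self : ∀ (W : X.Opens) (D : VectorField X W), app W D D = 0
  res_app : ∀ {W W' : X.Opens} (h : W' ≤ W) (D E : VectorField X W),
    res h (app W D E) = app W' (D.restrict h) (E.restrict h)

namespace TwoForm

/-- The exterior derivative of the 2-form vanishes. -/
def IsClosed (ω : TwoForm X) : Prop :=
  ∀ (W : X.Opens) (D E F : VectorField X W),
    ⁅D, ω.app W E F⁆ - ⁅E, ω.app W D F⁆ + ⁅F, ω.app W D E⁆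
      - ω.app W ⁅D, E⁆ F + ω.app W ⁅D, F⁆ E - ω.app W ⁅E, F⁆ D = 0

/-- The 2-form is non-degenerate: `D ↦ ω(D, -)` is an isomorphism from `T_X` to the sheaf
`ℋom(T_X, 𝒪_X)`, i.e. over each open `W` every morphism of sheaves of modules
`T_X|_W → 𝒪_X|_W` is `ω(D, -)` for a unique vector field `D` on `W`. -/
def IsNondegenerate (ω : TwoForm X) : Prop :=
  ∀ (W : X.Opens) (l : ∀ W' : {W' : X.Opens // W' ≤ W}, VectorField X W'.1 →ₗ[Γ(X, W'.1)] Γ(X, W'.1)),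
    (∀ (W' W'' : {W' : X.Opens // W' ≤ W}) (h : W''.1 ≤ W'.1) (E : VectorField X W'.1),
      res h (l W' E) = l W'' (E.restrict h)) →
    ∃! D : VectorField X W, ∀ (W' : {W' : X.Opens // W' ≤ W}) (E : VectorField X W'.1),
      ω.app W'.1 (D.restrict W'.2) E = l W' E

end TwoForm

variable (X) in
/-- A symplectic form: a closed non-degenerate 2-form. -/
structure SymplecticForm extends TwoForm X where
  isClosed : toTwoForm.IsClosed
  isNondegenerate : toTwoForm.IsNondegenerate

namespace SymplecticForm

variable (ω : SymplecticForm X) {W W' : X.Opens}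

/-- The differential `df` of a function on `W`, as the morphism `T_X|_W → 𝒪_X|_W`, `E ↦ E(f)`. -/
def differential (f : Γ(X, W)) (W' : {W' : X.Opens // W' ≤ W}) :
    VectorField X W'.1 →ₗ[Γ(X, W'.1)] Γ(X, W'.1) where
  toFun E := ⁅E, res W'.2 f⁆
  map_add' E F := add_lie E F _
  map_smul' a E := LieRinehartRing.lie_smul_eq_mul a _ E

lemma exists_unique_hamiltonian (f : Γ(X, W)) :
    ∃! D : VectorField X W, ∀ (W' : {W' : X.Opens // W' ≤ W}) (E : VectorField X W'.1),
      ω.app W'.1 (D.restrict W'.2) E = differential f W' E :=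
  ω.isNondegenerate W (differential f) fun W' W'' h E => by
    change res h (E.der _ _ (res _ f)) = E.der _ _ (res _ f)
    rw [VectorField.res_der, res_res]

/-- The Hamiltonian vector field `X_f`: the vector field corresponding to the 1-form `df` under
the isomorphism `T_X ≅ Ω¹_X`, `D ↦ ω(D, -)`. -/
def hamiltonian (f : Γ(X, W)) : VectorField X W := (ω.exists_unique_hamiltonian f).choose

lemma app_hamiltonian (f : Γ(X, W)) (h : W' ≤ W) (E : VectorField X W') :
    ω.app W' ((ω.hamiltonian f).restrict h) E = ⁅E, res h f⁆ :=
  (ω.exists_unique_hamiltonian f).choose_spec.1 ⟨W', h⟩ E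

lemma restrict_hamiltonian (f : Γ(X, W)) (h : W' ≤ W) :
    (ω.hamiltonian f).restrict h = ω.hamiltonian (res h f) := by
  refine (ω.exists_unique_hamiltonian (res h f)).choose_spec.2 _ fun W'' E => ?_
  change _ = ⁅E, res W''.2 (res h f)⁆
  rw [res_res]
  exact ω.app_hamiltonian f (W''.2.trans h) E

/-- The Poisson bracket `{f, g} = Θ(df ∧ dg) = ω(X_f, X_g)` of functions on `W`, where `Θ` is the
form on `Ω¹_X` that corresponds to `ω` under `T_X ≅ Ω¹_X`. -/
def bracket (f g : Γ(X, W)) : Γ(X, W) := ω.app W (ω.hamiltonian f) (ω.hamiltonian g)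

lemma bracket_eq (f g : Γ(X, W)) : ω.bracket f g = ⁅ω.hamiltonian g, f⁆ := by
  have := ω.app_hamiltonian f le_rfl (ω.hamiltonian g)
  rw [res_self] at this
  exact this

lemma bracket_skew (f g : Γ(X, W)) : ω.bracket f g = -ω.bracket g f := by
  have h := ω.app_self W (ω.hamiltonian f + ω.hamiltonian g)
  simp only [map_add, LinearMap.add_apply, ω.app_self, zero_add, add_zero] at h
  rw [eq_neg_iff_add_eq_zero, add_comm]
  exact h

lemma res_bracket (h : W' ≤ W) (f g : Γ(X, W)) :
    res h (ω.bracket f g) = ω.bracket (res h f) (res h g) := by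
  rw [bracket, ω.res_app, restrict_hamiltonian, restrict_hamiltonian]
  rfl

end SymplecticForm

/-! ### Lagrangian subvarieties and the completion -/

/-- A vector field `D` on the open `W` of `Y` is tangent to `V` and restricts to the vector field
`v` on `V ∩ W`, i.e. `D(f)|_V = v(f|_V)` for all functions `f`. -/
def IsRelated (i : V ⟶ Y) {W : Y.Opens} (D : VectorField Y W) (v : VectorField V (i ⁻¹ᵁ W)) :
    Prop :=
  ∀ (W' : Y.Opens) (h : W' ≤ W) (f : Γ(Y, W')),
    (i.app W').hom (D.der W' h f) = v.der (i ⁻¹ᵁ W') (i.preimage_mono h) ((i.app W').hom f)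

/-- The 2-form `ω` restricts to zero on `V`: `ω(D, D')|_V = 0` if `D` and `D'` restrict to
vector fields `v` and `v'` on `V`, i.e. `ω|_V(v, v') = 0`. -/
def TwoForm.RestrictsToZero (ω : TwoForm Y) (i : V ⟶ Y) : Prop :=
  ∀ (W : Y.Opens) (D D' : VectorField Y W) (v v' : VectorField V (i ⁻¹ᵁ W)),
    IsRelated i D v → IsRelated i D' v' → (i.app W).hom (ω.app W D D') = 0

/-- The restriction map `𝒪_Y/ℐⁿ (W) → 𝒪_Y/ℐᵐ (W')` for affine opens `W' ≤ W` and `m ≤ n`. -/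
def resMod (I : Y.IdealSheafData) {W W' : Y.affineOpens} (h : W'.1 ≤ W.1) {m n : ℕ}
    (hmn : m ≤ n) : (Γ(Y, W.1) ⧸ I.ideal W ^ n) →ₐ[ℂ] (Γ(Y, W'.1) ⧸ I.ideal W' ^ m) :=
  Ideal.quotientMapₐ _ (res h) (by
    refine (Ideal.pow_le_pow_right hmn).trans ?_
    refine le_trans (Ideal.pow_right_mono (I.ideal_le_comap_ideal h) m) ?_
    exact Ideal.le_comap_pow _ m)

lemma resMod_mk (I : Y.IdealSheafData) {W W' : Y.affineOpens} (h : W'.1 ≤ W.1) {m n : ℕ}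
    (hmn : m ≤ n) (f : Γ(Y, W.1)) :
    resMod I h hmn (Ideal.Quotient.mk _ f) = Ideal.Quotient.mk _ (res h f) := rfl

/-- The sections over the open `W` of `V` of the completion `lim_n (𝒪_Y/ℐⁿ)` of `𝒪_Y` along the
ideal `ℐ` of `V`: the compatible families of elements of `Γ(Y, W')/ℐ(W')ⁿ`, where `n` runs
through the natural numbers and `W'` through the affine opens of `Y` with `V ∩ W' ⊆ W`.
(The quasi-coherent sheaf `𝒪_Y/ℐⁿ` has the sections `Γ(Y, W')/ℐ(W')ⁿ` on `W'`, and as it is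
supported on `V`, its restriction to `V` has on `W` the same sections as `𝒪_Y/ℐⁿ` has on the
open `W ∪ (Y ∖ V)` of `Y`.) -/
def completion (i : V ⟶ Y) (W : V.Opens) :
    Subalgebra ℂ (∀ (W' : {W' : Y.affineOpens // i ⁻¹ᵁ W'.1 ≤ W}) (n : ℕ),
      Γ(Y, W'.1.1) ⧸ i.ker.ideal W'.1 ^ n) where
  carrier := {s | ∀ (W₁ W₂ : {W' : Y.affineOpens // i ⁻¹ᵁ W'.1 ≤ W}) (h : W₂.1.1 ≤ W₁.1.1)
    (m n : ℕ) (hmn : m ≤ n), resMod i.ker h hmn (s W₁ n) = s W₂ m}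
  mul_mem' := fun hs ht W₁ W₂ h m n hmn => by
    simp only [Pi.mul_apply, map_mul, hs W₁ W₂ h m n hmn, ht W₁ W₂ h m n hmn]
  add_mem' := fun hs ht W₁ W₂ h m n hmn => by
    simp only [Pi.add_apply, map_add, hs W₁ W₂ h m n hmn, ht W₁ W₂ h m n hmn]
  algebraMap_mem' := fun z W₁ W₂ h m n hmn => by
    simp only [Pi.algebraMap_apply, AlgHom.commutes]

/-- Restriction of sections of the completion. -/
def completionRes (i : V ⟶ Y) {W W' : V.Opens} (h : W' ≤ W) :
    completion i W →ₐ[ℂ] completion i W' where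
  toFun s := ⟨fun W₁ n => s.1 ⟨W₁.1, W₁.2.trans h⟩ n, fun W₁ W₂ h' m n hmn =>
    s.2 ⟨W₁.1, W₁.2.trans h⟩ ⟨W₂.1, W₂.2.trans h⟩ h' m n hmn⟩
  map_one' := rfl
  map_mul' _ _ := rfl
  map_zero' := rfl
  map_add' _ _ := rfl
  commutes' _ := rfl

/-- A derivation maps `Iⁿ⁺¹` into `Iⁿ`. -/
lemma derivation_pow_mem {R : Type*} [CommRing R] [Algebra ℂ R] (D : Derivation ℂ R R)
    (I : Ideal R) (n : ℕ) : ∀ f ∈ I ^ (n + 1), D f ∈ I ^ n := by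
  induction n with
  | zero => simp
  | succ n ih =>
    intro f hf
    rw [pow_succ] at hf
    refine Submodule.mul_induction_on hf (fun a ha b hb => ?_) fun a b ha hb => ?_
    · rw [Derivation.leibniz]
      refine add_mem (Ideal.mul_mem_right _ _ ha) ?_
      rw [pow_succ, mul_comm]
      exact Ideal.mul_mem_mul hb (ih a ha) |> fun h => by rwa [smul_eq_mul]
    · rw [map_add]
      exact add_mem ha hb

/-- `{-, -}` is well defined as a map `𝒪_Y/ℐⁿ⁺¹ × 𝒪_Y/ℐⁿ⁺¹ → 𝒪_Y/ℐⁿ`. -/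
lemma SymplecticForm.bracket_congr (ω : SymplecticForm X) {W : X.Opens} (I : Ideal Γ(X, W))
    {n : ℕ} {f f' g g' : Γ(X, W)}
    (hf : Ideal.Quotient.mk (I ^ (n + 1)) f = Ideal.Quotient.mk _ f')
    (hg : Ideal.Quotient.mk (I ^ (n + 1)) g = Ideal.Quotient.mk _ g') :
    Ideal.Quotient.mk (I ^ n) (ω.bracket f g) = Ideal.Quotient.mk _ (ω.bracket f' g') := by
  have key : ∀ (f f' g : Γ(X, W)), Ideal.Quotient.mk (I ^ (n + 1)) f = Ideal.Quotient.mk _ f' →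
      Ideal.Quotient.mk (I ^ n) (ω.bracket f g) = Ideal.Quotient.mk _ (ω.bracket f' g) := by
    intro f f' g h
    rw [Ideal.Quotient.mk_eq_mk_iff_sub_mem] at h ⊢
    rw [ω.bracket_eq, ω.bracket_eq, ← lie_sub]
    exact derivation_pow_mem ((ω.hamiltonian g).der W le_rfl) I n _ h
  rw [key f f' g hf, ω.bracket_skew f' g, ω.bracket_skew f' g', map_neg, map_neg,
    key g g' f' hg]

/-- The Poisson bracket of the completion, induced by the brackets
`𝒪_Y/ℐⁿ⁺¹ × 𝒪_Y/ℐⁿ⁺¹ → 𝒪_Y/ℐⁿ`. -/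
def completionBracket (ω : SymplecticForm Y) (i : V ⟶ Y) {W : V.Opens} (s t : completion i W) :
    completion i W :=
  ⟨fun W' n => Ideal.Quotient.mk _ (ω.bracket (Quotient.out (s.1 W' (n + 1)))
    (Quotient.out (t.1 W' (n + 1)))), fun W₁ W₂ h m n hmn => by
    have out_mk : ∀ (W' : {W' : Y.affineOpens // i ⁻¹ᵁ W'.1 ≤ W}) (n : ℕ)
        (x : Γ(Y, W'.1.1) ⧸ i.ker.ideal W'.1 ^ n),
        Ideal.Quotient.mk (i.ker.ideal W'.1 ^ n) (Quotient.out x) = x :=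
      fun W' n x => Quotient.out_eq x
    rw [resMod_mk, ω.res_bracket]
    refine ω.bracket_congr _ ?_ ?_
    · rw [← resMod_mk i.ker h (Nat.succ_le_succ hmn), out_mk, out_mk]
      exact s.2 W₁ W₂ h _ _ _
    · rw [← resMod_mk i.ker h (Nat.succ_le_succ hmn), out_mk, out_mk]
      exact t.2 W₁ W₂ h _ _ _⟩

/-! ### The sheaf `∏_n Sym^n T_V` -/

/-- Restriction `∏_n Sym^n T_V (W) → ∏_n Sym^n T_V (W')` for affine opens `W' ≤ W`. -/
def symRes {W W' : V.Opens} (h : W' ≤ W) :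
    CompletedSym Γ(V, W) (VectorField V W) →ₐ[ℂ] CompletedSym Γ(V, W') (VectorField V W') where
  __ := CompletedSym.map (res h : Γ(V, W) →ₐ[ℂ] Γ(V, W')).toRingHom (VectorField.restrictₛₗ h)
  commutes' z := by
    refine (CompletedSym.map_algebraMap _ _ _).trans ?_
    change algebraMap _ _ (res h (algebraMap ℂ _ z)) = _
    rw [AlgHom.commutes]
    rfl

lemma symRes_bracket {W W' : V.Opens} (h : W' ≤ W)
    (F G : CompletedSym Γ(V, W) (VectorField V W)) :
    symRes h (F.bracket G) = (symRes h F).bracket (symRes h G) :=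
  CompletedSym.map_bracket _ _ (fun _ _ => rfl) (fun D f => by
    change res h (D.der W _ f) = D.der W' _ (res h f)
    rw [VectorField.res_der]) F G

variable (V) in
/-- The sections over the open `W` of the sheaf `∏_n Sym^n T_V`: the compatible families of
elements of `∏_n Sym^n Γ(W', T_V)`, where `W'` runs through the affine opens contained in `W`.
(On a smooth `V` the sheaf `Sym^n T_V` is quasi-coherent, with sections the `n`-th symmetric
power of the `Γ(V, W')`-module `Γ(W', T_V)` on an affine open `W'`.) -/
def symSections (W : V.Opens) :
    Subalgebra ℂ (∀ W' : {W' : V.affineOpens // W'.1 ≤ W},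
      CompletedSym Γ(V, W'.1.1) (VectorField V W'.1.1)) where
  carrier := {s | ∀ (W₁ W₂ : {W' : V.affineOpens // W'.1 ≤ W}) (h : W₂.1.1 ≤ W₁.1.1),
    symRes h (s W₁) = s W₂}
  mul_mem' := fun hs ht W₁ W₂ h => by
    simp only [Pi.mul_apply, map_mul, hs W₁ W₂ h, ht W₁ W₂ h]
  add_mem' := fun hs ht W₁ W₂ h => by
    simp only [Pi.add_apply, map_add, hs W₁ W₂ h, ht W₁ W₂ h]
  algebraMap_mem' := fun z W₁ W₂ h => by
    simp only [Pi.algebraMap_apply, AlgHom.commutes]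

/-- Restriction of sections of `∏_n Sym^n T_V`. -/
def symSectionsRes {W W' : V.Opens} (h : W' ≤ W) : symSections V W →ₐ[ℂ] symSections V W' where
  toFun s := ⟨fun W₁ => s.1 ⟨W₁.1, W₁.2.trans h⟩, fun W₁ W₂ h' =>
    s.2 ⟨W₁.1, W₁.2.trans h⟩ ⟨W₂.1, W₂.2.trans h⟩ h'⟩
  map_one' := rfl
  map_mul' _ _ := rfl
  map_zero' := rfl
  map_add' _ _ := rfl
  commutes' _ := rfl

/-- The Poisson bracket of `∏_n Sym^n T_V`. -/
def symSectionsBracket {W : V.Opens} (s t : symSections V W) : symSections V W :=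
  ⟨fun W' => (s.1 W').bracket (t.1 W'), fun W₁ W₂ h => by
    rw [symRes_bracket, s.2 W₁ W₂ h, t.2 W₁ W₂ h]⟩

/-- An isomorphism of sheaves of Poisson algebras over the open `U` of `V`, from the completion
of `𝒪_Y` along `V` to `∏_n Sym^n T_U`. -/
structure PoissonIso (ω : SymplecticForm Y) (i : V ⟶ Y) (U : V.Opens) where
  equiv : ∀ W : V.Opens, W ≤ U → (completion i W ≃ₐ[ℂ] symSections V W)
  equiv_res : ∀ {W W' : V.Opens} (hW : W ≤ U) (h : W' ≤ W) (s : completion i W),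
    equiv W' (h.trans hW) (completionRes i h s) = symSectionsRes h (equiv W hW s)
  equiv_bracket : ∀ {W : V.Opens} (hW : W ≤ U) (s t : completion i W),
    equiv W hW (completionBracket ω i s t) = symSectionsBracket (equiv W hW s) (equiv W hW t)

end Schemes

end LagrangianNeighborhood

end

set_option linter.unusedSectionVars false

/-! The heart of the proof is a formal Darboux theorem along `V`. Let `A` be the functions on a
small affine open of `V` with coordinates `u` and coordinate fields `∂_i`, let `B` be the completion
over it, `ε : B → A` the restriction to `V`, and `F n` the filtration of `B` by powers of the ideal.
The bracket lowers the filtration by at most one.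

Geometry enters three times. As `V` is isotropic, each `∂_j` is, up to sign, the restriction of the
Hamiltonian field of a function vanishing on `V` (`exists_hamiltonian_eq`). As `V` has half the
dimension, it is also coisotropic (`pull_bracket_eq_zero`). A function on which both `V` and the
brackets with lifts of the coordinates vanish lies in the square of the ideal
(`mem_ker_sq_of_bracket_eq_zero`).

The algebraic tool is a formal Poincaré lemma, `exists_potential`: given commuting derivations `D_i`
that lower the filtration by one and `η_j ∈ F 1` with `D_i η_j ≡ δ_ij` modulo `F 1`, every closed
system `D_i g = m_i` has a solution of one order higher. For `D_i = {-, x_i}` it is used to turn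
lifts of `u` into Poisson commuting `x`, to find conjugate elements `y ∈ F 1` (both in
`exists_darboux`), and to correct a lift of any `a ∈ A` to an element commuting with all `x`
(`exists_constant`). The last lift is unique: the Euler derivation `∑ {-, x_i} y_i` acts as `n` on
`F n / F (n+1)`, so in characteristic zero no nonzero element of `F 1` commutes with all `x`. This
gives an algebra section `sec` of `ε`. The Jacobi identity and the same uniqueness force `{y_i, y_j}
= 0`, `{sec a, sec b} = 0` and `{y_i, sec a} = sec (∂_i a)`.

Hence `a ↦ sec a`, `v ↦ ∑ sec (v u_i) y_i` defines a Poisson map `Sym_A T → B`. It is bijective on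
graded pieces (`eq_zero_of_symHom_mem`, `exists_symPart`), and completeness gives an isomorphism
`limitEquiv` from `∏ Sym^n`.

This isomorphism depends only on `x` and `y`. These are chosen once on an open `U` and then
restricted, so the isomorphisms over the traces of affine opens of `Y` commute with restriction
(`limitEquiv_map`). The remaining point is that the completion is described by affine opens of `Y`
and `∏ Sym^n T_V` by affine opens of `V`; the sections of the latter are glued from traces by gluing
their coefficients in the frame `∂_i` (`exists_completedSym`). -/

namespace LagrangianNeighborhood

/-! ### Complete filtered algebras and commuting derivations -/

section Filtration

variable {B : Type*} [CommRing B] [Algebra ℂ B]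

/-- A decreasing multiplicative filtration by ideals for which `B` is complete and separated. -/
structure IsCompleteFiltration (F : ℕ → Ideal B) : Prop where
  zero : F 0 = ⊤
  anti : Antitone F
  mul : ∀ {m n : ℕ} {a b : B}, a ∈ F m → b ∈ F n → a * b ∈ F (m + n)
  sep : ∀ {f : B}, (∀ n, f ∈ F n) → f = 0
  complete : ∀ f : ℕ → B, (∀ n, f (n + 1) - f n ∈ F n) → ∃ g, ∀ n, g - f n ∈ F n

namespace IsCompleteFiltration

variable {F : ℕ → Ideal B} (hF : IsCompleteFiltration F)

include hF

lemma mem_zero (f : B) : f ∈ F 0 := by rw [hF.zero]; trivial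

lemma pow_mem_of_mem_one {y : B} (hy : y ∈ F 1) (n : ℕ) : y ^ n ∈ F n := by
  induction n with
  | zero => exact hF.mem_zero _
  | succ n ih => rw [pow_succ]; exact hF.mul ih hy

lemma iterate_mem (D : Derivation ℂ B B) (hD : ∀ n, ∀ f ∈ F (n + 1), D f ∈ F n) {n : ℕ} (k : ℕ) :
    ∀ {m : B}, m ∈ F (k + n) → D^[k] m ∈ F n := by
  induction k with
  | zero => intro m hm; simpa using hm
  | succ k ih =>
    intro m hm
    rw [Function.iterate_succ_apply]
    exact ih (hD _ _ (by rwa [Nat.add_right_comm] at hm))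

/-- The image of `m` under a right inverse of `D` up to higher order terms. -/
lemma exists_approx_antiderivative (D : Derivation ℂ B B)
    (hD : ∀ n, ∀ f ∈ F (n + 1), D f ∈ F n) (S : Subalgebra ℂ B) (hS : ∀ f ∈ S, D f ∈ S)
    {y : B} (hy : y ∈ F 1) (hyS : y ∈ S) (hDy : D y - 1 ∈ F 1) {n : ℕ} {m : B} (hm : m ∈ F n)
    (hmS : m ∈ S) : ∃ g ∈ F (n + 1), g ∈ S ∧ m - D g ∈ F (n + 1) := by
  have hit : ∀ k, D^[k] m ∈ S := fun k => by
    induction k with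
    | zero => exact hmS
    | succ k ih => rw [Function.iterate_succ_apply']; exact hS _ ih
  have hyk : ∀ k ≤ n, y ^ k * D^[k] m ∈ F n := fun k hk => by
    have := hF.mul (hF.pow_mem_of_mem_one hy k) (hF.iterate_mem D hD (n := n - k) k (m := m)
      (by rwa [Nat.add_sub_cancel' hk]))
    rwa [Nat.add_sub_cancel' hk] at this
  -- Repeated integration by parts: `∑_{j<N} (-1)^j y^(j+1) D^j m / (j+1)!` has derivative `m` up to
  -- the remainder displayed here and errors coming from `D y - 1 ∈ F 1`. At `N = n + 1` the
  -- remainder has the factor `y^(n+1) ∈ F (n+1)`.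
  have key : ∀ N ≤ n + 1, ∃ g ∈ F (n + 1), g ∈ S ∧ ∃ e ∈ F (n + 1),
      m - D g = e + ((-1 : ℂ) ^ N * (N.factorial : ℂ)⁻¹) • (y ^ N * D^[N] m) := by
    intro N
    induction N with
    | zero => intro _; exact ⟨0, zero_mem _, zero_mem _, 0, zero_mem _, by simp⟩
    | succ N ih =>
      intro hN
      obtain ⟨g, hg, hgS, e, he, h⟩ := ih (by omega)
      set c : ℂ := (-1 : ℂ) ^ N * (N.factorial : ℂ)⁻¹ with hc
      set c' : ℂ := (-1 : ℂ) ^ N * ((N + 1).factorial : ℂ)⁻¹ with hc'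
      have hcc : c' * ((N + 1 : ℕ) : ℂ) = c := by
        rw [hc, hc', Nat.factorial_succ, Nat.cast_mul, mul_inv]
        have : ((N + 1 : ℕ) : ℂ) ≠ 0 := Nat.cast_ne_zero.2 (by omega)
        field_simp
      have hmem : y ^ (N + 1) * D^[N] m ∈ F (n + 1) := by
        rw [pow_succ', mul_assoc, add_comm n]
        exact hF.mul hy (hyk N (by omega))
      refine ⟨g + c' • (y ^ (N + 1) * D^[N] m), add_mem hg (Submodule.smul_of_tower_mem _ _ hmem),
        add_mem hgS (S.smul_mem (mul_mem (pow_mem hyS _) (hit _)) _),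
        e - c • ((D y - 1) * (y ^ N * D^[N] m)), sub_mem he (Submodule.smul_of_tower_mem _ _ ?_), ?_⟩
      · rw [add_comm n]; exact hF.mul hDy (hyk N (by omega))
      · rw [map_add, ← sub_sub, h, Derivation.map_smul, Derivation.leibniz,
          Derivation.leibniz_pow, ← Function.iterate_succ_apply' (f := D), Nat.add_sub_cancel]
        simp only [smul_eq_mul, nsmul_eq_mul, smul_add]
        rw [← hcc, show ((-1 : ℂ) ^ (N + 1) * ((N + 1).factorial : ℂ)⁻¹) = -c' by
          rw [hc', pow_succ]; ring]
        simp only [Algebra.smul_def, map_mul, map_neg, map_natCast]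
        ring
  obtain ⟨g, hg, hgS, e, he, h⟩ := key (n + 1) le_rfl
  refine ⟨g, hg, hgS, ?_⟩
  rw [h]
  exact add_mem he (Submodule.smul_of_tower_mem _ _
    (Ideal.mul_mem_right _ _ (hF.pow_mem_of_mem_one hy _)))

/-- Successive approximation: a continuous additive equation that is solvable up to higher order
terms is solvable. -/
lemma exists_antiderivative (D : Derivation ℂ B B)
    (hD : ∀ n, ∀ f ∈ F (n + 1), D f ∈ F n) (S : Subalgebra ℂ B) (hS : ∀ f ∈ S, D f ∈ S)
    (hScl : ∀ g, (∀ n, ∃ s ∈ S, g - s ∈ F n) → g ∈ S)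
    {y : B} (hy : y ∈ F 1) (hyS : y ∈ S) (hDy : D y - 1 ∈ F 1) {n : ℕ} {m : B} (hm : m ∈ F n)
    (hmS : m ∈ S) : ∃ g ∈ F (n + 1), g ∈ S ∧ D g = m := by
  classical
  -- A correction for every residue of order `n + k` in `S`; the value `0` elsewhere only makes the
  -- choice a total function.
  have step : ∀ k, ∀ r : B, ∃ g, r ∈ F (n + k) → r ∈ S →
      g ∈ F (n + k + 1) ∧ g ∈ S ∧ r - D g ∈ F (n + k + 1) := by
    intro k r
    by_cases h : r ∈ F (n + k) ∧ r ∈ S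
    · obtain ⟨g, h1, h2, h3⟩ := hF.exists_approx_antiderivative D hD S hS hy hyS hDy h.1 h.2
      exact ⟨g, fun _ _ => ⟨h1, h2, h3⟩⟩
    · exact ⟨0, fun a b => absurd ⟨a, b⟩ h⟩
  choose c hc using step
  -- Partial sums of the corrections: each step solves for the current residue and raises its order
  -- by one.
  let G : ℕ → B := fun k => Nat.rec 0 (fun k g => g + c k (m - D g)) k
  have hG : ∀ k, G (k + 1) = G k + c k (m - D (G k)) := fun k => rfl
  have inv : ∀ k, G k ∈ S ∧ G k ∈ F (n + 1) ∧ m - D (G k) ∈ F (n + k) := by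
    intro k
    induction k with
    | zero => exact ⟨zero_mem _, zero_mem _, by simpa [G] using hm⟩
    | succ k ih =>
      obtain ⟨h1, h2, h3⟩ := hc k (m - D (G k)) ih.2.2 (sub_mem hmS (hS _ ih.1))
      rw [hG]
      refine ⟨add_mem ih.1 h2, add_mem ih.2.1 (hF.anti (by omega) h1), ?_⟩
      rw [map_add, ← sub_sub]
      exact h3
  obtain ⟨g, hg⟩ := hF.complete G (fun k => by
    rw [hG, add_sub_cancel_left]
    exact hF.anti (by omega) (hc k (m - D (G k)) (inv k).2.2 (sub_mem hmS (hS _ (inv k).1))).1)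
  refine ⟨g, ?_, hScl g fun k => ⟨G k, (inv k).1, hg k⟩, ?_⟩
  · have := add_mem (hg (n + 1)) (inv (n + 1)).2.1
    rwa [sub_add_cancel] at this
  · rw [← sub_eq_zero]
    refine hF.sep fun k => ?_
    have h1 := hD k _ (hg (k + 1))
    have h2 := hF.anti (by omega : k ≤ n + k) (inv k).2.2
    have h3 := hF.anti (by omega : k ≤ n + (k + 1)) (inv (k + 1)).2.2
    have : D g - m = D (g - G (k + 1)) - (m - D (G (k + 1))) := by rw [map_sub]; ring
    rw [this]
    exact sub_mem h1 h3

/-- The Poincaré lemma for commuting derivations that lower the filtration by one. -/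
theorem exists_potential {k : ℕ} (D : Fin k → Derivation ℂ B B)
    (hD : ∀ i n, ∀ f ∈ F (n + 1), D i f ∈ F n) (hcomm : ∀ i j f, D i (D j f) = D j (D i f))
    (η : Fin k → B) (hη : ∀ i, η i ∈ F 1)
    (hDη : ∀ i j, D i (η j) - (if i = j then 1 else 0) ∈ F 1) {n : ℕ} (m : Fin k → B)
    (hm : ∀ i, m i ∈ F n) (hcompat : ∀ i j, D i (m j) = D j (m i)) :
    ∃ g ∈ F (n + 1), ∀ i, D i g = m i := by
  induction k generalizing n with
  | zero => exact ⟨0, zero_mem _, fun i => i.elim0⟩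
  | succ k ih =>
    have ih' : ∀ {n : ℕ} (m : Fin k → B), (∀ i, m i ∈ F n) →
        (∀ i j, D i.castSucc (m j) = D j.castSucc (m i)) →
        ∃ g ∈ F (n + 1), ∀ i : Fin k, D i.castSucc g = m i := fun m h1 h2 =>
      ih (fun i => D i.castSucc) (fun i => hD _) (fun i j => hcomm _ _)
        (fun i => η i.castSucc) (fun i => hη _)
        (fun i j => by simpa using hDη i.castSucc j.castSucc) m h1 h2
    -- After solving the first `k` equations, the defect of the last one is annihilated by the first
    -- `k` derivations. It is removed inside their common kernel `S`, which does not disturb the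
    -- equations already solved.
    obtain ⟨g₀, hg₀, hDg₀⟩ := ih' (fun i => m i.castSucc) (fun i => hm _) (fun i j => hcompat _ _)
    let S : Subalgebra ℂ B :=
      { carrier := {f | ∀ i : Fin k, D i.castSucc f = 0}
        mul_mem' := fun {a b} ha hb i => by simp [Derivation.leibniz, ha i, hb i]
        add_mem' := fun {a b} ha hb i => by simp [ha i, hb i]
        algebraMap_mem' := fun z i => by simp }
    have hS : ∀ f ∈ S, D (Fin.last k) f ∈ S := fun f hf i => by rw [hcomm, hf i, map_zero]
    -- The derivations are continuous for the filtration, so their common kernel is closed.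
    have hScl : ∀ g, (∀ n, ∃ s ∈ S, g - s ∈ F n) → g ∈ S := fun g hg i => hF.sep fun n => by
      obtain ⟨s, hs, hgs⟩ := hg (n + 1)
      have := hD i.castSucc n _ hgs
      rwa [map_sub, hs i, sub_zero] at this
    -- The last `η` need not lie in `S`. Its derivatives in the first `k` directions lie in `F 1`,
    -- so they have a potential `h ∈ F 2`; then `η - h` lies in `S`, and its last derivative is
    -- still `1` modulo `F 1`.
    obtain ⟨h, hh, hDh⟩ := ih' (n := 1) (fun i => D i.castSucc (η (Fin.last k)))
      (fun i => by simpa [(Fin.castSucc_lt_last i).ne] using hDη i.castSucc (Fin.last k))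
      (fun i j => hcomm _ _ _)
    obtain ⟨g₁, hg₁, hg₁S, hDg₁⟩ := hF.exists_antiderivative (D (Fin.last k)) (hD _) S hS hScl
      (y := η (Fin.last k) - h) (sub_mem (hη _) (hF.anti (by omega) hh))
      (fun i => by rw [map_sub, hDh, sub_self])
      (by
        have h1 := hDη (Fin.last k) (Fin.last k)
        rw [if_pos rfl] at h1
        rw [map_sub, sub_right_comm]
        exact sub_mem h1 (hD _ _ _ hh))
      (n := n) (m := m (Fin.last k) - D (Fin.last k) g₀) (sub_mem (hm _) (hD _ _ _ hg₀))
      (fun i => by rw [map_sub, hcompat, hcomm, hDg₀, sub_self])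
    refine ⟨g₀ + g₁, add_mem hg₀ hg₁, fun i => ?_⟩
    refine Fin.lastCases ?_ (fun i => ?_) i
    · rw [map_add, hDg₁]; ring
    · rw [map_add, hDg₀, hg₁S i, add_zero]

end IsCompleteFiltration

end Filtration

end LagrangianNeighborhood

namespace LagrangianNeighborhood

/-! ### Filtered Poisson algebras and Darboux coordinates -/

section FilteredPoisson

variable {B : Type*} [CommRing B] [Algebra ℂ B]

/-- A Poisson bracket that lowers the filtration `F` by at most one. `ham g f` is `{f, g}`. -/
structure FilteredPoisson (F : ℕ → Ideal B) where
  ham : B → Derivation ℂ B B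
  skew : ∀ f g, ham g f = -ham f g
  jacobi : ∀ f g h, ham h (ham g f) = ham g (ham h f) + ham (ham h g) f
  filt : ∀ g n, ∀ f ∈ F (n + 1), ham g f ∈ F n

namespace FilteredPoisson

variable {F : ℕ → Ideal B} (P : FilteredPoisson F)

lemma ham_add (g g' f : B) : P.ham (g + g') f = P.ham g f + P.ham g' f := by
  rw [P.skew, map_add, P.skew g, P.skew g']; ring

lemma ham_sub (g g' f : B) : P.ham (g - g') f = P.ham g f - P.ham g' f := by
  rw [P.skew, map_sub, P.skew g, P.skew g']; ring

lemma ham_sum {ι : Type*} (s : Finset ι) (g : ι → B) (f : B) :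
    P.ham (∑ i ∈ s, g i) f = ∑ i ∈ s, P.ham (g i) f := by
  rw [P.skew, map_sum, ← Finset.sum_neg_distrib]
  exact Finset.sum_congr rfl fun i _ => (P.skew _ _).symm

lemma ham_mul (g g' f : B) : P.ham (g * g') f = g * P.ham g' f + g' * P.ham g f := by
  rw [P.skew, Derivation.leibniz, P.skew g, P.skew g']; simp only [smul_eq_mul]; ring

lemma ham_zero (f : B) : P.ham 0 f = 0 := by
  rw [P.skew, map_zero, neg_zero]

lemma ham_self (f : B) : P.ham f f = 0 := by
  have h := P.skew f f
  have h2 : (2 : ℂ) • P.ham f f = 0 := by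
    rw [two_smul]; nth_rw 1 [h]; exact neg_add_cancel _
  simpa using h2

lemma filt_right {n : ℕ} (f : B) {g : B} (hg : g ∈ F (n + 1)) : P.ham g f ∈ F n := by
  rw [P.skew]; exact neg_mem (P.filt f n g hg)

lemma ham_congr {n : ℕ} {f f' g g' : B} (hf : f - f' ∈ F (n + 1)) (hg : g - g' ∈ F (n + 1)) :
    P.ham g f - P.ham g' f' ∈ F n := by
  have : P.ham g f - P.ham g' f' = P.ham g (f - f') + P.ham (g - g') f' := by
    rw [map_sub, P.ham_sub]; ring
  rw [this]
  exact add_mem (P.filt _ _ _ hf) (P.filt_right _ hg)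

/-- Functions with Poisson commuting Hamiltonians have commuting Hamiltonian derivations. -/
lemma ham_comm {g h : B} (hgh : P.ham h g = 0) (f : B) :
    P.ham h (P.ham g f) = P.ham g (P.ham h f) := by
  rw [P.jacobi, hgh, P.ham_zero, add_zero]

variable {A : Type*} [CommRing A] [Algebra ℂ A]

/-- Existence of Darboux coordinates: coordinates `u` modulo `F 1` lift to Poisson commuting
elements `x`, and there are conjugate elements `y` in `F 1`. -/
theorem exists_darboux (hF : IsCompleteFiltration F) (ε : B →ₐ[ℂ] A)
    (hε : Function.Surjective ε) (hker : ∀ f, ε f = 0 ↔ f ∈ F 1) {d : ℕ} (u : Fin d → A)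
    (η : Fin d → B) (hη : ∀ i, η i ∈ F 1)
    (hηu : ∀ i j x, ε x = u j → ε (P.ham x (η i)) = if i = j then 1 else 0) :
    ∃ x y : Fin d → B, (∀ i, ε (x i) = u i) ∧ (∀ i, y i ∈ F 1) ∧
      (∀ i j, P.ham (x i) (x j) = 0) ∧
      ∀ i j, P.ham (x j) (y i) = if i = j then 1 else 0 := by
  have hmod : ∀ (x : Fin d → B), (∀ i, ε (x i) = u i) → ∀ i j,
      P.ham (x i) (η j) - (if i = j then 1 else 0) ∈ F 1 := by
    intro x hx i j
    rw [← hker, map_sub, hηu j i _ (hx i)]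
    by_cases h : i = j
    · simp [h]
    · simp [h, Ne.symm h]
  -- Make the lifts commute one at a time. Once the first `k` commute, their Hamiltonian derivations
  -- commute, so the brackets of the next lift with them form a closed system; subtracting a
  -- potential kills these brackets. The potential lies in `F 1`, so the image under `ε` is
  -- unchanged.
  have key : ∀ k ≤ d, ∃ x : Fin d → B, (∀ i, ε (x i) = u i) ∧
      ∀ i j : Fin d, i.1 < k → j.1 < k → P.ham (x i) (x j) = 0 := by
    intro k
    induction k with
    | zero =>
      intro _
      choose x hx using fun i => hε (u i)
      exact ⟨x, hx, fun i _ hi => absurd hi (by omega)⟩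
    | succ k ih =>
      intro hk
      obtain ⟨x, hx, hxx⟩ := ih (by omega)
      let e : Fin k → Fin d := Fin.castLE (by omega)
      have hxx' : ∀ i j, P.ham (x (e i)) (x (e j)) = 0 := fun i j => hxx _ _ i.2 j.2
      obtain ⟨g, hg, hDg⟩ := hF.exists_potential (fun i => P.ham (x (e i))) (fun i => P.filt _)
        (fun i j => P.ham_comm (hxx' i j)) (fun i => η (e i))
        (fun i => hη _) (fun i j => by
          have := hmod x hx (e i) (e j)
          simpa [e, Fin.ext_iff] using this) (n := 0)
        (fun i => P.ham (x (e i)) (x ⟨k, hk⟩)) (fun i => hF.mem_zero _)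
        (fun i j => P.ham_comm (hxx' i j) _)
      have hz : ∀ i : Fin d, i.1 < k → P.ham (x i) (x ⟨k, hk⟩ - g) = 0 := fun i hi => by
        rw [map_sub, sub_eq_zero]
        exact (hDg ⟨i.1, hi⟩).symm
      refine ⟨Function.update x ⟨k, hk⟩ (x ⟨k, hk⟩ - g), fun i => ?_, fun i j hi hj => ?_⟩
      · by_cases h : i = ⟨k, hk⟩
        · subst h
          rw [Function.update_self, map_sub, hx, (hker g).2 hg, sub_zero]
        · rw [Function.update_of_ne h, hx]
      · by_cases h : i = ⟨k, hk⟩ <;> by_cases h' : j = ⟨k, hk⟩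
        · subst h; subst h'
          exact P.ham_self _
        · subst h
          rw [Function.update_self, Function.update_of_ne h', P.skew, hz, neg_zero]
          have : j.1 ≠ k := fun e => h' (Fin.ext e)
          omega
        · subst h'
          rw [Function.update_self, Function.update_of_ne h, hz]
          have : i.1 ≠ k := fun e => h (Fin.ext e)
          omega
        · rw [Function.update_of_ne h, Function.update_of_ne h']
          have : i.1 ≠ k := fun e => h (Fin.ext e)
          have : j.1 ≠ k := fun e => h' (Fin.ext e)
          exact hxx _ _ (by omega) (by omega)
  obtain ⟨x, hx, hxx⟩ := key d le_rfl
  have hxx' : ∀ i j, P.ham (x i) (x j) = 0 := fun i j => hxx i j i.2 j.2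
  -- The right-hand sides are constants, so this system is closed.
  have hy : ∀ i, ∃ y ∈ F 1, ∀ j, P.ham (x j) y = if i = j then 1 else 0 := fun i =>
    hF.exists_potential (fun i => P.ham (x i)) (fun i => P.filt _)
      (fun i j => P.ham_comm (hxx' i j)) η hη (hmod x hx) (n := 0)
      (fun j => if i = j then 1 else 0) (fun i => hF.mem_zero _) (fun j l => by
        split_ifs <;> simp)
  choose y hy hyx using hy
  exact ⟨x, y, hx, hy, hxx', hyx⟩

end FilteredPoisson

end FilteredPoisson

/-! ### The formal cotangent bundle in Darboux coordinates -/

section FormalChart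

variable (A L B : Type*) [CommRing A] [Algebra ℂ A] [LieRing L] [Module A L] [LieRingModule L A]
  [LieRinehartRing A L] [CommRing B] [Algebra ℂ B] (d : ℕ)

/-- A complete Poisson algebra `B` with quotient `A = B / F 1`, coordinates `u` on `A` with
coordinate vector fields `∂`, and Darboux coordinates `x`, `y` on `B` such that `x` lifts `u` and
`y` generates the filtration. -/
structure FormalChart where
  F : ℕ → Ideal B
  complete : IsCompleteFiltration F
  P : FilteredPoisson F
  ε : B →ₐ[ℂ] A
  ε_surjective : Function.Surjective ε
  ε_eq_zero : ∀ f, ε f = 0 ↔ f ∈ F 1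
  -- The Lie–Rinehart structure gives only additivity of the action on `A`; `anchor` records its
  -- `ℂ`-linearity, so that it can be compared with `ℂ`-derivations.
  anchor : L → Derivation ℂ A A
  anchor_apply : ∀ v a, anchor v a = ⁅v, a⁆
  u : Fin d → A
  partial' : Fin d → L
  lie_u : ∀ i j, ⁅partial' i, u j⁆ = if i = j then (1 : A) else 0
  sum_partial : ∀ v : L, ∑ i, ⁅v, u i⁆ • partial' i = v
  derivation_eq_zero : ∀ δ : Derivation ℂ A A, (∀ i, δ (u i) = 0) → ∀ a, δ a = 0
  x : Fin d → B
  y : Fin d → B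
  ε_x : ∀ i, ε (x i) = u i
  y_mem : ∀ i, y i ∈ F 1
  ham_x_x : ∀ i j, P.ham (x i) (x j) = 0
  ham_x_y : ∀ i j, P.ham (x j) (y i) = if i = j then 1 else 0
  coisotropic : ∀ f ∈ F 1, ∀ g ∈ F 1, P.ham g f ∈ F 1
  -- Nondegeneracy normal to the subvariety: brackets with `x` detect `F 1 / F 2`. The next
  -- condition says that the associated graded ring is generated in degrees zero and one.
  mem_two : ∀ f ∈ F 1, (∀ i, P.ham (x i) f ∈ F 1) → f ∈ F 2
  le_pow : ∀ n, F n ≤ F 1 ^ n ⊔ F (n + 1)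

variable {A L B d}

namespace FormalChart

variable (c : FormalChart A L B d)


/-- By `mem_two` it is enough to bracket with each `x_j`. As `{y_i, x_j} = δ_ij`, the first-order
terms cancel and only second brackets times some `y_i ∈ F 1` remain. In particular the `y_i`
generate `F 1` modulo `F 2`. -/
lemma sub_mem_two {f : B} (hf : f ∈ c.F 1) :
    f - ∑ i, c.P.ham (c.x i) f * c.y i ∈ c.F 2 := by
  refine c.mem_two _ (sub_mem hf (sum_mem fun i _ => Ideal.mul_mem_left _ _ (c.y_mem i)))
    fun j => ?_
  have : c.P.ham (c.x j) (f - ∑ i, c.P.ham (c.x i) f * c.y i) =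
      -∑ i, c.y i * c.P.ham (c.x j) (c.P.ham (c.x i) f) := by
    rw [map_sub, map_sum]
    simp only [Derivation.leibniz, smul_eq_mul, c.ham_x_y, Finset.sum_add_distrib, mul_ite,
      mul_one, mul_zero, Finset.sum_ite_eq', Finset.mem_univ, if_true]
    ring
  rw [this]
  exact neg_mem (sum_mem fun i _ => Ideal.mul_mem_right _ _ (c.y_mem i))

/-- The Euler derivation multiplies the graded piece of degree `n` by `n`. -/
lemma euler_sub_mem (n : ℕ) {f : B} (hf : f ∈ c.F n) :
    ∑ i, c.P.ham (c.x i) f * c.y i - n * f ∈ c.F (n + 1) := by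
  have hhigh : ∀ f ∈ c.F (n + 1), ∑ i, c.P.ham (c.x i) f * c.y i - n * f ∈ c.F (n + 1) := by
    intro f hf
    exact sub_mem (sum_mem fun i _ => c.complete.mul (c.P.filt _ _ _ hf) (c.y_mem i))
      (Ideal.mul_mem_left _ _ hf)
  have hadd : ∀ a b : B, ∑ i, c.P.ham (c.x i) (a + b) * c.y i - n * (a + b) =
      (∑ i, c.P.ham (c.x i) a * c.y i - n * a) + (∑ i, c.P.ham (c.x i) b * c.y i - n * b) := by
    intro a b
    simp only [map_add, add_mul, Finset.sum_add_distrib]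
    ring
  -- `le_pow` reduces the claim to products of `n` elements of `F 1`. On these it follows from the
  -- Leibniz rule, since in degree one the Euler derivation is the identity modulo `F 2` by
  -- `sub_mem_two`.
  have hpow : ∀ f ∈ c.F 1 ^ n, f ∈ c.F n ∧
      ∑ i, c.P.ham (c.x i) f * c.y i - n * f ∈ c.F (n + 1) := by
    clear hhigh hadd hf
    induction n with
    | zero =>
      intro f _
      refine ⟨c.complete.mem_zero _, ?_⟩
      simp only [Nat.cast_zero, zero_mul, sub_zero]
      exact sum_mem fun i _ => Ideal.mul_mem_left _ _ (c.y_mem i)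
    | succ n ih =>
      intro f hf
      rw [pow_succ] at hf
      refine Submodule.mul_induction_on hf (fun a ha b hb => ?_) fun a b ha hb => ?_
      · obtain ⟨h1, h2⟩ := ih a ha
        refine ⟨c.complete.mul h1 hb, ?_⟩
        have h3 := c.sub_mem_two hb
        have : ∑ i, c.P.ham (c.x i) (a * b) * c.y i - (n + 1 : ℕ) * (a * b) =
            (∑ i, c.P.ham (c.x i) a * c.y i - n * a) * b -
              a * (b - ∑ i, c.P.ham (c.x i) b * c.y i) := by
          simp only [Derivation.leibniz, smul_eq_mul, add_mul, Finset.sum_add_distrib, mul_assoc,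
            ← Finset.mul_sum, sub_mul, mul_sub]
          simp only [mul_left_comm _ b, mul_comm _ b]
          push_cast
          ring
        rw [this]
        exact sub_mem (c.complete.mul h2 hb) (show _ ∈ c.F (n + 2) from c.complete.mul h1 h3)
      · refine ⟨add_mem ha.1 hb.1, ?_⟩
        have : ∑ i, c.P.ham (c.x i) (a + b) * c.y i - (n + 1 : ℕ) * (a + b) =
          (∑ i, c.P.ham (c.x i) a * c.y i - (n + 1 : ℕ) * a) +
            (∑ i, c.P.ham (c.x i) b * c.y i - (n + 1 : ℕ) * b) := by
          simp only [map_add, add_mul, Finset.sum_add_distrib]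
          ring
        rw [this]
        exact add_mem ha.2 hb.2
  obtain ⟨a, ha, b, hb, rfl⟩ := Submodule.mem_sup.1 (c.le_pow n hf)
  rw [hadd]
  exact add_mem (hpow a ha).2 (hhigh b hb)

/-- The elements that Poisson commute with the coordinates `x`. -/
def constants : Subalgebra ℂ B where
  carrier := {f | ∀ i, c.P.ham (c.x i) f = 0}
  mul_mem' := fun {a b} ha hb i => by simp [Derivation.leibniz, ha i, hb i]
  add_mem' := fun {a b} ha hb i => by simp [ha i, hb i]
  algebraMap_mem' := fun z i => by simp

lemma mem_constants {f : B} : f ∈ c.constants ↔ ∀ i, c.P.ham (c.x i) f = 0 := Iff.rfl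

/-- The Euler derivation kills `f`, but acts as `n + 1` on `F (n+1) / F (n+2)`. Dividing by `n + 1`
pushes `f` into every `F n`. This is the uniqueness principle behind all bracket computations below.
-/
lemma eq_zero_of_mem_constants {f : B} (hf : f ∈ c.constants) (h1 : f ∈ c.F 1) : f = 0 := by
  refine c.complete.sep fun n => ?_
  rcases n with _ | n
  · exact c.complete.mem_zero _
  induction n with
  | zero => exact h1
  | succ n ih =>
    have h := c.euler_sub_mem (n + 1) ih
    simp only [c.mem_constants.1 hf, zero_mul, Finset.sum_const_zero, zero_sub] at h
    have h2 := Submodule.smul_of_tower_mem _ (((n + 1 : ℕ) : ℂ)⁻¹) (neg_mem h)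
    rw [neg_neg, ← map_natCast (algebraMap ℂ B), ← Algebra.smul_def, smul_smul,
      inv_mul_cancel₀ (Nat.cast_ne_zero.2 (by omega)), one_smul] at h2
    exact h2

/-- The brackets of any lift `z` of `a` with `x` form a closed system; its potential lies in `F 1`
and can be subtracted from `z`. -/
lemma exists_constant (a : A) : ∃ f ∈ c.constants, c.ε f = a := by
  obtain ⟨z, rfl⟩ := c.ε_surjective a
  obtain ⟨g, hg, hDg⟩ := c.complete.exists_potential (fun i => c.P.ham (c.x i))
    (fun i => c.P.filt _) (fun i j => c.P.ham_comm (c.ham_x_x i j)) c.y c.y_mem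
    (fun i j => by rw [c.ham_x_y, if_congr (eq_comm (a := i)) rfl rfl, sub_self]; exact zero_mem _)
    (n := 0) (fun i => c.P.ham (c.x i) z) (fun i => c.complete.mem_zero _)
    (fun i j => c.P.ham_comm (c.ham_x_x i j) _)
  exact ⟨z - g, fun i => by rw [map_sub, hDg, sub_self],
    by rw [map_sub, (c.ε_eq_zero g).2 hg, sub_zero]⟩

lemma bijective_ε_constants : Function.Bijective (c.ε.comp c.constants.val) := by
  refine ⟨(injective_iff_map_eq_zero _).2 fun f hf => Subtype.ext ?_, fun a => ?_⟩
  · exact c.eq_zero_of_mem_constants f.2 ((c.ε_eq_zero _).1 hf)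
  · obtain ⟨f, hf, h⟩ := c.exists_constant a
    exact ⟨⟨f, hf⟩, h⟩

/-- The section of `ε` with values in the elements that Poisson commute with `x`. -/
noncomputable def sec : A →ₐ[ℂ] B :=
  c.constants.val.comp (AlgEquiv.ofBijective _ c.bijective_ε_constants).symm.toAlgHom

lemma sec_mem (a : A) : c.sec a ∈ c.constants :=
  ((AlgEquiv.ofBijective _ c.bijective_ε_constants).symm a).2

lemma ε_sec (a : A) : c.ε (c.sec a) = a :=
  (AlgEquiv.ofBijective _ c.bijective_ε_constants).apply_symm_apply a

lemma eq_sec {f : B} (hf : f ∈ c.constants) : f = c.sec (c.ε f) := by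
  rw [← sub_eq_zero]
  refine c.eq_zero_of_mem_constants (sub_mem hf (c.sec_mem _)) ?_
  rw [← c.ε_eq_zero, map_sub, c.ε_sec, sub_self]

lemma sec_u (i : Fin d) : c.sec (c.u i) = c.x i := by
  rw [← c.ε_x, ← c.eq_sec]
  exact fun j => c.ham_x_x j i

/-- By the Jacobi identity the bracket of two `y`s commutes with all `x`, because the brackets of
`y` with `x` are constants. It lies in `F 1` by coisotropy, so it vanishes; the `y` need no further
correction. -/
lemma ham_y_y (i j : Fin d) : c.P.ham (c.y i) (c.y j) = 0 := by
  refine c.eq_zero_of_mem_constants (fun l => ?_) (c.coisotropic _ (c.y_mem j) _ (c.y_mem i))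
  have h : ∀ (p : Prop) [Decidable p] (f : B), c.P.ham (if p then 1 else 0) f = 0 := by
    intro p _ f
    split_ifs
    · rw [c.P.skew, Derivation.map_one_eq_zero, neg_zero]
    · exact c.P.ham_zero f
  rw [c.P.jacobi, c.ham_x_y, c.ham_x_y, c.P.skew, h, h, neg_zero, add_zero]

/-- The bracket commutes with all `x`, so it is determined by its image under `ε`. As a function of
`b` this image is a derivation of `A`; it kills the coordinates, since `sec u_i = x_i`. -/
lemma ham_sec_sec (a b : A) : c.P.ham (c.sec a) (c.sec b) = 0 := by
  have hmem : ∀ b, c.P.ham (c.sec a) (c.sec b) ∈ c.constants := fun b i => by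
    rw [c.P.jacobi, c.sec_mem b, c.sec_mem a, map_zero, c.P.ham_zero, add_zero]
  let δ : Derivation ℂ A A := Derivation.mk'
    (c.ε.toLinearMap ∘ₗ (c.P.ham (c.sec a)).toLinearMap ∘ₗ c.sec.toLinearMap) fun b b' => by
      simp [Derivation.leibniz, c.ε_sec]
  have hδ : ∀ b, c.ε (c.P.ham (c.sec a) (c.sec b)) = 0 := c.derivation_eq_zero δ fun i => by
    change c.ε (c.P.ham (c.sec a) (c.sec (c.u i))) = 0
    rw [c.sec_u, c.P.skew, c.sec_mem a, neg_zero, map_zero]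
  rw [c.eq_sec (hmem b), hδ, map_zero]

/-- Again the bracket commutes with all `x`, and its image under `ε` is a derivation in `a`. It
agrees with `∂_i` on the coordinates because `y` is conjugate to `x`. -/
lemma ham_sec_y (a : A) (i : Fin d) :
    c.P.ham (c.sec a) (c.y i) = c.sec ⁅c.partial' i, a⁆ := by
  have hconst : ∀ (p : Prop) [Decidable p] (f : B), c.P.ham f (if p then 1 else 0) = 0 := by
    intro p _ f
    split_ifs <;> simp
  have hmem : ∀ b, c.P.ham (c.sec b) (c.y i) ∈ c.constants := fun b j => by
    rw [c.P.jacobi, c.ham_x_y, c.sec_mem b, c.P.ham_zero, add_zero, hconst]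
  let δ : Derivation ℂ A A := Derivation.mk'
    (c.ε.toLinearMap ∘ₗ (-(c.P.ham (c.y i)).toLinearMap) ∘ₗ c.sec.toLinearMap) fun b b' => by
      simp [Derivation.leibniz, c.ε_sec]
      ring
  have h := c.derivation_eq_zero (δ - c.anchor (c.partial' i)) (fun j => by
    change c.ε (-(c.P.ham (c.y i) (c.sec (c.u j)))) - c.anchor _ _ = 0
    rw [c.sec_u, ← c.P.skew, c.ham_x_y, c.anchor_apply, c.lie_u]
    split_ifs <;> simp) a
  have h' : c.ε (-(c.P.ham (c.y i) (c.sec a))) - c.anchor _ _ = 0 := h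
  rw [← c.P.skew, c.anchor_apply, sub_eq_zero] at h'
  rw [c.eq_sec (hmem a), h']

/-- The linear function along the fibres given by a vector field. -/
noncomputable def vec (v : L) : B := ∑ i, c.sec ⁅v, c.u i⁆ * c.y i

lemma vec_add (v w : L) : c.vec (v + w) = c.vec v + c.vec w := by
  simp [vec, add_lie, add_mul, Finset.sum_add_distrib]

lemma vec_smul (a : A) (v : L) : c.vec (a • v) = c.sec a * c.vec v := by
  simp [vec, LieRinehartRing.lie_smul_eq_mul, Finset.mul_sum, mul_assoc]

lemma vec_mem (v : L) : c.vec v ∈ c.F 1 :=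
  sum_mem fun i _ => Ideal.mul_mem_left _ _ (c.y_mem i)

lemma lie_eq_sum (v : L) (a : A) : ⁅v, a⁆ = ∑ i, ⁅v, c.u i⁆ * ⁅c.partial' i, a⁆ := by
  nth_rw 1 [← c.sum_partial v]
  have : ∀ (s : Finset (Fin d)) (w : Fin d → L), ⁅∑ i ∈ s, w i, a⁆ = ∑ i ∈ s, ⁅w i, a⁆ :=
    fun s w => map_sum (AddMonoidHom.mk' (fun w : L => ⁅w, a⁆) fun _ _ => add_lie _ _ _) w s
  rw [this]
  exact Finset.sum_congr rfl fun i _ => LieRinehartRing.lie_smul_eq_mul _ _ _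

lemma ham_sec_vec (a : A) (v : L) : c.P.ham (c.sec a) (c.vec v) = c.sec ⁅v, a⁆ := by
  rw [c.lie_eq_sum, map_sum, vec, map_sum]
  refine Finset.sum_congr rfl fun i _ => ?_
  simp [Derivation.leibniz, c.ham_sec_sec, c.ham_sec_y]

lemma ham_y_sec (a : A) (i : Fin d) :
    c.P.ham (c.y i) (c.sec a) = -c.sec ⁅c.partial' i, a⁆ := by
  rw [c.P.skew, c.ham_sec_y]

/-- As the `y`s commute with each other and the coefficients do too, only brackets of a `y` with a
coefficient survive. The coefficient of `y_j` becomes `v (w u_j) - w (v u_j)`. -/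
lemma ham_vec_vec (v w : L) : c.P.ham (c.vec w) (c.vec v) = c.vec ⁅v, w⁆ := by
  have h1 : ∀ i, c.P.ham (c.y i) (c.vec v) = -∑ j, c.sec ⁅c.partial' i, ⁅v, c.u j⁆⁆ * c.y j := by
    intro i
    simp [vec, Derivation.leibniz, c.ham_y_sec, c.ham_y_y, mul_comm]
  have h2 : c.P.ham (c.vec w) (c.vec v) =
      ∑ i, (c.sec ⁅w, c.u i⁆ * c.P.ham (c.y i) (c.vec v) + c.y i * c.sec ⁅v, ⁅w, c.u i⁆⁆) := by
    rw [vec, c.P.ham_sum]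
    exact Finset.sum_congr rfl fun i _ => by rw [c.P.ham_mul, c.ham_sec_vec]
  have h3 : ∀ j, ∑ i, c.sec ⁅w, c.u i⁆ * c.sec ⁅c.partial' i, ⁅v, c.u j⁆⁆ =
      c.sec ⁅w, ⁅v, c.u j⁆⁆ := fun j => by
    rw [c.lie_eq_sum w, map_sum]
    simp
  have h4 : ∑ i, c.sec ⁅w, c.u i⁆ * c.P.ham (c.y i) (c.vec v) =
      -∑ j, c.sec ⁅w, ⁅v, c.u j⁆⁆ * c.y j := by
    simp only [h1, mul_neg, Finset.sum_neg_distrib, Finset.mul_sum]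
    rw [Finset.sum_comm]
    congr 1
    refine Finset.sum_congr rfl fun j _ => ?_
    rw [← h3, Finset.sum_mul]
    exact Finset.sum_congr rfl fun i _ => by ring
  rw [h2, Finset.sum_add_distrib, h4, vec, ← Finset.sum_neg_distrib, ← Finset.sum_add_distrib]
  refine Finset.sum_congr rfl fun j _ => ?_
  rw [lie_lie, map_sub]
  ring

end FormalChart
end FormalChart
end LagrangianNeighborhood

namespace LagrangianNeighborhood

/-! ### The completed symmetric algebra of a formal chart -/

/-- Truncated Cauchy products: the terms of total degree at least `N` may be dropped. -/
lemma sum_range_sum_sub_mem {B : Type*} [CommRing B] (J : Ideal B) (c : ℕ → ℕ → B) (N : ℕ)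
    (hc : ∀ i j, N ≤ i + j → c i j ∈ J) :
    ∑ i ∈ Finset.range N, ∑ j ∈ Finset.range N, c i j -
      ∑ n ∈ Finset.range N, ∑ p ∈ Finset.HasAntidiagonal.antidiagonal n, c p.1 p.2 ∈ J := by
  have h1 : ∑ n ∈ Finset.range N, ∑ p ∈ Finset.HasAntidiagonal.antidiagonal n, c p.1 p.2 =
      ∑ p ∈ (Finset.range N ×ˢ Finset.range N).filter (fun p => p.1 + p.2 < N), c p.1 p.2 := by
    rw [Finset.sum_sigma']
    refine Finset.sum_bij' (fun s _ => s.2) (fun p _ => ⟨p.1 + p.2, p⟩) ?_ ?_ ?_ ?_ ?_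
    · rintro ⟨n, p⟩ h
      simp only [Finset.mem_sigma, Finset.mem_range, Finset.HasAntidiagonal.mem_antidiagonal] at h
      simp only [Finset.mem_filter, Finset.mem_product, Finset.mem_range]
      omega
    · rintro p h
      simp only [Finset.mem_filter, Finset.mem_product, Finset.mem_range] at h
      simp [h.2]
    · rintro ⟨n, p⟩ h
      simp only [Finset.mem_sigma, Finset.mem_range, Finset.HasAntidiagonal.mem_antidiagonal] at h
      obtain ⟨_, rfl⟩ := h
      rfl
    · intro p _; rfl
    · intro p _; rfl
  rw [h1, ← Finset.sum_product', ← Finset.sum_filter_add_sum_filter_not _ (fun p => p.1 + p.2 < N),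
    add_sub_cancel_left]
  refine sum_mem fun p hp => hc _ _ ?_
  simp only [Finset.mem_filter, not_lt] at hp
  exact hp.2

namespace FormalChart

variable {A L B : Type*} [CommRing A] [Algebra ℂ A] [LieRing L] [Module A L] [LieRingModule L A]
  [LieRinehartRing A L] [CommRing B] [Algebra ℂ B] {d : ℕ} (c : FormalChart A L B d)

/-- The map `Sym_A L → B` that is `sec` on `A` and `vec` on `L`. -/
noncomputable def symHom : SymmetricAlgebra A L →+* B :=
  letI : Algebra A B := c.sec.toRingHom.toAlgebra
  (SymmetricAlgebra.lift
    { toFun := c.vec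
      map_add' := c.vec_add
      map_smul' := fun a v => by
        rw [c.vec_smul, Algebra.smul_def]; rfl } : SymmetricAlgebra A L →ₐ[A] B).toRingHom

lemma symHom_algebraMap (a : A) : c.symHom (algebraMap A _ a) = c.sec a := by
  let _ : Algebra A B := c.sec.toRingHom.toAlgebra
  exact AlgHom.commutes (SymmetricAlgebra.lift _) a

lemma symHom_ι (v : L) : c.symHom (SymmetricAlgebra.ι A L v) = c.vec v := by
  let _ : Algebra A B := c.sec.toRingHom.toAlgebra
  exact SymmetricAlgebra.lift_ι_apply _ v

lemma symHom_mem {n : ℕ} {a : SymmetricAlgebra A L} (ha : a ∈ symPart A L n) :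
    c.symHom a ∈ c.F n := by
  induction ha using Submodule.pow_induction_on_left' with
  | algebraMap r => exact c.complete.mem_zero _
  | add x y i hx hy ihx ihy => rw [map_add]; exact add_mem ihx ihy
  | mem_mul m hm i x hx ih =>
    obtain ⟨y, rfl⟩ := hm
    rw [map_mul, c.symHom_ι, Nat.succ_eq_add_one, Nat.add_comm]
    exact c.complete.mul (c.vec_mem y) ih

/-- Both sides are biderivations along `symHom`, so it suffices to compare them on `A` and `L`. -/
lemma symHom_bracket (a b : SymmetricAlgebra A L) :
    c.symHom (symBracket a b) = c.P.ham (c.symHom b) (c.symHom a) := by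
  induction a using SymmetricAlgebra.induction with
  | algebraMap r =>
    induction b using SymmetricAlgebra.induction with
    | algebraMap s =>
      rw [symBracket_algebraMap_algebraMap, c.symHom_algebraMap, c.symHom_algebraMap,
        c.ham_sec_sec, map_zero]
    | ι y =>
      rw [symBracket_algebraMap_left, adScalar_ι, map_neg, c.symHom_algebraMap,
        c.symHom_algebraMap, c.symHom_ι, c.P.skew, c.ham_sec_vec]
    | mul b b' hb hb' =>
      simp only [map_mul, map_add, symBracket_mul_right, hb, hb', c.P.ham_mul]
    | add b b' hb hb' => simp only [map_add, symBracket_add_right, hb, hb', c.P.ham_add]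
  | ι x =>
    induction b using SymmetricAlgebra.induction with
    | algebraMap s =>
      rw [symBracket_ι_algebraMap, c.symHom_algebraMap, c.symHom_algebraMap, c.symHom_ι,
        c.ham_sec_vec]
    | ι y => rw [symBracket_ι_ι, c.symHom_ι, c.symHom_ι, c.symHom_ι, c.ham_vec_vec]
    | mul b b' hb hb' =>
      simp only [map_mul, map_add, symBracket_mul_right, hb, hb', c.P.ham_mul]
    | add b b' hb hb' => simp only [map_add, symBracket_add_right, hb, hb', c.P.ham_add]
  | mul a a' ha ha' =>
    simp only [map_mul, map_add, symBracket_mul_left, ha, ha', Derivation.leibniz, smul_eq_mul]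
  | add a a' ha ha' => simp only [map_add, symBracket_add_left, ha, ha']

/-- Euler's formula in the symmetric algebra. -/
lemma sum_ι_mul_bracket {n : ℕ} {a : SymmetricAlgebra A L} (ha : a ∈ symPart A L n) :
    ∑ i, SymmetricAlgebra.ι A L (c.partial' i) * symBracket a (algebraMap A _ (c.u i)) =
      n * a := by
  induction ha using Submodule.pow_induction_on_left' with
  | algebraMap r => simp [symBracket_algebraMap_algebraMap]
  | add x y i hx hy ihx ihy =>
    simp only [symBracket_add_left, mul_add, Finset.sum_add_distrib, ihx, ihy]
  | mem_mul m hm i x hx ih =>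
    obtain ⟨v, rfl⟩ := hm
    have h : ∑ i, SymmetricAlgebra.ι A L (c.partial' i) * algebraMap A _ ⁅v, c.u i⁆ =
        SymmetricAlgebra.ι A L v := by
      conv_rhs => rw [← c.sum_partial v, map_sum]
      exact Finset.sum_congr rfl fun i _ => by rw [map_smul, Algebra.smul_def, mul_comm]
    simp only [symBracket_mul_left, mul_add, Finset.sum_add_distrib, symBracket_ι_algebraMap,
      mul_left_comm _ x, mul_left_comm _ (SymmetricAlgebra.ι A L v), ← Finset.mul_sum, h, ih]
    push_cast
    ring

/-- Injectivity on graded pieces. Bracketing with `u_i` lowers both the degree and the filtration by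
one, so by induction all `{a, u_i}` vanish, and Euler's formula recovers a nonzero multiple of `a`
from them. Degree zero is `ε ∘ sec = id`. -/
lemma eq_zero_of_symHom_mem (n : ℕ) {a : SymmetricAlgebra A L} (ha : a ∈ symPart A L n)
    (h : c.symHom a ∈ c.F (n + 1)) : a = 0 := by
  induction n generalizing a with
  | zero =>
    obtain ⟨r, rfl⟩ := exists_algebraMap_of_mem ha
    rw [c.symHom_algebraMap, ← c.ε_eq_zero, c.ε_sec] at h
    rw [h, map_zero]
  | succ n ih =>
    have h0 : ∀ i, symBracket a (algebraMap A _ (c.u i)) = 0 := fun i => by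
      refine ih (symBracket_mem_symPart (j := 0) (by omega) ha (algebraMap_mem_symPart _)) ?_
      rw [c.symHom_bracket]
      exact c.P.filt _ _ _ h
    have := c.sum_ι_mul_bracket ha
    simp only [h0, mul_zero, Finset.sum_const_zero] at this
    have hz : algebraMap A (SymmetricAlgebra A L) (algebraMap ℂ A ((n + 1 : ℕ) : ℂ)⁻¹) *
        (((n + 1 : ℕ) : SymmetricAlgebra A L) * a) = 0 := by rw [← this, mul_zero]
    rwa [← mul_assoc, ← map_natCast (algebraMap A (SymmetricAlgebra A L)),
      ← map_natCast (algebraMap ℂ A), ← map_mul, ← map_mul,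
      inv_mul_cancel₀ (Nat.cast_ne_zero.2 (by omega)), map_one, map_one, one_mul] at hz

/-- Surjectivity on graded pieces; by `le_pow` only products of elements of `F 1` have to be
treated. -/
lemma exists_symPart (n : ℕ) {f : B} (hf : f ∈ c.F n) :
    ∃ a ∈ symPart A L n, f - c.symHom a ∈ c.F (n + 1) := by
  have h0 : ∀ f : B, f - c.sec (c.ε f) ∈ c.F 1 := fun f => by
    rw [← c.ε_eq_zero, map_sub, c.ε_sec, sub_self]
  have hpow : ∀ f ∈ c.F 1 ^ n, f ∈ c.F n ∧ ∃ a ∈ symPart A L n, f - c.symHom a ∈ c.F (n + 1) := by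
    clear hf
    induction n with
    | zero =>
      refine fun f _ => ⟨c.complete.mem_zero _, algebraMap A _ (c.ε f),
        algebraMap_mem_symPart _, ?_⟩
      rw [c.symHom_algebraMap]
      exact h0 f
    | succ n ih =>
      intro f hf
      rw [pow_succ] at hf
      refine Submodule.mul_induction_on hf (fun a ha b hb => ?_) fun a b ha hb => ?_
      · obtain ⟨h1, a', ha', h2⟩ := ih a ha
        -- Modulo `F 2`, `b` is `∑ {b, x_i} y_i`; replacing each coefficient by its image under `sec
        -- ∘ ε` changes it by an element of `F 1`.
        have hv : b - c.vec (∑ i, c.ε (c.P.ham (c.x i) b) • c.partial' i) ∈ c.F 2 := by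
          have hvs : ∀ (s : Finset (Fin d)) (w : Fin d → L), c.vec (∑ i ∈ s, w i) =
            ∑ i ∈ s, c.vec (w i) := fun s w => map_sum (AddMonoidHom.mk' c.vec c.vec_add) w s
          have hp : ∀ i, c.vec (c.partial' i) = c.y i := fun i => by
            simp [vec, c.lie_u]
          have : b - c.vec (∑ i, c.ε (c.P.ham (c.x i) b) • c.partial' i) =
              (b - ∑ i, c.P.ham (c.x i) b * c.y i) +
                ∑ i, (c.P.ham (c.x i) b - c.sec (c.ε (c.P.ham (c.x i) b))) * c.y i := by
            simp only [hvs, c.vec_smul, hp, sub_mul, Finset.sum_sub_distrib]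
            ring
          rw [this]
          exact add_mem (c.sub_mem_two hb) (sum_mem fun i _ => c.complete.mul (h0 _) (c.y_mem i))
        refine ⟨c.complete.mul h1 hb, a' * SymmetricAlgebra.ι A L _,
          mul_mem_symPart rfl ha' (ι_mem_symPart (∑ i, c.ε (c.P.ham (c.x i) b) • c.partial' i)), ?_⟩
        rw [map_mul, c.symHom_ι]
        have : ∀ v, a * b - c.symHom a' * c.vec v =
            (a - c.symHom a') * b + c.symHom a' * (b - c.vec v) := fun v => by ring
        rw [this]
        exact add_mem (c.complete.mul h2 hb)
          (show _ ∈ c.F (n + 2) from c.complete.mul (c.symHom_mem ha') hv)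
      · obtain ⟨h1, a', ha', h2⟩ := ha
        obtain ⟨h3, b', hb', h4⟩ := hb
        refine ⟨add_mem h1 h3, a' + b', add_mem ha' hb', ?_⟩
        rw [map_add, add_sub_add_comm]
        exact add_mem h2 h4
  obtain ⟨a, ha, b, hb, rfl⟩ := Submodule.mem_sup.1 (c.le_pow n hf)
  obtain ⟨_, a', ha', h⟩ := hpow a ha
  refine ⟨a', ha', ?_⟩
  rw [add_sub_right_comm]
  exact add_mem h hb

/-- The partial sums of the image of an element of `∏_n Sym^n_A L`. -/
noncomputable def partialSum (G : CompletedSym A L) (N : ℕ) : B :=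
  ∑ n ∈ Finset.range N, c.symHom (PowerSeries.coeff n G.1)

lemma exists_limit (G : CompletedSym A L) : ∃ g, ∀ N, g - c.partialSum G N ∈ c.F N :=
  c.complete.complete _ fun n => by
    rw [partialSum, Finset.sum_range_succ, partialSum, add_sub_cancel_left]
    exact c.symHom_mem (G.2 n)

/-- The sum of the image of an element of `∏_n Sym^n_A L`. -/
noncomputable def limit (G : CompletedSym A L) : B := (c.exists_limit G).choose

lemma limit_sub_mem (G : CompletedSym A L) (N : ℕ) : c.limit G - c.partialSum G N ∈ c.F N :=
  (c.exists_limit G).choose_spec N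

lemma eq_limit {g : B} {G : CompletedSym A L} (h : ∀ N, g - c.partialSum G N ∈ c.F N) :
    g = c.limit G := by
  rw [← sub_eq_zero]
  refine c.complete.sep fun N => ?_
  rw [← sub_sub_sub_cancel_right _ _ (c.partialSum G N)]
  exact sub_mem (h N) (c.limit_sub_mem G N)

lemma limit_add (G H : CompletedSym A L) : c.limit (G + H) = c.limit G + c.limit H := by
  symm
  refine c.eq_limit fun N => ?_
  have : c.partialSum (G + H) N = c.partialSum G N + c.partialSum H N := by
    rw [partialSum, partialSum, partialSum, ← Finset.sum_add_distrib]
    refine Finset.sum_congr rfl fun n _ => ?_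
    rw [← map_add c.symHom, ← map_add (PowerSeries.coeff n)]
    rfl
  rw [this, add_sub_add_comm]
  exact add_mem (c.limit_sub_mem _ _) (c.limit_sub_mem _ _)

lemma limit_mul (G H : CompletedSym A L) : c.limit (G * H) = c.limit G * c.limit H := by
  symm
  refine c.eq_limit fun N => ?_
  have h1 : c.partialSum G N * c.partialSum H N - c.partialSum (G * H) N ∈ c.F N := by
    have := sum_range_sum_sub_mem (c.F N) (fun i j => c.symHom (PowerSeries.coeff i G.1) *
      c.symHom (PowerSeries.coeff j H.1)) N (fun i j hij => c.complete.anti hij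
        (c.complete.mul (c.symHom_mem (G.2 i)) (c.symHom_mem (H.2 j))))
    rw [← Finset.sum_mul_sum] at this
    have h2 : c.partialSum (G * H) N = ∑ n ∈ Finset.range N,
        ∑ p ∈ Finset.HasAntidiagonal.antidiagonal n, c.symHom (PowerSeries.coeff p.1 G.1) *
          c.symHom (PowerSeries.coeff p.2 H.1) := by
      refine Finset.sum_congr rfl fun n _ => ?_
      change c.symHom (PowerSeries.coeff n (G.1 * H.1)) = _
      rw [PowerSeries.coeff_mul, map_sum]
      simp only [map_mul]
    rw [h2]
    exact this
  have : c.limit G * c.limit H - c.partialSum (G * H) N =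
      (c.limit G - c.partialSum G N) * c.limit H +
        c.partialSum G N * (c.limit H - c.partialSum H N) +
        (c.partialSum G N * c.partialSum H N - c.partialSum (G * H) N) := by ring
  rw [this]
  exact add_mem (add_mem (Ideal.mul_mem_right _ _ (c.limit_sub_mem _ _))
    (Ideal.mul_mem_left _ _ (c.limit_sub_mem _ _))) h1

lemma limit_bracket (G H : CompletedSym A L) :
    c.limit (G.bracket H) = c.P.ham (c.limit H) (c.limit G) := by
  symm
  refine c.eq_limit fun N => ?_
  have hdeg : ∀ i j, N + 1 ≤ i + j → c.symHom (symBracket (PowerSeries.coeff i G.1)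
      (PowerSeries.coeff j H.1)) ∈ c.F N := fun i j hij => by
    obtain ⟨k, hk⟩ : ∃ k, i + j = k + 1 := ⟨i + j - 1, by omega⟩
    exact c.complete.anti (by omega)
      (c.symHom_mem (symBracket_mem_symPart hk (G.2 i) (H.2 j)))
  have h0 : symBracket (PowerSeries.coeff 0 G.1) (PowerSeries.coeff 0 H.1) = 0 := by
    obtain ⟨a, ha⟩ := exists_algebraMap_of_mem (G.2 0)
    obtain ⟨b, hb⟩ := exists_algebraMap_of_mem (H.2 0)
    rw [← ha, ← hb, symBracket_algebraMap_algebraMap]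
  -- The bracket loses one degree, so the sums run to `N + 1`. The part of total degree `0` is
  -- `{G_0, H_0} = 0`; dropping it matches total degree `n + 1` with degree `n` of the bracket.
  have h1 := sum_range_sum_sub_mem (c.F N) (fun i j => c.symHom (symBracket
      (PowerSeries.coeff i G.1) (PowerSeries.coeff j H.1))) (N + 1) hdeg
  rw [Finset.sum_range_succ' (fun n => ∑ p ∈ Finset.HasAntidiagonal.antidiagonal n, _)] at h1
  simp only [Finset.Nat.antidiagonal_zero, Finset.sum_singleton, h0, map_zero, add_zero] at h1
  have h2 : ∑ n ∈ Finset.range N, ∑ p ∈ Finset.HasAntidiagonal.antidiagonal (n + 1),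
      c.symHom (symBracket (PowerSeries.coeff p.1 G.1) (PowerSeries.coeff p.2 H.1)) =
      c.partialSum (G.bracket H) N := by
    refine Finset.sum_congr rfl fun n _ => ?_
    rw [CompletedSym.coeff_bracket, map_sum]
  have h3 : ∑ i ∈ Finset.range (N + 1), ∑ j ∈ Finset.range (N + 1),
      c.symHom (symBracket (PowerSeries.coeff i G.1) (PowerSeries.coeff j H.1)) =
      c.P.ham (c.partialSum H (N + 1)) (c.partialSum G (N + 1)) := by
    rw [partialSum, partialSum, c.P.ham_sum, Finset.sum_comm]
    refine Finset.sum_congr rfl fun j _ => ?_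
    rw [map_sum]
    exact Finset.sum_congr rfl fun i _ => c.symHom_bracket _ _
  rw [h2, h3] at h1
  have h4 := add_mem (c.P.ham_congr (c.limit_sub_mem G (N + 1)) (c.limit_sub_mem H (N + 1))) h1
  rwa [sub_add_sub_cancel] at h4

lemma coeff_algebraMap (a : A) (n : ℕ) :
    PowerSeries.coeff n (algebraMap A (CompletedSym A L) a).1 =
      if n = 0 then algebraMap A _ a else 0 := by
  change PowerSeries.coeff n (algebraMap A (PowerSeries (SymmetricAlgebra A L)) a) = _
  rw [PowerSeries.algebraMap_apply, PowerSeries.coeff_C]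

lemma limit_algebraMap (a : A) : c.limit (algebraMap A _ a) = c.sec a := by
  symm
  refine c.eq_limit fun N => ?_
  rcases N with _ | N
  · exact c.complete.mem_zero _
  · have : c.partialSum (algebraMap A (CompletedSym A L) a) (N + 1) = c.sec a := by
      rw [partialSum, Finset.sum_range_succ']
      simp [coeff_algebraMap, c.symHom_algebraMap]
    rw [this, sub_self]
    exact zero_mem _

/-- The map `∏_n Sym^n_A L → B`. -/
noncomputable def limitHom : CompletedSym A L →ₐ[ℂ] B where
  toFun := c.limit
  map_one' := by rw [← map_one (algebraMap A (CompletedSym A L)), c.limit_algebraMap, map_one]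
  map_mul' := c.limit_mul
  map_zero' := by rw [← map_zero (algebraMap A (CompletedSym A L)), c.limit_algebraMap, map_zero]
  map_add' := c.limit_add
  commutes' z := by
    change c.limit (algebraMap A _ (algebraMap ℂ A z)) = _
    rw [c.limit_algebraMap, AlgHom.commutes]

/-- If the coefficients below `n` vanish, the limit agrees with the image of the `n`-th coefficient
modulo `F (n+1)`, so `eq_zero_of_symHom_mem` applies. -/
lemma limitHom_injective : Function.Injective c.limitHom := by
  refine (injective_iff_map_eq_zero _).2 fun G hG => ?_
  have h : ∀ n, PowerSeries.coeff n G.1 = 0 := by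
    intro n
    induction n using Nat.strong_induction_on with
    | _ n ih =>
      have h1 := c.limit_sub_mem G (n + 1)
      change c.limitHom G - _ ∈ _ at h1
      rw [hG, partialSum, Finset.sum_range_succ, Finset.sum_eq_zero (fun i hi => by
        rw [ih i (Finset.mem_range.1 hi), map_zero]), zero_add, zero_sub] at h1
      exact c.eq_zero_of_symHom_mem n (G.2 n) (by simpa using neg_mem h1)
  exact Subtype.ext (PowerSeries.ext fun n => by rw [h n]; rfl)

lemma limitHom_surjective : Function.Surjective c.limitHom := by
  classical
  intro b
  have step : ∀ n, ∀ f : B, ∃ a ∈ symPart A L n, f ∈ c.F n → f - c.symHom a ∈ c.F (n + 1) := by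
    intro n f
    by_cases h : f ∈ c.F n
    · obtain ⟨a, ha, h'⟩ := c.exists_symPart n h
      exact ⟨a, ha, fun _ => h'⟩
    · exact ⟨0, zero_mem _, fun h' => absurd h' h⟩
  choose a ha hfa using step
  -- The remainder after the leading terms of degrees below `n` have been subtracted from `b`; it
  -- lies in `F n`.
  let r : ℕ → B := fun n => Nat.rec b (fun n f => f - c.symHom (a n f)) n
  have hr : ∀ n, r n ∈ c.F n := by
    intro n
    induction n with
    | zero => exact c.complete.mem_zero _
    | succ n ih => exact hfa n (r n) ih
  let G : CompletedSym A L := ⟨PowerSeries.mk fun n => a n (r n), fun n => by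
    rw [PowerSeries.coeff_mk]; exact ha _ _⟩
  refine ⟨G, Eq.symm (c.eq_limit fun N => ?_)⟩
  have : b - c.partialSum G N = r N := by
    induction N with
    | zero => simp [partialSum, r]
    | succ N ih =>
      rw [partialSum, Finset.sum_range_succ, ← sub_sub]
      rw [partialSum] at ih
      rw [ih]
      change r N - c.symHom (PowerSeries.coeff N (PowerSeries.mk fun n => a n (r n))) = _
      rw [PowerSeries.coeff_mk]
  rw [this]
  exact hr N

/-- The isomorphism of Poisson algebras `∏_n Sym^n_A L ≃ B`. -/
noncomputable def limitEquiv : CompletedSym A L ≃ₐ[ℂ] B :=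
  AlgEquiv.ofBijective c.limitHom ⟨c.limitHom_injective, c.limitHom_surjective⟩

lemma limitEquiv_bracket (G H : CompletedSym A L) :
    c.limitEquiv (G.bracket H) = c.P.ham (c.limitEquiv H) (c.limitEquiv G) :=
  c.limit_bracket G H

section Functoriality

variable {A' L' B' : Type*} [CommRing A'] [Algebra ℂ A'] [LieRing L'] [Module A' L']
  [LieRingModule L' A'] [LieRinehartRing A' L'] [CommRing B'] [Algebra ℂ B']
  (c' : FormalChart A' L' B' d) (σ : A →ₐ[ℂ] A') (f : L →ₛₗ[σ.toRingHom] L') (τ : B →ₐ[ℂ] B')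

/-- Naturality of `limitEquiv`. -/
lemma limitEquiv_map (hanchor : ∀ (v : L) (a : A), σ ⁅v, a⁆ = ⁅f v, σ a⁆)
    (hu : ∀ i, σ (c.u i) = c'.u i) (hε : ∀ b, c'.ε (τ b) = σ (c.ε b))
    (hF : ∀ n, ∀ b ∈ c.F n, τ b ∈ c'.F n)
    (hham : ∀ a b, τ (c.P.ham a b) = c'.P.ham (τ a) (τ b))
    (hx : ∀ i, τ (c.x i) = c'.x i) (hy : ∀ i, τ (c.y i) = c'.y i) (G : CompletedSym A L) :
    τ (c.limitEquiv G) = c'.limitEquiv (CompletedSym.map σ.toRingHom f G) := by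
  -- An element commuting with all coordinates `x` of the target is determined by its image under
  -- `ε`.
  have hsec : ∀ a, τ (c.sec a) = c'.sec (σ a) := fun a => by
    rw [c'.eq_sec (f := τ (c.sec a)) fun i => by rw [← hx, ← hham, c.sec_mem a i, map_zero], hε,
      c.ε_sec]
  have hvec : ∀ v, τ (c.vec v) = c'.vec (f v) := fun v => by
    simp only [vec, map_sum, map_mul, hsec, hy, hanchor, hu]
  have hsym : ∀ a, τ (c.symHom a) = c'.symHom (symMap σ.toRingHom f a) := by
    intro a
    induction a using SymmetricAlgebra.induction with
    | algebraMap r =>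
      rw [symMap_algebraMap, c.symHom_algebraMap, c'.symHom_algebraMap, hsec]; rfl
    | ι x => rw [symMap_ι, c.symHom_ι, c'.symHom_ι, hvec]
    | mul a b ha hb => simp only [map_mul, ha, hb]
    | add a b ha hb => simp only [map_add, ha, hb]
  refine c'.eq_limit fun N => ?_
  have : c'.partialSum (CompletedSym.map σ.toRingHom f G) N = τ (c.partialSum G N) := by
    rw [partialSum, partialSum, map_sum]
    refine Finset.sum_congr rfl fun n _ => ?_
    rw [hsym]
    change c'.symHom (PowerSeries.coeff n (PowerSeries.map (symMap σ.toRingHom f) G.1)) = _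
    rw [PowerSeries.coeff_map]
  rw [this, ← map_sub]
  exact hF _ _ (c.limit_sub_mem G N)

end Functoriality

end FormalChart

end LagrangianNeighborhood

namespace LagrangianNeighborhood

/-! ### Coefficients of elements of the completed symmetric algebra of a free module -/

section Coefficients

variable {A L : Type*} [CommRing A] [AddCommGroup L] [Module A L] {κ : Type*} [Fintype κ]
  (b : Module.Basis κ A L)

/-- Both sides are the `n`-th power of the degree-one part, and a basis of `L` corresponds to the
variables. Coefficients in a basis will reduce the gluing of sections of `∏ Sym^n` to that of
functions. -/
lemma mem_symPart_iff {n : ℕ} {a : SymmetricAlgebra A L} :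
    a ∈ symPart A L n ↔ (SymmetricAlgebra.equivMvPolynomial b a).IsHomogeneous n := by
  have h : (symPart A L n).map (SymmetricAlgebra.equivMvPolynomial b).toAlgHom.toLinearMap =
      MvPolynomial.homogeneousSubmodule κ A n := by
    rw [symPart, Submodule.map_pow, ← MvPolynomial.homogeneousSubmodule_one_pow,
      MvPolynomial.homogeneousSubmodule_one_eq_span_X, LinearMap.range_eq_map, ← b.span_eq,
      Submodule.map_span, Submodule.map_span, ← Set.range_comp, ← Set.range_comp]
    congr 3
    ext i : 1
    exact SymmetricAlgebra.equivMvPolynomial_ι_apply b i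
  rw [← MvPolynomial.mem_homogeneousSubmodule, ← h]
  refine ⟨Submodule.mem_map_of_mem, ?_⟩
  rintro ⟨a', ha', h'⟩
  rwa [← (SymmetricAlgebra.equivMvPolynomial b).injective h']

namespace CompletedSym

/-- The coefficient of the monomial `α` in a basis of the module. -/
noncomputable def monomialCoeff (α : κ →₀ ℕ) (G : CompletedSym A L) : A :=
  MvPolynomial.coeff α (SymmetricAlgebra.equivMvPolynomial b (PowerSeries.coeff α.degree G.1))

lemma ext_monomialCoeff {G H : CompletedSym A L}
    (h : ∀ α, monomialCoeff b α G = monomialCoeff b α H) : G = H := by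
  refine Subtype.ext (PowerSeries.ext fun n => (SymmetricAlgebra.equivMvPolynomial b).injective
    (MvPolynomial.ext _ _ fun α => ?_))
  by_cases hα : α.degree = n
  · subst hα; exact h α
  · rw [((mem_symPart_iff b).1 (G.2 n)).coeff_eq_zero hα,
      ((mem_symPart_iff b).1 (H.2 n)).coeff_eq_zero hα]

lemma exists_monomialCoeff_eq (c : (κ →₀ ℕ) → A) :
    ∃ G : CompletedSym A L, ∀ α, monomialCoeff b α G = c α := by
  classical
  -- As `κ` is finite, there are finitely many monomials in each degree, so any family of
  -- coefficients is allowed.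
  let p : ℕ → MvPolynomial κ A := fun n =>
    ∑ α ∈ Finset.univ.finsuppAntidiag n, MvPolynomial.monomial α (c α)
  have hmem : ∀ (n : ℕ) (α : κ →₀ ℕ), α ∈ Finset.univ.finsuppAntidiag n ↔ α.degree = n := by
    intro n α
    rw [Finset.mem_finsuppAntidiag, Finsupp.degree_eq_sum]
    simp
  have hp : ∀ n, (p n).IsHomogeneous n := fun n =>
    MvPolynomial.IsHomogeneous.sum _ _ _ fun α hα =>
      MvPolynomial.isHomogeneous_monomial _ ((hmem n α).1 hα)
  refine ⟨⟨PowerSeries.mk fun n => (SymmetricAlgebra.equivMvPolynomial b).symm (p n), fun n => ?_⟩,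
    fun α => ?_⟩
  · rw [PowerSeries.coeff_mk, mem_symPart_iff b, AlgEquiv.apply_symm_apply]
    exact hp n
  · change MvPolynomial.coeff α (SymmetricAlgebra.equivMvPolynomial b (PowerSeries.coeff α.degree
      (PowerSeries.mk fun n => (SymmetricAlgebra.equivMvPolynomial b).symm (p n)))) = _
    rw [PowerSeries.coeff_mk, AlgEquiv.apply_symm_apply, MvPolynomial.coeff_sum]
    simp only [MvPolynomial.coeff_monomial]
    rw [Finset.sum_ite_eq', if_pos ((hmem _ α).2 rfl)]

lemma monomialCoeff_map {A' L' : Type*} [CommRing A'] [AddCommGroup L'] [Module A' L']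
    (b' : Module.Basis κ A' L') (σ : A →+* A') (f : L →ₛₗ[σ] L') (hf : ∀ i, f (b i) = b' i)
    (α : κ →₀ ℕ) (G : CompletedSym A L) :
    monomialCoeff b' α (map σ f G) = σ (monomialCoeff b α G) := by
  have h : ∀ p, SymmetricAlgebra.equivMvPolynomial b' (symMap σ f
      ((SymmetricAlgebra.equivMvPolynomial b).symm p)) = MvPolynomial.map σ p := by
    intro p
    induction p using MvPolynomial.induction_on with
    | C a =>
      rw [MvPolynomial.map_C, ← MvPolynomial.algebraMap_eq, ← MvPolynomial.algebraMap_eq,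
        AlgEquiv.commutes, symMap_algebraMap, AlgEquiv.commutes]
    | add p q hp hq => simp only [map_add, hp, hq]
    | mul_X p i hp =>
      simp only [map_mul, hp, SymmetricAlgebra.equivMvPolynomial_symm_X, symMap_ι, hf,
        SymmetricAlgebra.equivMvPolynomial_ι_apply, MvPolynomial.map_X]
  change MvPolynomial.coeff α (SymmetricAlgebra.equivMvPolynomial b' (PowerSeries.coeff α.degree
    (PowerSeries.map (symMap σ f) G.1))) = _
  rw [PowerSeries.coeff_map, ← (SymmetricAlgebra.equivMvPolynomial b).symm_apply_apply
    (PowerSeries.coeff α.degree G.1), h, MvPolynomial.coeff_map]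
  rfl

end CompletedSym

end Coefficients

end LagrangianNeighborhood

namespace LagrangianNeighborhood

/-! ### Derivations of smooth algebras -/

section Derivations

open TensorProduct KaehlerDifferential

lemma derivation_apply_eq_lift {R M : Type*} [CommRing R] [Algebra ℂ R] [AddCommGroup M]
    [Module R M] [Module ℂ M] [IsScalarTower ℂ R M] (δ : Derivation ℂ R M) (f : R) :
    δ f = δ.liftKaehlerDifferential (D ℂ R f) :=
  (Derivation.liftKaehlerDifferential_comp_D δ f).symm

/-! ### Derivations along étale homomorphisms -/

section Etale

variable {R S : Type*} [CommRing R] [CommRing S] [Algebra ℂ R] [Algebra ℂ S] [Algebra R S]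
  [IsScalarTower ℂ R S]

/-- Derivations on a formally unramified algebra are determined by their values on the base. -/
lemma derivation_eq_of_formallyUnramified [Algebra.FormallyUnramified R S] {M : Type*}
    [AddCommGroup M] [Module S M] [Module ℂ M] [IsScalarTower ℂ S M] (δ δ' : Derivation ℂ S M)
    (h : ∀ r : R, δ (algebraMap R S r) = δ' (algebraMap R S r)) (s : S) : δ s = δ' s := by
  let _ : Module R M := Module.compHom M (algebraMap R S)
  have : IsScalarTower R S M := ⟨fun r s m => by
    rw [Algebra.smul_def, mul_smul]; rfl⟩
  -- The difference vanishes on the image of `R`, so it is `R`-linear and factors through `Ω[S⁄R] =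
  -- 0`.
  let E : Derivation R S M := Derivation.mk'
    { toFun := fun s => δ s - δ' s
      map_add' := fun a b => by rw [map_add, map_add]; abel
      map_smul' := fun r s => by
        rw [Algebra.smul_def, Derivation.leibniz, Derivation.leibniz, h, add_sub_add_right_eq_sub,
          ← smul_sub]
        rfl } fun a b => (δ - δ').leibniz a b
  have h0 : E s = E.liftKaehlerDifferential (D R S s) :=
    (Derivation.liftKaehlerDifferential_comp_D E s).symm
  rw [Subsingleton.elim (D R S s) 0, map_zero] at h0
  exact sub_eq_zero.1 h0

/-- Derivations extend along formally étale homomorphisms. -/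
lemma exists_derivation_extension [Algebra.FormallyEtale R S] (δ : Derivation ℂ R R) :
    ∃ δ' : Derivation ℂ S S, ∀ r, δ' (algebraMap R S r) = algebraMap R S (δ r) := by
  let l : Ω[S⁄ℂ] →ₗ[S] S := (AlgebraTensorModule.lift
    (LinearMap.toSpanSingleton S _
      (((Algebra.linearMap R S).comp δ.liftKaehlerDifferential)))).comp
    (tensorKaehlerEquivOfFormallyEtale ℂ R S).symm.toLinearMap
  refine ⟨l.compDer (D ℂ S), fun r => ?_⟩
  change l (D ℂ S (algebraMap R S r)) = _
  simp only [l, LinearMap.comp_apply, LinearEquiv.coe_coe,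
    tensorKaehlerEquivOfFormallyEtale_symm_D_algebraMap]
  simp

end Etale

/-! ### Dual bases of Kähler differentials -/

section Smooth

variable (R : Type*) [CommRing R] [Algebra ℂ R]

/-- A dual basis of the differentials of a smooth algebra. -/
lemma exists_dual_basis [Algebra.FormallySmooth ℂ R] [Algebra.FiniteType ℂ R] :
    ∃ (n : ℕ) (h : Fin n → R) (δ : Fin n → Derivation ℂ R R),
      ∀ f, D ℂ R f = ∑ k, δ k f • D ℂ R (h k) := by
  obtain ⟨t, ht, hspan⟩ := (Submodule.fg_span_iff_fg_span_finset_subset (R := R)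
    (Set.range (D ℂ R))).1 (by rw [span_range_derivation]; exact Module.Finite.fg_top)
  rw [span_range_derivation] at hspan
  choose h hh using fun x : t => ht x.2
  let l : (Fin t.card → R) →ₗ[R] Ω[R⁄ℂ] := Fintype.linearCombination R fun k => D ℂ R (h (t.equivFin.symm k))
  have hl : Function.Surjective l := by
    rw [← LinearMap.range_eq_top, Fintype.range_linearCombination, hspan]
    congr 1
    ext x
    constructor
    · rintro ⟨k, rfl⟩; simp only [hh]; exact (t.equivFin.symm k).2
    · intro hx; exact ⟨t.equivFin ⟨x, hx⟩, by simp [hh]⟩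
  -- Finitely many exact differentials generate the projective module `Ω[R⁄ℂ]`. The coordinates of a
  -- splitting are the derivations sought; the generators need not be independent.
  obtain ⟨s, hs⟩ := Module.projective_lifting_property l LinearMap.id hl
  refine ⟨t.card, fun k => h (t.equivFin.symm k),
    fun k => (LinearMap.proj k ∘ₗ s).compDer (D ℂ R), fun f => ?_⟩
  conv_lhs => rw [← LinearMap.id_apply (R := R) (D ℂ R f), ← hs, LinearMap.comp_apply,
    Fintype.linearCombination_apply]
  rfl

variable {R}

lemma derivation_eq_sum_of_dual_basis {n : ℕ} {h : Fin n → R} {δ : Fin n → Derivation ℂ R R}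
    (hδ : ∀ f, D ℂ R f = ∑ k, δ k f • D ℂ R (h k)) {M : Type*} [AddCommGroup M]
    [Module R M] [Module ℂ M] [IsScalarTower ℂ R M] (E : Derivation ℂ R M) (f : R) :
    E f = ∑ k, δ k f • E (h k) := by
  rw [derivation_apply_eq_lift, hδ, map_sum]
  exact Finset.sum_congr rfl fun k _ => by rw [map_smul, ← derivation_apply_eq_lift]

end Smooth

/-! ### The conormal sequence of a smooth subvariety -/

section Conormal

variable {R A : Type*} [CommRing R] [CommRing A] [Algebra ℂ R] [Algebra ℂ A] [Algebra R A]
  [IsScalarTower ℂ R A]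

/-- The conormal sequence of a smooth subvariety is exact on the left. -/
lemma mem_ker_sq_of_tmul_D_eq_zero [Algebra.FormallySmooth ℂ R] [Algebra.FormallySmooth ℂ A]
    (hsurj : Function.Surjective (algebraMap R A)) {f : R} (hf : f ∈ RingHom.ker (algebraMap R A))
    (h : (1 : A) ⊗ₜ[R] D ℂ R f = 0) : f ∈ RingHom.ker (algebraMap R A) ^ 2 := by
  have hinj := (Algebra.FormallySmooth.kerCotangentToTensor_injective_iff (R := ℂ) hsurj).2
    inferInstance
  have := hinj (a₁ := Ideal.toCotangent _ ⟨f, hf⟩) (a₂ := 0) (by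
    rw [kerCotangentToTensor_toCotangent, map_zero]; exact h)
  rwa [Ideal.toCotangent_eq_zero] at this

/-- Along the subvariety `df = ∑ δ_k f ⊗ dh_k`, which vanishes when all coefficients lie in the
ideal. -/
lemma mem_ker_sq_of_dual_basis [Algebra.FormallySmooth ℂ R] [Algebra.FormallySmooth ℂ A]
    (hsurj : Function.Surjective (algebraMap R A)) {n : ℕ} {h : Fin n → R}
    {δ : Fin n → Derivation ℂ R R} (hδ : ∀ f, D ℂ R f = ∑ k, δ k f • D ℂ R (h k)) {f : R}
    (hf : f ∈ RingHom.ker (algebraMap R A)) (h0 : ∀ k, δ k f ∈ RingHom.ker (algebraMap R A)) :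
    f ∈ RingHom.ker (algebraMap R A) ^ 2 := by
  refine mem_ker_sq_of_tmul_D_eq_zero hsurj hf ?_
  rw [hδ, tmul_sum]
  refine Finset.sum_eq_zero fun k _ => ?_
  rw [← smul_tmul, ← Algebra.algebraMap_eq_smul_one, RingHom.mem_ker.1 (h0 k), zero_tmul]

/-- The values of `v` on the restrictions of the `h_k` lift arbitrarily to `e_k`; the dual basis
formula shows that `∑ e_k δ_k` induces `v`. -/
lemma exists_lift_derivation (hsurj : Function.Surjective (algebraMap R A)) {n : ℕ} {h : Fin n → R}
    {δ : Fin n → Derivation ℂ R R} (hδ : ∀ f, D ℂ R f = ∑ k, δ k f • D ℂ R (h k))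
    (v : Derivation ℂ A A) :
    ∃ E : Derivation ℂ R R, ∀ f, algebraMap R A (E f) = v (algebraMap R A f) := by
  choose e he using fun k => hsurj (v (algebraMap R A (h k)))
  refine ⟨∑ k, e k • δ k, fun f => ?_⟩
  have h1 := derivation_eq_sum_of_dual_basis hδ (v.compAlgebraMap R) f
  change v (algebraMap R A f) = ∑ k, δ k f • v (algebraMap R A (h k)) at h1
  rw [h1, ← Derivation.coeFnAddMonoidHom_apply, map_sum, Finset.sum_apply, map_sum]
  refine Finset.sum_congr rfl fun k _ => ?_
  simp [he, Algebra.smul_def, mul_comm]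

/-- A one-form whose restriction to the subvariety vanishes is, along the subvariety, the
differential of a function that vanishes on the subvariety. -/
lemma exists_mem_ker_of_restrict_eq_zero [Algebra.FormallySmooth ℂ A] [Algebra.FiniteType ℂ A]
    (hsurj : Function.Surjective (algebraMap R A)) {n : ℕ} (h e : Fin n → R)
    (h0 : ∀ v : Derivation ℂ A A,
      ∑ k, algebraMap R A (e k) * v (algebraMap R A (h k)) = 0) :
    ∃ f ∈ RingHom.ker (algebraMap R A), ∀ E : Derivation ℂ R A,
      E f = ∑ k, algebraMap R A (e k) * E (h k) := by
  obtain ⟨m, h', δ', hδ'⟩ := exists_dual_basis A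
  -- A dual basis of `Ω[A⁄ℂ]` shows that a one-form on which all derivations of `A` vanish is zero.
  -- Exactness of the conormal sequence then gives `f`.
  have hz : KaehlerDifferential.mapBaseChange ℂ R A
      (∑ k, algebraMap R A (e k) ⊗ₜ D ℂ R (h k)) = 0 := by
    rw [map_sum]
    simp only [mapBaseChange_tmul, map_D]
    have : ∀ k, algebraMap R A (e k) • D ℂ A (algebraMap R A (h k)) =
        ∑ l, (algebraMap R A (e k) * δ' l (algebraMap R A (h k))) • D ℂ A (h' l) := fun k => by
      rw [hδ', Finset.smul_sum]
      simp only [mul_smul]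
    simp only [this]
    rw [Finset.sum_comm]
    refine Finset.sum_eq_zero fun l _ => ?_
    rw [← Finset.sum_smul, h0, zero_smul]
  obtain ⟨f, hf⟩ := (exact_kerCotangentToTensor_mapBaseChange ℂ R A hsurj _).1 hz
  obtain ⟨f, rfl⟩ := Ideal.toCotangent_surjective _ f
  rw [kerCotangentToTensor_toCotangent] at hf
  refine ⟨f.1, f.2, fun E => ?_⟩
  let l : A ⊗[R] Ω[R⁄ℂ] →ₗ[A] A := AlgebraTensorModule.lift
    (LinearMap.toSpanSingleton A _ E.liftKaehlerDifferential)
  have hl : ∀ a g, l (a ⊗ₜ D ℂ R g) = a * E g := fun a g => by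
    simp [l, Derivation.liftKaehlerDifferential_comp_D]
  have := congrArg l hf
  simpa [map_sum, hl] using this

end Conormal

/-- A triangular system of functionals of the right size on a free module is injective. -/
lemma injective_of_triangular {A M : Type*} [CommRing A] [AddCommGroup M] [Module A M] {d : ℕ}
    (b : Module.Basis (Fin (2 * d)) A M) (T : M →ₗ[A] (Fin d ⊕ Fin d → A)) (p q : Fin d → M)
    (hp : ∀ i j, T (p i) (Sum.inl j) = if i = j then 1 else 0)
    (hq : ∀ i j, T (q i) (Sum.inl j) = 0)
    (hq' : ∀ i j, T (q i) (Sum.inr j) = if i = j then 1 else 0) : Function.Injective T := by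
  have hsurj : Function.Surjective T := by
    intro w
    refine ⟨∑ i, w (Sum.inl i) • p i +
      ∑ i, (w (Sum.inr i) - ∑ k, w (Sum.inl k) * T (p k) (Sum.inr i)) • q i, ?_⟩
    funext s
    rcases s with j | j
    · simp [hp, hq, Finset.sum_apply]
    · simp [hq', Finset.sum_apply]
  let e : M ≃ₗ[A] (Fin d ⊕ Fin d → A) := b.equivFun.trans
    (LinearEquiv.funCongrLeft A A (finSumFinEquiv.trans (finCongr (two_mul d).symm)))
  -- Source and target are free of the same rank `2d`, so surjectivity, proved by back substitution,
  -- implies injectivity.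
  have := OrzechProperty.injective_of_surjective_endomorphism (T.comp e.symm.toLinearMap)
    (hsurj.comp e.symm.surjective)
  exact fun a b hab => e.injective (this (by simpa using hab))

/-! ### Coordinates -/

/-- The differentials of `u` form a basis. -/
def IsCoordinates {R : Type*} [CommRing R] [Algebra ℂ R] {κ : Type*} (u : κ → R) : Prop :=
  ∃ b : Module.Basis κ R Ω[R⁄ℂ], ∀ i, b i = D ℂ R (u i)

section Coordinates

variable {R : Type*} [CommRing R] [Algebra ℂ R] {κ : Type*} {u : κ → R} (hu : IsCoordinates u)
include hu

lemma IsCoordinates.derivation_ext {M : Type*} [AddCommGroup M]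
    [Module R M] [Module ℂ M] [IsScalarTower ℂ R M] {δ δ' : Derivation ℂ R M}
    (h : ∀ i, δ (u i) = δ' (u i)) (f : R) : δ f = δ' f := by
  obtain ⟨b, hb⟩ := hu
  have : δ.liftKaehlerDifferential = δ'.liftKaehlerDifferential := b.ext fun i => by
    rw [hb, ← derivation_apply_eq_lift, ← derivation_apply_eq_lift, h]
  rw [derivation_apply_eq_lift, this, ← derivation_apply_eq_lift]

lemma IsCoordinates.exists_partial [DecidableEq κ] : ∃ δ : κ → Derivation ℂ R R,
    ∀ i j, δ i (u j) = if i = j then 1 else 0 := by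
  obtain ⟨b, hb⟩ := hu
  refine ⟨fun i => (b.coord i).compDer (D ℂ R), fun i j => ?_⟩
  change b.coord i (D ℂ R (u j)) = _
  rw [← hb, Module.Basis.coord_apply, Module.Basis.repr_self, Finsupp.single_apply]
  simp only [eq_comm]

lemma IsCoordinates.of_formallyEtale {S : Type*} [CommRing S] [Algebra ℂ S] [Algebra R S]
    [IsScalarTower ℂ R S] [Algebra.FormallyEtale R S] :
    IsCoordinates fun i => algebraMap R S (u i) := by
  obtain ⟨b, hb⟩ := hu
  refine ⟨(b.baseChange S).map (tensorKaehlerEquivOfFormallyEtale ℂ R S), fun i => ?_⟩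
  rw [Module.Basis.map_apply, Module.Basis.baseChange_apply, hb,
    ← tensorKaehlerEquivOfFormallyEtale_symm_D_algebraMap, LinearEquiv.apply_symm_apply]

end Coordinates

end Derivations

end LagrangianNeighborhood

namespace LagrangianNeighborhood

/-! ### Gluing sections -/

section Gluing

variable {X : Scheme.{0}}

lemma presheaf_section_ext {W : X.Opens} {s t : Γ(X, W)}
    (h : ∀ x ∈ W, ∃ (W' : X.Opens) (h : W' ≤ W), x ∈ W' ∧
      X.presheaf.map (homOfLE h).op s = X.presheaf.map (homOfLE h).op t) : s = t := by
  choose U hU hx hst using fun x : W => h x.1 x.2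
  exact X.sheaf.eq_of_locally_eq' U W (fun x => homOfLE (hU x))
    (fun x hxW => Opens.mem_iSup.2 ⟨⟨x, hxW⟩, hx ⟨x, hxW⟩⟩) s t hst

/-- Agreement is required only near each point of an overlap, so that it can be checked on small
affine opens. -/
lemma exists_presheaf_glue {W : X.Opens} {ι : Type} (U : ι → X.Opens) (hU : ∀ i, U i ≤ W)
    (hcover : ∀ x ∈ W, ∃ i, x ∈ U i) (s : ∀ i, Γ(X, U i))
    (hs : ∀ i j, ∀ x ∈ U i, x ∈ U j → ∃ (W' : X.Opens) (hi : W' ≤ U i) (hj : W' ≤ U j), x ∈ W' ∧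
      X.presheaf.map (homOfLE hi).op (s i) = X.presheaf.map (homOfLE hj).op (s j)) :
    ∃ t : Γ(X, W), ∀ i, X.presheaf.map (homOfLE (hU i)).op t = s i := by
  obtain ⟨t, ht, -⟩ := X.sheaf.existsUnique_gluing' U W (fun i => homOfLE (hU i))
    (fun x hx => Opens.mem_iSup.2 (hcover x hx)) s (fun i j => by
      refine presheaf_section_ext (X := X) fun x hx => ?_
      obtain ⟨W', hi, hj, hxW, h⟩ := hs i j x hx.1 hx.2
      refine ⟨W', le_inf hi hj, hxW, ?_⟩
      change X.presheaf.map _ (X.presheaf.map _ _) = X.presheaf.map _ (X.presheaf.map _ _)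
      rw [← ConcreteCategory.comp_apply, ← ConcreteCategory.comp_apply, ← Functor.map_comp,
        ← Functor.map_comp]
      exact h)
  exact ⟨t, ht⟩

lemma exists_affine_mem {W : X.Opens} {x : X} (hx : x ∈ W) :
    ∃ W' : X.Opens, IsAffineOpen W' ∧ W' ≤ W ∧ x ∈ W' := by
  obtain ⟨_, ⟨W', hW', rfl⟩, hxW', h⟩ := X.isBasis_affineOpens.exists_subset_of_mem_open hx W.2
  exact ⟨W', hW', h, hxW'⟩

variable [X.Over SpecC]

lemma section_ext {W : X.Opens} {s t : Γ(X, W)}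
    (h : ∀ (W' : X.Opens) (h : W' ≤ W), IsAffineOpen W' → res h s = res h t) : s = t :=
  presheaf_section_ext fun _ hx =>
    let ⟨W', hW', hle, hxW'⟩ := exists_affine_mem hx
    ⟨W', hle, hxW', h W' hle hW'⟩

lemma exists_section_glue {W : X.Opens} {ι : Type} (U : ι → X.Opens) (hU : ∀ i, U i ≤ W)
    (hcover : ∀ x ∈ W, ∃ i, x ∈ U i) (s : ∀ i, Γ(X, U i))
    (hs : ∀ i j, ∀ x ∈ U i, x ∈ U j → ∃ (W' : X.Opens) (hi : W' ≤ U i) (hj : W' ≤ U j), x ∈ W' ∧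
      res hi (s i) = res hj (s j)) :
    ∃ t : Γ(X, W), ∀ i, res (hU i) t = s i :=
  exists_presheaf_glue U hU hcover s hs

end Gluing

/-! ### Smoothness of rings of sections -/

section SmoothSections

variable {X : Scheme.{0}} [X.Over SpecC]

/-- The restriction map is the identity morphism of `X`, which is étale, read on the two affine
opens. -/
lemma etale_res {W W' : X.Opens} (hW : IsAffineOpen W) (hW' : IsAffineOpen W') (h : W' ≤ W) :
    (res h : Γ(X, W) →ₐ[ℂ] Γ(X, W')).toRingHom.Etale := by
  have := (𝟙 X : X ⟶ X).etale_appLE hW hW' h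
  have h2 : (𝟙 X : X ⟶ X).appLE W W' h = X.presheaf.map (homOfLE h).op := by
    simp [Scheme.Hom.appLE]
    rfl
  rw [h2] at this
  exact this

lemma algebraMap_sections_eq (W : X.Opens) : algebraMap ℂ Γ(X, W) =
    ((X ↘ SpecC).appLE ⊤ W le_top).hom.comp
      (Scheme.ΓSpecIso (CommRingCat.of ℂ)).inv.hom := rfl

lemma smooth_sections [Smooth (X ↘ SpecC)] {W : X.Opens} (hW : IsAffineOpen W) :
    Algebra.Smooth ℂ Γ(X, W) := by
  rw [← RingHom.smooth_algebraMap, algebraMap_sections_eq]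
  exact RingHom.Smooth.respectsIso.2 _ (Scheme.ΓSpecIso (CommRingCat.of ℂ)).symm.commRingCatIsoToRingEquiv
    ((X ↘ SpecC).smooth_appLE (isAffineOpen_top SpecC) hW le_top)

/-- Local coordinates on a smooth variety. -/
lemma exists_coordinates (n : ℕ) [SmoothOfRelativeDimension n (X ↘ SpecC)] (x : X) :
    ∃ (W : X.Opens) (u : Fin n → Γ(X, W)), IsAffineOpen W ∧ x ∈ W ∧ IsCoordinates u := by
  obtain ⟨U, hU, W, hW, hx, e, h⟩ :=
    SmoothOfRelativeDimension.exists_isStandardSmoothOfRelativeDimension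
      (n := n) (f := X ↘ SpecC) x
  -- `Spec ℂ` is a single point.
  have hUtop : U = ⊤ := by
    refine top_le_iff.1 fun y _ => ?_
    have : Subsingleton (SpecC : Scheme) :=
      inferInstanceAs (Subsingleton (PrimeSpectrum ℂ))
    rw [Subsingleton.elim y ((X ↘ SpecC) x)]
    exact e hx
  subst hUtop
  have h' : (algebraMap ℂ Γ(X, W)).IsStandardSmoothOfRelativeDimension n := by
    rw [algebraMap_sections_eq]
    exact (RingHom.isStandardSmoothOfRelativeDimension_respectsIso).2 _
      (Scheme.ΓSpecIso (CommRingCat.of ℂ)).symm.commRingCatIsoToRingEquiv h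
  rw [RingHom.isStandardSmoothOfRelativeDimension_algebraMap] at h'
  obtain ⟨ι, σ, _, _, P, hP⟩ := h'.out
  have := Fintype.ofFinite ι
  have := Fintype.ofFinite σ
  classical
  -- The differentials of the variables outside the range of `P.map` form a basis of the Kähler
  -- differentials; the relative dimension counts these variables.
  have hcard : Fintype.card ((Set.range P.map)ᶜ : Set ι) = n := by
    rw [← hP, Algebra.Presentation.dimension, Fintype.card_compl_set,
      Set.card_range_of_injective P.map_inj, Nat.card_eq_fintype_card, Nat.card_eq_fintype_card]
  let e := Fintype.equivFinOfCardEq hcard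
  exact ⟨W, fun i => P.val (e.symm i), hW, hx, P.basisKaehler.reindex e, fun i => by simp⟩

end SmoothSections

end LagrangianNeighborhood

namespace LagrangianNeighborhood

/-! ### Vector fields on affine opens -/

section

open KaehlerDifferential

/-- Derivations related along `φ` on the image of an étale homomorphism are related along `φ`. -/
lemma map_derivation_eq {R S S' : Type*} [CommRing R] [CommRing S] [CommRing S'] [Algebra ℂ R]
    [Algebra ℂ S] [Algebra ℂ S'] (ρ : R →ₐ[ℂ] S) (hρ : ρ.toRingHom.Etale) (φ : S →ₐ[ℂ] S')
    (δ : Derivation ℂ S S) (δ' : Derivation ℂ S' S')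
    (h : ∀ r, φ (δ (ρ r)) = δ' (φ (ρ r))) (s : S) : φ (δ s) = δ' (φ s) := by
  let _ : Algebra R S := ρ.toRingHom.toAlgebra
  have : IsScalarTower ℂ R S := .of_algebraMap_eq fun z => (ρ.commutes z).symm
  have : Algebra.Etale R S := hρ
  let _ : Algebra S S' := φ.toRingHom.toAlgebra
  have : IsScalarTower ℂ S S' := .of_algebraMap_eq fun z => (φ.commutes z).symm
  let E : Derivation ℂ S S' := Derivation.mk' (φ.toLinearMap ∘ₗ δ.toLinearMap) fun a b => by
    change φ (δ (a * b)) = φ a * φ (δ b) + φ b * φ (δ a)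
    simp [Derivation.leibniz]
  exact derivation_eq_of_formallyUnramified (R := R) E (δ'.compAlgebraMap S) h s

end

variable {X : Scheme.{0}} [X.Over SpecC]

namespace VectorField

/-- A vector field on an open subset of an affine open `Q` is determined by its values on the
functions on `Q`. -/
lemma ext_of_affine {Q W : X.Opens} (hQ : IsAffineOpen Q) (hW : W ≤ Q) {D E : VectorField X W}
    (h : ∀ f : Γ(X, Q), D.der W le_rfl (res hW f) = E.der W le_rfl (res hW f)) : D = E := by
  ext W' h' f
  refine section_ext fun W'' h'' hW'' => ?_
  rw [D.res_der, E.res_der]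
  refine map_derivation_eq (res (h''.trans (h'.trans hW))) (etale_res hQ hW'' _)
    (AlgHom.id ℂ _) _ (E.der W'' _) (fun r => ?_) _
  have h1 := congrArg (res (h''.trans h')) (h r)
  rw [D.res_der, E.res_der, res_res] at h1
  exact h1

/-- The derivation extends to every smaller affine open because restriction is étale, and the
extension is unique, hence compatible with restriction. On an arbitrary open the values are glued
from its affine opens. -/
lemma exists_of_derivation {Q : X.Opens} (hQ : IsAffineOpen Q) (δ : Derivation ℂ Γ(X, Q) Γ(X, Q)) :
    ∃ D : VectorField X Q, ∀ f, D.der Q le_rfl f = δ f := by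
  have haff : ∀ W : {W : X.affineOpens // W.1 ≤ Q}, ∃ δ' : Derivation ℂ Γ(X, W.1.1) Γ(X, W.1.1),
      ∀ f, δ' (res W.2 f) = res W.2 (δ f) := by
    intro W
    let _ : Algebra Γ(X, Q) Γ(X, W.1.1) := (res W.2).toRingHom.toAlgebra
    have : IsScalarTower ℂ Γ(X, Q) Γ(X, W.1.1) :=
      .of_algebraMap_eq fun z => ((res W.2).commutes z).symm
    have : Algebra.Etale Γ(X, Q) Γ(X, W.1.1) := etale_res hQ W.1.2 W.2
    exact exists_derivation_extension δ
  choose d hd using haff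
  have hcompat : ∀ (W W' : {W : X.affineOpens // W.1 ≤ Q}) (h : W'.1.1 ≤ W.1.1) (f : Γ(X, W.1.1)),
      res h (d W f) = d W' (res h f) := fun W W' h f =>
    map_derivation_eq (res W.2) (etale_res hQ W.1.2 W.2) (res h) (d W) (d W') (fun r => by
      rw [hd, res_res, res_res, hd]) f
  have hglue : ∀ (W : {W : X.Opens // W ≤ Q}) (f : Γ(X, W.1)), ∃ g : Γ(X, W.1),
      ∀ W' : {W' : X.affineOpens // W'.1 ≤ W.1},
        res W'.2 g = d ⟨W'.1, W'.2.trans W.2⟩ (res W'.2 f) := by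
    intro W f
    refine exists_section_glue (fun W' : {W' : X.affineOpens // W'.1 ≤ W.1} => W'.1.1)
      (fun W' => W'.2) (fun x hx => ?_)
      (fun W' => d ⟨W'.1, W'.2.trans W.2⟩ (res W'.2 f)) fun W₁ W₂ x h1 h2 => ?_
    · obtain ⟨W', hW', hle, hxW'⟩ := exists_affine_mem hx
      exact ⟨⟨⟨W', hW'⟩, hle⟩, hxW'⟩
    · obtain ⟨W', hW', hle, hxW'⟩ := exists_affine_mem (W := W₁.1.1 ⊓ W₂.1.1) ⟨h1, h2⟩
      refine ⟨W', hle.trans inf_le_left, hle.trans inf_le_right, hxW', ?_⟩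
      rw [hcompat ⟨W₁.1, W₁.2.trans W.2⟩ ⟨⟨W', hW'⟩, hle.trans (inf_le_left.trans
        (W₁.2.trans W.2))⟩, hcompat ⟨W₂.1, W₂.2.trans W.2⟩ ⟨⟨W', hW'⟩, hle.trans (inf_le_left.trans
        (W₁.2.trans W.2))⟩, res_res, res_res]
  choose D hD using hglue
  have hext : ∀ (W : {W : X.Opens // W ≤ Q}) (f g : Γ(X, W.1)),
      (∀ W' : {W' : X.affineOpens // W'.1 ≤ W.1}, res W'.2 f = res W'.2 g) → f = g :=
    fun W f g h => section_ext fun W' hle hW' => h ⟨⟨W', hW'⟩, hle⟩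
  let Der : ∀ W : {W : X.Opens // W ≤ Q}, Derivation ℂ Γ(X, W.1) Γ(X, W.1) := fun W =>
    Derivation.mk'
      { toFun := D W
        map_add' := fun f g => hext W _ _ fun W' => by
          rw [map_add, hD, hD, hD, map_add, map_add]
        map_smul' := fun z f => hext W _ _ fun W' => by
          rw [RingHom.id_apply, map_smul, hD, hD, map_smul, Derivation.map_smul] }
      (fun f g => hext W _ _ fun W' => by
        change res _ (D W (f * g)) = res _ (f * D W g + g * D W f)
        rw [map_add, map_mul, map_mul, hD, hD, hD, map_mul, Derivation.leibniz, smul_eq_mul,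
          smul_eq_mul])
  refine ⟨⟨Der, fun W W' h f => hext W' _ _ fun W'' => ?_⟩, fun f => hext ⟨Q, le_rfl⟩ _ _
    fun W' => ?_⟩
  · change res _ (res _ (D W f)) = res _ (D W' (res h f))
    rw [res_res, hD W f ⟨W''.1, W''.2.trans h⟩, hD, res_res]
  · change res _ (D ⟨Q, le_rfl⟩ f) = _
    rw [hD, hd]

/-- A dual basis for the vector fields on the open subsets of an affine open. -/
lemma exists_dual_basis [Smooth (X ↘ SpecC)] {Q : X.Opens} (hQ : IsAffineOpen Q) :
    ∃ (n : ℕ) (h : Fin n → Γ(X, Q)) (E : Fin n → VectorField X Q),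
      (∀ f, KaehlerDifferential.D ℂ Γ(X, Q) f =
        ∑ k, (E k).der Q le_rfl f • KaehlerDifferential.D ℂ Γ(X, Q) (h k)) ∧
      ∀ (W : X.Opens) (hW : W ≤ Q) (D : VectorField X W),
        D = ∑ k, D.der W le_rfl (res hW (h k)) • (E k).restrict hW := by
  have := smooth_sections hQ
  obtain ⟨n, h, δ, hδ⟩ := LagrangianNeighborhood.exists_dual_basis Γ(X, Q)
  choose E hE using fun k => exists_of_derivation hQ (δ k)
  refine ⟨n, h, E, fun f => by simp only [hE]; exact hδ f, fun W hW D => ?_⟩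
  refine ext_of_affine hQ hW fun f => ?_
  let _ : Algebra Γ(X, Q) Γ(X, W) := (res hW).toRingHom.toAlgebra
  have : IsScalarTower ℂ Γ(X, Q) Γ(X, W) :=
    .of_algebraMap_eq fun z => ((res hW).commutes z).symm
  have h1 := derivation_eq_sum_of_dual_basis hδ ((D.der W le_rfl).compAlgebraMap Γ(X, Q)) f
  change D.der W le_rfl (res hW f) = ∑ k, res hW (δ k f) * D.der W le_rfl (res hW (h k)) at h1
  rw [h1]
  have hsum : ∀ (s : Finset (Fin n)) (F : Fin n → VectorField X W) (g : Γ(X, W)),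
      (∑ k ∈ s, F k).der W le_rfl g = ∑ k ∈ s, (F k).der W le_rfl g := fun s F g =>
    map_sum (AddMonoidHom.mk' (fun F : VectorField X W => F.der W le_rfl g)
      fun _ _ => add_der _ _ _ _) F s
  rw [hsum]
  refine Finset.sum_congr rfl fun k _ => ?_
  rw [smul_der, res_self, restrict_der, ← (E k).res_der le_rfl hW, hE, mul_comm]

end VectorField

/-! ### Hamiltonian vector fields -/

namespace SymplecticForm

variable (ω : SymplecticForm X) {W : X.Opens}

lemma app_skew (W : X.Opens) (D E : VectorField X W) : ω.app W D E = -ω.app W E D := by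
  have h := ω.app_self W (D + E)
  simp only [map_add, LinearMap.add_apply, ω.app_self, zero_add, add_zero] at h
  rw [eq_neg_iff_add_eq_zero, add_comm]
  exact h

/-- Hamiltonian vector fields generate the vector fields on an affine open. -/
lemma exists_eq_sum_hamiltonian [Smooth (X ↘ SpecC)] {Q : X.Opens} (hQ : IsAffineOpen Q)
    (E : VectorField X Q) : ∃ (n : ℕ) (g h : Fin n → Γ(X, Q)),
      E = ∑ k, g k • ω.hamiltonian (h k) := by
  obtain ⟨n, h, D, -, hD⟩ := VectorField.exists_dual_basis hQ
  -- Pairing `∑ ω(E, D_k) X_{h_k}` with `F` gives `∑ ω(E, D_k) F(h_k) = ω(E, F)`, since `F = ∑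
  -- F(h_k) D_k`; nondegeneracy concludes.
  refine ⟨n, fun k => ω.app Q E (D k), h, ?_⟩
  have hl : ∀ (W W' : {W' : X.Opens // W' ≤ Q}) (h : W'.1 ≤ W.1) (F : VectorField X W.1),
      res h (ω.app W.1 (E.restrict W.2) F) = ω.app W'.1 (E.restrict W'.2) (F.restrict h) :=
    fun W W' h F => ω.res_app h _ F
  refine (ω.isNondegenerate Q (fun W => ω.app W.1 (E.restrict W.2)) hl).unique
    (fun W F => rfl) fun W F => ?_
  have hres : (∑ k, ω.app Q E (D k) • ω.hamiltonian (h k)).restrict W.2 =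
      ∑ k, res W.2 (ω.app Q E (D k)) • (ω.hamiltonian (h k)).restrict W.2 := by
    change VectorField.restrictₛₗ W.2 _ = _
    rw [map_sum]
    exact Finset.sum_congr rfl fun k _ => map_smulₛₗ _ _ _
  rw [hres, map_sum, LinearMap.sum_apply]
  conv_rhs => rw [hD W.1 W.2 F, map_sum]
  refine Finset.sum_congr rfl fun k _ => ?_
  rw [map_smul, LinearMap.smul_apply, ω.app_hamiltonian, ω.res_app, map_smul, smul_eq_mul,
    smul_eq_mul, mul_comm]
  rfl

lemma bracket_apply (f g : Γ(X, W)) : ω.bracket f g = (ω.hamiltonian g).der W le_rfl f :=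
  ω.bracket_eq f g

/-- The Jacobi identity, from the closedness of the symplectic form. -/
lemma jacobi (f g h : Γ(X, W)) : ω.bracket (ω.bracket f g) h =
    ω.bracket (ω.bracket f h) g + ω.bracket f (ω.bracket g h) := by
  -- As `ω(D, X_a) = -D(a)`, closedness on three Hamiltonian fields is a relation between double
  -- brackets.
  have key := ω.isClosed W (ω.hamiltonian f) (ω.hamiltonian g) (ω.hamiltonian h)
  have h1 : ∀ (D : VectorField X W) (a : Γ(X, W)), ω.app W D (ω.hamiltonian a) = -D.der W le_rfl a :=
    fun D a => by
      rw [ω.app_skew]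
      have := ω.app_hamiltonian a le_rfl D
      rw [res_self] at this
      exact congrArg Neg.neg this
  simp only [h1, VectorField.lie_der, VectorField.lie_def, ← bracket_apply] at key
  have e1 := ω.bracket_skew f (ω.bracket g h)
  have e2 := ω.bracket_skew h g
  have e3 := ω.bracket_skew h f
  have e4 := ω.bracket_skew g f
  simp only [map_neg, bracket_apply] at key e1 e2 e3 e4 ⊢
  rw [e1]
  simp only [e2, e3, e4, map_neg] at key
  linear_combination -key

end SymplecticForm

end LagrangianNeighborhood

namespace LagrangianNeighborhood

/-! ### Restriction to a closed subvariety -/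

variable {Y V : Scheme.{0}} [Y.Over SpecC] [V.Over SpecC] (i : V ⟶ Y) [i.IsOver SpecC]

/-- The restriction of functions to a subvariety. -/
noncomputable def pull (W : Y.Opens) : Γ(Y, W) →ₐ[ℂ] Γ(V, i ⁻¹ᵁ W) where
  __ := (i.app W).hom
  commutes' z := by
    change (i.app W).hom (((Y ↘ SpecC).appLE ⊤ W le_top).hom
      ((Scheme.ΓSpecIso (CommRingCat.of ℂ)).inv.hom z)) =
      ((V ↘ SpecC).appLE ⊤ (i ⁻¹ᵁ W) le_top).hom ((Scheme.ΓSpecIso (CommRingCat.of ℂ)).inv.hom z)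
    have h : (Y ↘ SpecC).appLE ⊤ W le_top ≫ i.app W =
        (V ↘ SpecC).appLE ⊤ (i ⁻¹ᵁ W) le_top := by
      have h := Scheme.Hom.appLE_comp_appLE i (Y ↘ SpecC) ⊤ W (i ⁻¹ᵁ W) le_top le_rfl
      rw [Scheme.Hom.appLE_eq_app] at h
      simp only [comp_over] at h
      exact h
    rw [← h]
    rfl

lemma res_pull {W W' : Y.Opens} (h : W' ≤ W) (f : Γ(Y, W)) :
    res (i.preimage_mono h) (pull i W f) = pull i W' (res h f) := by
  change (i.app W ≫ V.presheaf.map (homOfLE (i.preimage_mono h)).op).hom f =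
    (Y.presheaf.map (homOfLE h).op ≫ i.app W').hom f
  rw [i.naturality]
  rfl

/-- On a smaller affine open both sides are derivations along the restriction to `V` that agree on
functions from `Q`, hence everywhere by étaleness. General opens follow locally. -/
lemma isRelated_of_affine {Q : Y.Opens} (hQ : IsAffineOpen Q) {E : VectorField Y Q}
    {v : VectorField V (i ⁻¹ᵁ Q)}
    (h : ∀ f, pull i Q (E.der Q le_rfl f) = v.der _ le_rfl (pull i Q f)) : IsRelated i E v := by
  intro W hW f
  refine presheaf_section_ext fun x hx => ?_
  obtain ⟨W', hW', hle, hxW'⟩ := exists_affine_mem (W := W) (x := i x) hx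
  refine ⟨i ⁻¹ᵁ W', i.preimage_mono hle, hxW', ?_⟩
  change res (i.preimage_mono hle) (pull i W (E.der W hW f)) =
    res (i.preimage_mono hle) (v.der _ _ (pull i W f))
  rw [res_pull i hle, v.res_der, res_pull i hle, E.res_der]
  refine map_derivation_eq (res (hle.trans hW)) (etale_res hQ hW' _) (pull i W') _
    (v.der _ _) (fun r => ?_) _
  have := congrArg (res (i.preimage_mono (hle.trans hW))) (h r)
  rw [res_pull i (hle.trans hW), v.res_der, res_pull i (hle.trans hW), E.res_der] at this
  exact this

variable [IsClosedImmersion i]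

lemma pull_surjective {Q : Y.Opens} (hQ : IsAffineOpen Q) : Function.Surjective (pull i Q) :=
  Scheme.Hom.app_surjective i Q hQ

lemma ker_pull {Q : Y.Opens} (hQ : IsAffineOpen Q) :
    RingHom.ker (pull i Q) = i.ker.ideal ⟨Q, hQ⟩ :=
  (Scheme.Hom.ker_apply i ⟨Q, hQ⟩).symm

section Smooth

variable [Smooth (Y ↘ SpecC)] [Smooth (V ↘ SpecC)]

/-- Vector fields on a smooth affine subvariety extend to the ambient variety. -/
lemma exists_isRelated {Q : Y.Opens} (hQ : IsAffineOpen Q) (v : VectorField V (i ⁻¹ᵁ Q)) :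
    ∃ E : VectorField Y Q, IsRelated i E v := by
  let _ : Algebra Γ(Y, Q) Γ(V, i ⁻¹ᵁ Q) := (pull i Q).toRingHom.toAlgebra
  have : IsScalarTower ℂ Γ(Y, Q) Γ(V, i ⁻¹ᵁ Q) :=
    .of_algebraMap_eq fun z => ((pull i Q).commutes z).symm
  have := smooth_sections hQ
  obtain ⟨n, h, δ, hδ⟩ := exists_dual_basis Γ(Y, Q)
  obtain ⟨E, hE⟩ := exists_lift_derivation (A := Γ(V, i ⁻¹ᵁ Q)) (pull_surjective i hQ) hδ
    (v.der _ le_rfl)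
  obtain ⟨E', hE'⟩ := VectorField.exists_of_derivation hQ E
  exact ⟨E', isRelated_of_affine i hQ fun f => by rw [hE']; exact hE f⟩

variable (ω : SymplecticForm Y) (hV : ω.toTwoForm.RestrictsToZero i)

include hV in
/-- On an isotropic subvariety every vector field is, up to sign, the restriction of the
Hamiltonian vector field of a function that vanishes on the subvariety. -/
lemma exists_hamiltonian_eq {Q : Y.Opens} (hQ : IsAffineOpen Q) (v : VectorField V (i ⁻¹ᵁ Q)) :
    ∃ f, pull i Q f = 0 ∧ ∀ h, pull i Q (ω.bracket f h) = -v.der _ le_rfl (pull i Q h) := by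
  obtain ⟨E, hE⟩ := exists_isRelated i hQ v
  obtain ⟨n, h, D, -, hD⟩ := VectorField.exists_dual_basis hQ
  have hsum : ∀ E' : VectorField Y Q, ∑ k, pull i Q (ω.app Q E (D k)) *
      pull i Q (E'.der Q le_rfl (h k)) = pull i Q (ω.app Q E E') := by
    intro E'
    conv_rhs => rw [hD Q le_rfl E', map_sum, map_sum]
    refine Finset.sum_congr rfl fun k _ => ?_
    rw [map_smul, smul_eq_mul, map_mul, mul_comm, res_self]
    rfl
  let _ : Algebra Γ(Y, Q) Γ(V, i ⁻¹ᵁ Q) := (pull i Q).toRingHom.toAlgebra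
  have : IsScalarTower ℂ Γ(Y, Q) Γ(V, i ⁻¹ᵁ Q) :=
    .of_algebraMap_eq fun z => ((pull i Q).commutes z).symm
  have := smooth_sections (hQ.preimage i)
  -- The one-form `ω(E, -) = ∑ ω(E, D_k) dh_k`, with `E` extending `v`, restricts to zero on `V` by
  -- isotropy. So along `V` it is the differential of a function `f` vanishing on `V`.
  obtain ⟨f, hf, hfE⟩ := exists_mem_ker_of_restrict_eq_zero (A := Γ(V, i ⁻¹ᵁ Q))
    (pull_surjective i hQ) h (fun k => ω.app Q E (D k)) (fun v' => by
      obtain ⟨v'', hv''⟩ := VectorField.exists_of_derivation (hQ.preimage i) v'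
      obtain ⟨E', hE'⟩ := exists_isRelated i hQ v''
      have h1 : ∀ g, v' (pull i Q g) = pull i Q (E'.der Q le_rfl g) := fun g => by
        rw [← hv'']; exact (hE' Q le_rfl g).symm
      change ∑ k, pull i Q (ω.app Q E (D k)) * v' (pull i Q (h k)) = 0
      simp only [h1, hsum]
      exact hV Q E E' v v'' hE hE')
  refine ⟨f, hf, fun g => ?_⟩
  let X : Derivation ℂ Γ(Y, Q) Γ(V, i ⁻¹ᵁ Q) := Derivation.mk'
    ((pull i Q).toLinearMap ∘ₗ ((ω.hamiltonian g).der Q le_rfl).toLinearMap) fun a b => by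
      change pull i Q ((ω.hamiltonian g).der Q le_rfl (a * b)) = pull i Q a * _ + pull i Q b * _
      simp [Derivation.leibniz]
  have h2 : pull i Q ((ω.hamiltonian g).der Q le_rfl f) =
    ∑ k, pull i Q (ω.app Q E (D k)) * pull i Q ((ω.hamiltonian g).der Q le_rfl (h k)) := hfE X
  rw [ω.bracket_apply, h2, hsum, ω.app_skew, map_neg]
  have h3 := ω.app_hamiltonian g le_rfl E
  rw [res_self] at h3
  change -pull i Q (ω.app Q ((ω.hamiltonian g).restrict le_rfl) E) = _
  rw [h3]
  exact congrArg Neg.neg (hE Q le_rfl g)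

open TensorProduct in
include hV in
/-- An isotropic subvariety of half the dimension is coisotropic. -/
lemma pull_bracket_eq_zero_of_coordinates {d : ℕ} {Q : Y.Opens} (hQ : IsAffineOpen Q)
    {w : Fin (2 * d) → Γ(Y, Q)} (hw : IsCoordinates w) {u : Fin d → Γ(V, i ⁻¹ᵁ Q)}
    (hu : IsCoordinates u) {f g : Γ(Y, Q)} (hf : pull i Q f = 0) (hg : pull i Q g = 0) :
    pull i Q (ω.bracket g f) = 0 := by
  let _ : Algebra Γ(Y, Q) Γ(V, i ⁻¹ᵁ Q) := (pull i Q).toRingHom.toAlgebra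
  have : IsScalarTower ℂ Γ(Y, Q) Γ(V, i ⁻¹ᵁ Q) :=
    .of_algebraMap_eq fun z => ((pull i Q).commutes z).symm
  obtain ⟨δ, hδ⟩ := hu.exists_partial
  choose v hv using fun j => VectorField.exists_of_derivation (hQ.preimage i) (δ j)
  choose E hE using fun j => exists_isRelated i hQ (v j)
  choose φ hφ hφv using fun j => exists_hamiltonian_eq i ω hV hQ (v j)
  choose x hx using fun j => pull_surjective i hQ (u j)
  let der : VectorField Y Q → Derivation ℂ Γ(Y, Q) Γ(V, i ⁻¹ᵁ Q) := fun D => Derivation.mk'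
    ((pull i Q).toLinearMap ∘ₗ (D.der Q le_rfl).toLinearMap) fun a b => by
      change pull i Q (D.der Q le_rfl (a * b)) = pull i Q a * _ + pull i Q b * _
      simp [Derivation.leibniz]
  let lin : VectorField Y Q → Γ(V, i ⁻¹ᵁ Q) ⊗[Γ(Y, Q)] Ω[Γ(Y, Q)⁄ℂ] →ₗ[Γ(V, i ⁻¹ᵁ Q)]
      Γ(V, i ⁻¹ᵁ Q) := fun D => AlgebraTensorModule.lift
        (LinearMap.toSpanSingleton Γ(V, i ⁻¹ᵁ Q) _ (der D).liftKaehlerDifferential)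
  have hlin : ∀ D a h, lin D (a ⊗ₜ KaehlerDifferential.D ℂ _ h) =
      a * pull i Q (D.der Q le_rfl h) := fun D a h => by
    simp only [lin, AlgebraTensorModule.lift_tmul, LinearMap.toSpanSingleton_apply,
      LinearMap.smul_apply, Derivation.liftKaehlerDifferential_comp_D, smul_eq_mul]
    rfl
  -- Pairing of one-forms along `V` with `2d` vector fields: extensions of the `∂_j`, and the fields
  -- `-X_{x_j}`. It is triangular on the `dx_j` and `dφ_j`, hence injective.
  let T := LinearMap.pi (Sum.elim (fun j => lin (E j)) fun j => -lin (ω.hamiltonian (x j)))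
  have hTl : ∀ m j, T m (Sum.inl j) = lin (E j) m := fun m j => rfl
  have hTr : ∀ m j, T m (Sum.inr j) = -lin (ω.hamiltonian (x j)) m := fun m j => rfl
  have hEpull : ∀ j h, pull i Q ((E j).der Q le_rfl h) = δ j (pull i Q h) := fun j h => by
    rw [← hv]; exact hE j Q le_rfl h
  have hφpull : ∀ j h, pull i Q ((ω.hamiltonian h).der Q le_rfl (φ j)) = -δ j (pull i Q h) :=
    fun j h => by rw [← ω.bracket_apply, hφv, hv]
  obtain ⟨b, hb⟩ := hw
  have hT : Function.Injective T := injective_of_triangular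
    (b.baseChange Γ(V, i ⁻¹ᵁ Q)) T
    (fun j => 1 ⊗ₜ KaehlerDifferential.D ℂ _ (x j))
    (fun j => 1 ⊗ₜ KaehlerDifferential.D ℂ _ (φ j))
    (fun j k => by rw [hTl, hlin, one_mul, hEpull, hx, hδ]; simp only [eq_comm])
    (fun j k => by rw [hTl, hlin, one_mul, hEpull, hφ, map_zero])
    (fun j k => by rw [hTr, hlin, one_mul, hφpull, hx, hδ, neg_neg])
  -- So a function `g` vanishing on `V` satisfies `dg = -∑ {g, x_k} dφ_k` along `V`. Pairing with
  -- `X_f` gives zero, since `X_f φ_k = -∂_k (f|_V) = 0`.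
  have hz : (1 : Γ(V, i ⁻¹ᵁ Q)) ⊗ₜ[Γ(Y, Q)] KaehlerDifferential.D ℂ Γ(Y, Q) g +
      ∑ k, pull i Q ((ω.hamiltonian (x k)).der Q le_rfl g) ⊗ₜ KaehlerDifferential.D ℂ _ (φ k) =
      0 := by
    apply hT
    rw [map_zero]
    funext s
    rcases s with j | j
    · rw [hTl, map_add, map_sum]
      simp only [hlin, hEpull, hφ, hg, map_zero, mul_zero, Finset.sum_const_zero, add_zero,
        Pi.zero_apply]
    · rw [hTr, map_add, map_sum]
      simp only [hlin, hφpull, hx, hδ, one_mul, mul_neg, mul_ite, mul_one, mul_zero,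
        Finset.sum_neg_distrib, Finset.sum_ite_eq', Finset.mem_univ, if_true, Pi.zero_apply]
      ring
  have h := congrArg (lin (ω.hamiltonian f)) hz
  rw [map_add, map_sum] at h
  simp only [hlin, hφpull, hf, map_zero, neg_zero, mul_zero, Finset.sum_const_zero, add_zero,
    one_mul] at h
  rw [ω.bracket_apply, h]

end Smooth

/-- Small affine neighbourhoods with coordinates on the variety and on the subvariety. -/
lemma exists_adapted_neighbourhood (m n : ℕ) [SmoothOfRelativeDimension m (Y ↘ SpecC)]
    [SmoothOfRelativeDimension n (V ↘ SpecC)] {p : V} {W : Y.Opens} (hp : i p ∈ W) :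
    ∃ (Q : Y.Opens) (w : Fin m → Γ(Y, Q)) (u : Fin n → Γ(V, i ⁻¹ᵁ Q)), IsAffineOpen Q ∧ Q ≤ W ∧
      i p ∈ Q ∧ IsCoordinates w ∧ IsCoordinates u := by
  obtain ⟨W₁, w, hW₁, hp₁, hw⟩ := exists_coordinates (X := Y) m (i p)
  obtain ⟨W₂, u, hW₂, hp₂, hu⟩ := exists_coordinates (X := V) n p
  obtain ⟨O, hO, hOW⟩ := i.isClosedEmbedding.isInducing.isOpen_iff.1 W₂.2
  have hpO : i p ∈ O := by
    change p ∈ (i : V → Y) ⁻¹' O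
    rw [hOW]; exact hp₂
  obtain ⟨Q, hQ, hle, hpQ⟩ := exists_affine_mem (W := W ⊓ W₁ ⊓ ⟨O, hO⟩) (x := i p)
    ⟨⟨hp, hp₁⟩, hpO⟩
  have hQ₁ : Q ≤ W₁ := hle.trans (inf_le_left.trans inf_le_right)
  have hQ₂ : i ⁻¹ᵁ Q ≤ W₂ := fun x hx => by
    have : x ∈ (i : V → Y) ⁻¹' O := (hle hx).2
    rw [hOW] at this; exact this
  refine ⟨Q, fun j => res hQ₁ (w j), fun j => res hQ₂ (u j), hQ,
    hle.trans (inf_le_left.trans inf_le_left), hpQ, ?_, ?_⟩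
  · let _ : Algebra Γ(Y, W₁) Γ(Y, Q) := (res hQ₁).toRingHom.toAlgebra
    have : IsScalarTower ℂ Γ(Y, W₁) Γ(Y, Q) :=
      .of_algebraMap_eq fun z => ((res hQ₁).commutes z).symm
    have : Algebra.Etale Γ(Y, W₁) Γ(Y, Q) := etale_res hW₁ hQ hQ₁
    exact hw.of_formallyEtale (S := Γ(Y, Q))
  · let _ : Algebra Γ(V, W₂) Γ(V, i ⁻¹ᵁ Q) := (res hQ₂).toRingHom.toAlgebra
    have : IsScalarTower ℂ Γ(V, W₂) Γ(V, i ⁻¹ᵁ Q) :=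
      .of_algebraMap_eq fun z => ((res hQ₂).commutes z).symm
    have : Algebra.Etale Γ(V, W₂) Γ(V, i ⁻¹ᵁ Q) := etale_res hW₂ (hQ.preimage i) hQ₂
    exact hu.of_formallyEtale (S := Γ(V, i ⁻¹ᵁ Q))

/-! ### Coisotropy and second-order vanishing -/

section Lagrangian

variable (d : ℕ) [SmoothOfRelativeDimension (2 * d) (Y ↘ SpecC)]
  [SmoothOfRelativeDimension d (V ↘ SpecC)] (ω : SymplecticForm Y)
  (hV : ω.toTwoForm.RestrictsToZero i)

include d hV

/-- A Lagrangian subvariety is coisotropic. -/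
lemma pull_bracket_eq_zero {W : Y.Opens} {f g : Γ(Y, W)} (hf : pull i W f = 0)
    (hg : pull i W g = 0) : pull i W (ω.bracket g f) = 0 := by
  have : Smooth (Y ↘ SpecC) := SmoothOfRelativeDimension.smooth (2 * d) _
  have : Smooth (V ↘ SpecC) := SmoothOfRelativeDimension.smooth d _
  refine presheaf_section_ext fun x hx => ?_
  obtain ⟨Q, w, u, hQ, hQW, hxQ, hw, hu⟩ := exists_adapted_neighbourhood i (2 * d) d hx
  refine ⟨i ⁻¹ᵁ Q, i.preimage_mono hQW, hxQ, ?_⟩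
  change res (i.preimage_mono hQW) (pull i W _) = res (i.preimage_mono hQW) 0
  rw [res_pull i hQW, ω.res_bracket, map_zero]
  exact pull_bracket_eq_zero_of_coordinates i ω hV hQ hw hu
    (by rw [← res_pull, hf, map_zero]) (by rw [← res_pull, hg, map_zero])

/-- A function that vanishes on a Lagrangian subvariety and Poisson commutes with coordinates
along the subvariety vanishes to second order. -/
lemma mem_ker_sq_of_bracket_eq_zero {Q : Y.Opens} (hQ : IsAffineOpen Q)
    {u : Fin d → Γ(V, i ⁻¹ᵁ Q)} (hu : IsCoordinates u) {x : Fin d → Γ(Y, Q)}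
    (hx : ∀ j, pull i Q (x j) = u j) {f : Γ(Y, Q)} (hf : pull i Q f = 0)
    (hfx : ∀ j, pull i Q (ω.bracket f (x j)) = 0) : f ∈ RingHom.ker (pull i Q) ^ 2 := by
  have : Smooth (Y ↘ SpecC) := SmoothOfRelativeDimension.smooth (2 * d) _
  have : Smooth (V ↘ SpecC) := SmoothOfRelativeDimension.smooth d _
  -- By coisotropy `X_f` preserves the ideal of `V`, so it descends to a derivation of the functions
  -- on `V`. This kills the coordinates `u`, hence is zero.
  have hdesc : ∀ g h, pull i Q g = pull i Q h →
      pull i Q ((ω.hamiltonian f).der Q le_rfl g) = pull i Q ((ω.hamiltonian f).der Q le_rfl h) := by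
    intro g h hgh
    rw [← sub_eq_zero, ← map_sub, ← map_sub, ← ω.bracket_apply]
    exact pull_bracket_eq_zero i d ω hV hf (by rw [map_sub, hgh, sub_self])
  choose l hl using pull_surjective i hQ
  have hl' : ∀ a g, pull i Q g = a → pull i Q ((ω.hamiltonian f).der Q le_rfl (l a)) =
      pull i Q ((ω.hamiltonian f).der Q le_rfl g) := fun a g h => hdesc _ _ (by rw [hl, h])
  let δ : Derivation ℂ Γ(V, i ⁻¹ᵁ Q) Γ(V, i ⁻¹ᵁ Q) := Derivation.mk'
    { toFun := fun a => pull i Q ((ω.hamiltonian f).der Q le_rfl (l a))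
      map_add' := fun a b => by
        rw [hl' (a + b) (l a + l b) (by rw [map_add, hl, hl]), map_add, map_add]
      map_smul' := fun z a => by
        rw [hl' (z • a) (z • l a) (by rw [map_smul, hl]), Derivation.map_smul, map_smul]
        rfl }
    (fun a b => by
      change pull i Q ((ω.hamiltonian f).der Q le_rfl (l (a * b))) = _
      rw [hl' (a * b) (l a * l b) (by rw [map_mul, hl, hl]), Derivation.leibniz, map_add,
        smul_eq_mul, smul_eq_mul, map_mul, map_mul, hl, hl]
      rfl)
  have hδ : ∀ a, δ a = 0 := hu.derivation_ext (δ' := 0) fun j => by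
    change pull i Q ((ω.hamiltonian f).der Q le_rfl (l (u j))) = 0
    rw [hl' _ _ (hx j), ← ω.bracket_apply, ω.bracket_skew, map_neg, hfx, neg_zero]
  -- All Hamiltonian fields, which generate the vector fields on `Q`, now send `f` into the ideal;
  -- so `df` vanishes along `V`.
  have hbr : ∀ h, pull i Q ((ω.hamiltonian h).der Q le_rfl f) = 0 := fun h => by
    rw [← ω.bracket_apply, ω.bracket_skew, map_neg, ω.bracket_apply, neg_eq_zero,
      ← hl' _ _ rfl]
    exact hδ _
  have hsum : ∀ {n : ℕ} (F : Fin n → VectorField Y Q), (∑ k, F k).der Q le_rfl f =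
      ∑ k, (F k).der Q le_rfl f := fun F =>
    map_sum (AddMonoidHom.mk' (fun F : VectorField Y Q => F.der Q le_rfl f)
      fun _ _ => VectorField.add_der _ _ _ _) F _
  let _ : Algebra Γ(Y, Q) Γ(V, i ⁻¹ᵁ Q) := (pull i Q).toRingHom.toAlgebra
  have : IsScalarTower ℂ Γ(Y, Q) Γ(V, i ⁻¹ᵁ Q) :=
    .of_algebraMap_eq fun z => ((pull i Q).commutes z).symm
  have := smooth_sections hQ
  have := smooth_sections (hQ.preimage i)
  obtain ⟨n, h, E, hE, -⟩ := VectorField.exists_dual_basis hQ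
  refine mem_ker_sq_of_dual_basis (A := Γ(V, i ⁻¹ᵁ Q)) (pull_surjective i hQ) hE hf fun k => ?_
  obtain ⟨m, g, h', hEk⟩ := ω.exists_eq_sum_hamiltonian hQ (E k)
  change pull i Q ((E k).der Q le_rfl f) = 0
  rw [hEk, hsum, map_sum]
  refine Finset.sum_eq_zero fun l _ => ?_
  rw [VectorField.smul_der, map_mul, hbr, mul_zero]

end Lagrangian

end LagrangianNeighborhood

namespace LagrangianNeighborhood

/-! ### Gluing modulo powers of the ideal of a closed subscheme -/

section

variable {Z Y : Scheme.{0}} [Y.Over SpecC] (j : Z ⟶ Y) [IsClosedImmersion j]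

lemma app_res {W W' : Y.Opens} (h : W' ≤ W) (f : Γ(Y, W)) :
    (j.app W').hom (res h f) =
      (Z.presheaf.map (homOfLE (j.preimage_mono h)).op).hom ((j.app W).hom f) := by
  change (Y.presheaf.map (homOfLE h).op ≫ j.app W').hom f =
    (j.app W ≫ Z.presheaf.map (homOfLE (j.preimage_mono h)).op).hom f
  rw [j.naturality]
  rfl

lemma mem_ker_ideal_iff (W : Y.affineOpens) (f : Γ(Y, W.1)) :
    f ∈ j.ker.ideal W ↔ (j.app W.1).hom f = 0 := by
  rw [Scheme.Hom.ker_apply]; rfl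

lemma mem_ker_ideal_of_locally {W : Y.affineOpens} {f : Γ(Y, W.1)}
    (h : ∀ z, j z ∈ W.1 → ∃ (W' : Y.affineOpens) (hle : W'.1 ≤ W.1), j z ∈ W'.1 ∧
      res hle f ∈ j.ker.ideal W') : f ∈ j.ker.ideal W := by
  rw [mem_ker_ideal_iff]
  refine presheaf_section_ext fun z hz => ?_
  obtain ⟨W', hle, hzW', hf⟩ := h z hz
  refine ⟨j ⁻¹ᵁ W'.1, j.preimage_mono hle, hzW', ?_⟩
  rw [mem_ker_ideal_iff, app_res] at hf
  rw [map_zero]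
  exact hf

/-- The restrictions to `Z` glue in the structure sheaf of `Z`; since `W` is affine, the result
lifts to a function on `W`. -/
lemma exists_glue_ker_ideal {W : Y.affineOpens} {κ : Type} (U : κ → Y.affineOpens)
    (hU : ∀ k, (U k).1 ≤ W.1) (hcover : ∀ z, j z ∈ W.1 → ∃ k, j z ∈ (U k).1)
    (f : ∀ k, Γ(Y, (U k).1))
    (hf : ∀ k l z, j z ∈ (U k).1 → j z ∈ (U l).1 → ∃ (W' : Y.affineOpens) (hk : W'.1 ≤ (U k).1)
      (hl : W'.1 ≤ (U l).1), j z ∈ W'.1 ∧ res hk (f k) - res hl (f l) ∈ j.ker.ideal W') :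
    ∃ g : Γ(Y, W.1), ∀ k, res (hU k) g - f k ∈ j.ker.ideal (U k) := by
  obtain ⟨t, ht⟩ := exists_presheaf_glue (W := j ⁻¹ᵁ W.1) (fun k => j ⁻¹ᵁ (U k).1)
    (fun k => j.preimage_mono (hU k)) (fun z hz => hcover z hz)
    (fun k => (j.app (U k).1).hom (f k)) (fun k l z hk hl => by
      obtain ⟨W', hk', hl', hz, h⟩ := hf k l z hk hl
      refine ⟨j ⁻¹ᵁ W'.1, j.preimage_mono hk', j.preimage_mono hl', hz, ?_⟩
      rw [mem_ker_ideal_iff, map_sub, sub_eq_zero, app_res, app_res] at h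
      exact h)
  obtain ⟨g, rfl⟩ := Scheme.Hom.app_surjective j W.1 W.2 t
  refine ⟨g, fun k => ?_⟩
  rw [mem_ker_ideal_iff, map_sub, sub_eq_zero, app_res]
  exact ht k

end

/-! ### Infinitesimal thickenings of a closed subscheme -/

section

variable {Y V : Scheme.{0}} [Y.Over SpecC] (i : V ⟶ Y) [IsClosedImmersion i]

/-- A positive power of the ideal has the same support as the ideal, so a thickening has no new
points. The exponent `0` would give the empty scheme. -/
lemma exists_eq_subschemeι (n : ℕ) (z : (i.ker ^ (n + 1)).subscheme) :
    ∃ x, i x = (i.ker ^ (n + 1)).subschemeι z := by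
  have h : (i.ker ^ (n + 1)).subschemeι z ∈ Set.range (i.ker ^ (n + 1)).subschemeι := ⟨z, rfl⟩
  rw [Scheme.IdealSheafData.range_subschemeι, Scheme.IdealSheafData.support_pow_succ,
    Scheme.Hom.support_ker] at h
  change _ ∈ closure (Set.range i) at h
  rwa [i.isClosedEmbedding.isClosed_range.closure_eq] at h

lemma ker_subschemeι_ideal (n : ℕ) (W : Y.affineOpens) :
    (i.ker ^ n).subschemeι.ker.ideal W = i.ker.ideal W ^ n := by
  rw [Scheme.IdealSheafData.ker_subschemeι]; rfl

/-- Membership in a power of the ideal of a closed subscheme is local along the subscheme. -/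
lemma mem_ideal_pow_of_locally {n : ℕ} {W : Y.affineOpens} {f : Γ(Y, W.1)}
    (h : ∀ x, i x ∈ W.1 → ∃ (W' : Y.affineOpens) (hle : W'.1 ≤ W.1), i x ∈ W'.1 ∧
      res hle f ∈ i.ker.ideal W' ^ n) : f ∈ i.ker.ideal W ^ n := by
  rcases n with _ | n
  · simp
  rw [← ker_subschemeι_ideal]
  refine mem_ker_ideal_of_locally _ fun z hz => ?_
  obtain ⟨x, hx⟩ := exists_eq_subschemeι i n z
  obtain ⟨W', hle, hxW', hf⟩ := h x (hx ▸ hz)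
  exact ⟨W', hle, hx ▸ hxW', by rwa [ker_subschemeι_ideal]⟩

/-- Functions that agree modulo a power of the ideal of a closed subscheme can be glued along
the subscheme. -/
lemma exists_glue_ideal_pow (n : ℕ) {W : Y.affineOpens} {κ : Type} (U : κ → Y.affineOpens)
    (hU : ∀ k, (U k).1 ≤ W.1) (hcover : ∀ x, i x ∈ W.1 → ∃ k, i x ∈ (U k).1)
    (f : ∀ k, Γ(Y, (U k).1))
    (hf : ∀ k l x, i x ∈ (U k).1 → i x ∈ (U l).1 → ∃ (W' : Y.affineOpens) (hk : W'.1 ≤ (U k).1)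
      (hl : W'.1 ≤ (U l).1), i x ∈ W'.1 ∧ res hk (f k) - res hl (f l) ∈ i.ker.ideal W' ^ n) :
    ∃ g : Γ(Y, W.1), ∀ k, res (hU k) g - f k ∈ i.ker.ideal (U k) ^ n := by
  rcases n with _ | n
  · exact ⟨0, by simp⟩
  simp only [← ker_subschemeι_ideal]
  refine exists_glue_ker_ideal _ U hU (fun z hz => ?_) f fun k l z hk hl => ?_
  · obtain ⟨x, hx⟩ := exists_eq_subschemeι i n z
    obtain ⟨k, hk⟩ := hcover x (hx ▸ hz)
    exact ⟨k, hx ▸ hk⟩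
  · obtain ⟨x, hx⟩ := exists_eq_subschemeι i n z
    obtain ⟨W', hk', hl', hxW', h⟩ := hf k l x (hx ▸ hk) (hx ▸ hl)
    exact ⟨W', hk', hl', hx ▸ hxW', by rwa [ker_subschemeι_ideal]⟩

lemma exists_affineOpens_mem {W : Y.Opens} {x : Y} (hx : x ∈ W) :
    ∃ W' : Y.affineOpens, W'.1 ≤ W ∧ x ∈ W'.1 := by
  obtain ⟨W', hW', hle, hxW'⟩ := exists_affine_mem hx
  exact ⟨⟨W', hW'⟩, hle, hxW'⟩

end

/-! ### Sections of the completion -/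

section

variable {Y V : Scheme.{0}} [Y.Over SpecC] [V.Over SpecC] (i : V ⟶ Y) [i.IsOver SpecC]
  [IsClosedImmersion i] {W : V.Opens}

/-- The sections of the completion, as a type. -/
def Completion (W : V.Opens) : Type := completion i W

noncomputable instance : CommRing (Completion i W) := inferInstanceAs (CommRing (completion i W))

noncomputable instance : Algebra ℂ (Completion i W) :=
  inferInstanceAs (Algebra ℂ (completion i W))

variable {i} in
/-- The components of a section of the completion. -/
noncomputable def component (W' : {W' : Y.affineOpens // i ⁻¹ᵁ W'.1 ≤ W}) (n : ℕ) :
    Completion i W →ₐ[ℂ] Γ(Y, W'.1.1) ⧸ i.ker.ideal W'.1 ^ n where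
  toFun s := s.1 W' n
  map_one' := rfl
  map_mul' _ _ := rfl
  map_zero' := rfl
  map_add' _ _ := rfl
  commutes' _ := rfl

variable {i} in
lemma resMod_val (s : Completion i W) {W₁ W₂ : {W' : Y.affineOpens // i ⁻¹ᵁ W'.1 ≤ W}}
    (h : W₂.1.1 ≤ W₁.1.1) {m n : ℕ} (hmn : m ≤ n) :
    resMod i.ker h hmn (component W₁ n s) = component W₂ m s := s.2 W₁ W₂ h m n hmn

variable {i} in
lemma mk_res_eq (s : Completion i W) {W₁ W₂ : {W' : Y.affineOpens // i ⁻¹ᵁ W'.1 ≤ W}}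
    (h : W₂.1.1 ≤ W₁.1.1) {n : ℕ} {f : Γ(Y, W₁.1.1)}
    (hf : Ideal.Quotient.mk (i.ker.ideal W₁.1 ^ n) f = component W₁ n s) :
    Ideal.Quotient.mk (i.ker.ideal W₂.1 ^ n) (res h f) = component W₂ n s := by
  rw [← resMod_mk i.ker h le_rfl, hf]
  exact s.2 W₁ W₂ h n n le_rfl

variable {i} in
/-- A section of the completion is determined modulo a power of the ideal by its components on
affine opens that cover the subvariety. -/
lemma completion_component_eq {s t : Completion i W} {κ : Type}
    (Q : κ → {W' : Y.affineOpens // i ⁻¹ᵁ W'.1 ≤ W}) (hQ : ∀ x ∈ W, ∃ k, i x ∈ (Q k).1.1) {n : ℕ}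
    (h : ∀ k, component (Q k) n s = component (Q k) n t) (W' : {W' : Y.affineOpens // i ⁻¹ᵁ W'.1 ≤ W}) :
    component W' n s = component W' n t := by
  obtain ⟨f, hf⟩ := Ideal.Quotient.mk_surjective (component W' n s)
  obtain ⟨g, hg⟩ := Ideal.Quotient.mk_surjective (component W' n t)
  rw [← hf, ← hg, Ideal.Quotient.mk_eq_mk_iff_sub_mem]
  refine mem_ideal_pow_of_locally i fun x hx => ?_
  obtain ⟨k, hk⟩ := hQ x (W'.2 hx)
  obtain ⟨W'', hle, hxW''⟩ := exists_affineOpens_mem (W := W'.1.1 ⊓ (Q k).1.1) ⟨hx, hk⟩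
  refine ⟨W'', hle.trans inf_le_left, hxW'', ?_⟩
  rw [map_sub, ← Ideal.Quotient.mk_eq_mk_iff_sub_mem]
  let W₂ : {W' : Y.affineOpens // i ⁻¹ᵁ W'.1 ≤ W} :=
    ⟨W'', (i.preimage_mono (hle.trans inf_le_left)).trans W'.2⟩
  rw [mk_res_eq s (W₂ := W₂) (hle.trans inf_le_left) hf,
    mk_res_eq t (W₂ := W₂) (hle.trans inf_le_left) hg,
    ← resMod_val s (W₁ := Q k) (W₂ := W₂) (hle.trans inf_le_right) le_rfl,
    ← resMod_val t (W₁ := Q k) (W₂ := W₂) (hle.trans inf_le_right) le_rfl, h]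

/-- A compatible family of functions modulo the powers of the ideal on an affine open `Q` gives
a section of the completion over every open of `V ∩ Q`. -/
lemma exists_completion (Q : Y.affineOpens) (hW : W ≤ i ⁻¹ᵁ Q.1) (r : ℕ → Γ(Y, Q.1))
    (hr : ∀ m n, m ≤ n → r n - r m ∈ i.ker.ideal Q ^ m) :
    ∃ s : Completion i W, ∀ (W' : {W' : Y.affineOpens // i ⁻¹ᵁ W'.1 ≤ W}) (h : W'.1.1 ≤ Q.1) n,
      component W' n s = Ideal.Quotient.mk _ (res h (r n)) := by
  have hres : ∀ {W₁ W₂ : Y.affineOpens} (h : W₂.1 ≤ W₁.1) {n : ℕ} {f : Γ(Y, W₁.1)},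
      f ∈ i.ker.ideal W₁ ^ n → res h f ∈ i.ker.ideal W₂ ^ n := fun {W₁ W₂} h n f hf => by
    rw [← Ideal.Quotient.eq_zero_iff_mem] at hf ⊢
    rw [← resMod_mk i.ker h le_rfl, hf, map_zero]
  -- `W'` need not lie in `Q`, but its trace on `V` does. Hence the restrictions of `r n` to affine
  -- opens of `W' ∩ Q` cover `W'` along `V` and glue modulo the `n`-th power.
  have key : ∀ (W' : {W' : Y.affineOpens // i ⁻¹ᵁ W'.1 ≤ W}) (n : ℕ), ∃ g : Γ(Y, W'.1.1),
      ∀ U : {U : Y.affineOpens // U.1 ≤ W'.1.1 ⊓ Q.1},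
        res (U.2.trans inf_le_left) g - res (U.2.trans inf_le_right) (r n) ∈
          i.ker.ideal U.1 ^ n := by
    intro W' n
    refine exists_glue_ideal_pow i n (fun U : {U : Y.affineOpens // U.1 ≤ W'.1.1 ⊓ Q.1} => U.1)
      (fun U => U.2.trans inf_le_left) (fun x hx => ?_)
      (fun U => res (U.2.trans inf_le_right) (r n)) fun U U' x hx hx' => ?_
    · obtain ⟨U, hU, hxU⟩ := exists_affineOpens_mem (W := W'.1.1 ⊓ Q.1) (x := i x)
        ⟨hx, hW (W'.2 hx)⟩
      exact ⟨⟨U, hU⟩, hxU⟩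
    · obtain ⟨W'', hle, hxW''⟩ := exists_affineOpens_mem (W := U.1.1 ⊓ U'.1.1) ⟨hx, hx'⟩
      refine ⟨W'', hle.trans inf_le_left, hle.trans inf_le_right, hxW'', ?_⟩
      rw [res_res, res_res, sub_self]
      exact zero_mem _
  choose g hg using key
  refine ⟨⟨fun W' n => Ideal.Quotient.mk _ (g W' n), fun W₁ W₂ h m n hmn => ?_⟩,
    fun W' h n => ?_⟩
  · rw [resMod_mk, Ideal.Quotient.mk_eq_mk_iff_sub_mem]
    refine mem_ideal_pow_of_locally i fun x hx => ?_
    obtain ⟨U, hU, hxU⟩ := exists_affineOpens_mem (W := W₂.1.1 ⊓ Q.1) (x := i x)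
      ⟨hx, hW (W₂.2 hx)⟩
    refine ⟨U, hU.trans inf_le_left, hxU, ?_⟩
    have h1 := Ideal.pow_le_pow_right hmn
      (hg W₁ n ⟨U, le_inf (hU.trans (inf_le_left.trans h)) (hU.trans inf_le_right)⟩)
    have h2 := hg W₂ m ⟨U, hU⟩
    have h3 := hres (hU.trans inf_le_right) (hr m n hmn)
    rw [map_sub] at h3
    rw [map_sub, res_res]
    convert add_mem (sub_mem h1 h2) h3 using 1
    ring
  · refine (Ideal.Quotient.mk_eq_mk_iff_sub_mem _ _).2 ?_
    have := hg W' n ⟨W'.1, le_inf le_rfl h⟩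
    rwa [res_self] at this

end

end LagrangianNeighborhood

noncomputable section

namespace LagrangianNeighborhood

/-! ### Completions of Poisson algebras -/

/-- A ring `B` of compatible families of elements of the quotients of Poisson algebras `R w` by
the powers of ideals `I w`, together with the induced bracket. -/
structure PoissonCompletion (B : Type*) [CommRing B] [Algebra ℂ B] {ι : Type*} (R : ι → Type*)
    [∀ w, CommRing (R w)] [∀ w, Algebra ℂ (R w)] where
  I : ∀ w, Ideal (R w)
  comp : ∀ w n, B →ₐ[ℂ] R w ⧸ I w ^ n
  ext : ∀ s t, (∀ w n, comp w n s = comp w n t) → s = t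
  compat : ∀ w m n, m ≤ n → ∀ s f, Ideal.Quotient.mk (I w ^ n) f = comp w n s →
    Ideal.Quotient.mk (I w ^ m) f = comp w m s
  ham : ∀ w, R w → Derivation ℂ (R w) (R w)
  skew : ∀ w f g, ham w g f = -ham w f g
  jacobi : ∀ w f g h, ham w h (ham w g f) = ham w g (ham w h f) + ham w (ham w h g) f
  bracket : B → B → B
  comp_bracket : ∀ w n s t f g, Ideal.Quotient.mk (I w ^ (n + 1)) f = comp w (n + 1) s →
    Ideal.Quotient.mk (I w ^ (n + 1)) g = comp w (n + 1) t →
    comp w n (bracket s t) = Ideal.Quotient.mk (I w ^ n) (ham w g f)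

namespace PoissonCompletion

variable {B : Type*} [CommRing B] [Algebra ℂ B] {ι : Type*} {R : ι → Type*}
  [∀ w, CommRing (R w)] [∀ w, Algebra ℂ (R w)] (c : PoissonCompletion B R)

omit c in
lemma mk_smul {w : ι} (J : Ideal (R w)) (z : ℂ) (f : R w) :
    Ideal.Quotient.mk J (z • f) = z • Ideal.Quotient.mk J f := rfl

lemma exists_rep (w : ι) (n : ℕ) (s : B) : ∃ f, Ideal.Quotient.mk (c.I w ^ n) f = c.comp w n s :=
  Ideal.Quotient.mk_surjective _

lemma mem_pow {w : ι} {m n : ℕ} (hmn : m ≤ n) {s : B} (hs : c.comp w m s = 0) {f : R w}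
    (hf : Ideal.Quotient.mk (c.I w ^ n) f = c.comp w n s) : f ∈ c.I w ^ m := by
  rw [← Ideal.Quotient.eq_zero_iff_mem, c.compat w m n hmn s f hf, hs]

lemma comp_eq_of_le {w : ι} {m n : ℕ} (hmn : m ≤ n) {s t : B} (h : c.comp w n s = c.comp w n t) :
    c.comp w m s = c.comp w m t := by
  obtain ⟨f, hf⟩ := c.exists_rep w n s
  rw [← c.compat w m n hmn s f hf, ← c.compat w m n hmn t f (hf.trans h)]

/-- The filtration by the powers of the ideals. -/
def filtration (n : ℕ) : Ideal B where
  carrier := {s | ∀ w, c.comp w n s = 0}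
  add_mem' hs ht w := by rw [map_add, hs, ht, add_zero]
  zero_mem' w := map_zero _
  smul_mem' a s hs w := by rw [smul_eq_mul, map_mul, hs, mul_zero]

lemma bracket_add (s s' t : B) : c.bracket (s + s') t = c.bracket s t + c.bracket s' t :=
  c.ext _ _ fun w n => by
    obtain ⟨f, hf⟩ := c.exists_rep w (n + 1) s
    obtain ⟨f', hf'⟩ := c.exists_rep w (n + 1) s'
    obtain ⟨g, hg⟩ := c.exists_rep w (n + 1) t
    rw [c.comp_bracket w n (s + s') t (f + f') g (by rw [map_add, map_add, hf, hf']) hg,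
      map_add, map_add, map_add, c.comp_bracket w n s t f g hf hg,
      c.comp_bracket w n s' t f' g hf' hg]

lemma bracket_smul (z : ℂ) (s t : B) : c.bracket (z • s) t = z • c.bracket s t :=
  c.ext _ _ fun w n => by
    obtain ⟨f, hf⟩ := c.exists_rep w (n + 1) s
    obtain ⟨g, hg⟩ := c.exists_rep w (n + 1) t
    rw [c.comp_bracket w n (z • s) t (z • f) g (by rw [mk_smul, hf, map_smul]) hg,
      Derivation.map_smul, map_smul (c.comp w n), mk_smul, c.comp_bracket w n s t f g hf hg]

lemma bracket_mul (s s' t : B) :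
    c.bracket (s * s') t = s * c.bracket s' t + s' * c.bracket s t :=
  c.ext _ _ fun w n => by
    obtain ⟨f, hf⟩ := c.exists_rep w (n + 1) s
    obtain ⟨f', hf'⟩ := c.exists_rep w (n + 1) s'
    obtain ⟨g, hg⟩ := c.exists_rep w (n + 1) t
    have hs := c.compat w n (n + 1) (Nat.le_add_right _ _) s f hf
    have hs' := c.compat w n (n + 1) (Nat.le_add_right _ _) s' f' hf'
    rw [c.comp_bracket w n (s * s') t (f * f') g (by rw [map_mul, map_mul, hf, hf']) hg,
      Derivation.leibniz, map_add, map_add, map_mul (c.comp w n), map_mul (c.comp w n),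
      smul_eq_mul, smul_eq_mul, map_mul, map_mul, c.comp_bracket w n s t f g hf hg,
      c.comp_bracket w n s' t f' g hf' hg, hs, hs']

lemma bracket_skew (s t : B) : c.bracket s t = -c.bracket t s :=
  c.ext _ _ fun w n => by
    obtain ⟨f, hf⟩ := c.exists_rep w (n + 1) s
    obtain ⟨g, hg⟩ := c.exists_rep w (n + 1) t
    rw [map_neg, c.comp_bracket w n s t f g hf hg, c.comp_bracket w n t s g f hg hf, c.skew,
      map_neg]

lemma bracket_jacobi (s t r : B) : c.bracket (c.bracket s t) r =
    c.bracket (c.bracket s r) t + c.bracket s (c.bracket t r) :=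
  c.ext _ _ fun w n => by
    -- Each of two nested brackets costs one power of the ideal, so representatives are taken modulo
    -- the power `n + 2`.
    obtain ⟨f, hf⟩ := c.exists_rep w (n + 1 + 1) s
    obtain ⟨g, hg⟩ := c.exists_rep w (n + 1 + 1) t
    obtain ⟨h, hh⟩ := c.exists_rep w (n + 1 + 1) r
    have hst := c.comp_bracket w (n + 1) s t f g hf hg
    have hsr := c.comp_bracket w (n + 1) s r f h hf hh
    have htr := c.comp_bracket w (n + 1) t r g h hg hh
    have hs := c.compat w (n + 1) (n + 1 + 1) (Nat.le_add_right _ _) s f hf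
    have ht := c.compat w (n + 1) (n + 1 + 1) (Nat.le_add_right _ _) t g hg
    have hr := c.compat w (n + 1) (n + 1 + 1) (Nat.le_add_right _ _) r h hh
    rw [map_add, c.comp_bracket w n (c.bracket s t) r (c.ham w g f) h hst.symm hr,
      c.comp_bracket w n (c.bracket s r) t (c.ham w h f) g hsr.symm ht,
      c.comp_bracket w n s (c.bracket t r) f (c.ham w h g) hs htr.symm, c.jacobi, map_add]

lemma bracket_mem_filtration (t : B) (n : ℕ) {s : B} (hs : s ∈ c.filtration (n + 1)) :
    c.bracket s t ∈ c.filtration n := fun w => by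
  obtain ⟨g, hg⟩ := c.exists_rep w (n + 1) t
  rw [c.comp_bracket w n s t 0 g (by rw [map_zero, hs w]) hg, map_zero, map_zero]

/-- The Poisson structure of the completion. -/
def poisson : FilteredPoisson c.filtration where
  ham t := Derivation.mk'
    { toFun := fun s => c.bracket s t
      map_add' := fun s s' => c.bracket_add s s' t
      map_smul' := fun z s => c.bracket_smul z s t } fun s s' => c.bracket_mul s s' t
  skew s t := c.bracket_skew s t
  jacobi s t r := c.bracket_jacobi s t r
  filt t n _ hs := c.bracket_mem_filtration t n hs

lemma poisson_ham (s t : B) : c.poisson.ham t s = c.bracket s t := rfl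

/-- The index `q` determines the elements of the completion, and every compatible family of
elements of the quotients of `R q` occurs. -/
structure IsTerminal (q : ι) : Prop where
  comp_eq : ∀ s t n, c.comp q n s = c.comp q n t → ∀ w, c.comp w n s = c.comp w n t
  exists_eq : ∀ r : ℕ → R q, (∀ m n, m ≤ n → r n - r m ∈ c.I q ^ m) →
    ∃ s, ∀ n, c.comp q n s = Ideal.Quotient.mk _ (r n)

variable {c} {q : ι} (hq : c.IsTerminal q)

include hq

lemma IsTerminal.mem_filtration_iff {n : ℕ} {s : B} : s ∈ c.filtration n ↔ c.comp q n s = 0 :=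
  ⟨fun h => h q, fun h w => (hq.comp_eq s 0 n (by rw [h, map_zero]) w).trans (map_zero _)⟩

lemma IsTerminal.isCompleteFiltration : IsCompleteFiltration c.filtration where
  zero := by
    refine (Ideal.eq_top_iff_one _).2 fun w => ?_
    rw [map_one, ← map_one (Ideal.Quotient.mk _), Ideal.Quotient.eq_zero_iff_mem]
    simp
  anti m n hmn s hs w := by
    rw [c.comp_eq_of_le hmn (t := 0) (by rw [hs, map_zero]), map_zero]
  mul {m n s t} hs ht := by
    intro w
    obtain ⟨f, hf⟩ := c.exists_rep w (m + n) s
    obtain ⟨g, hg⟩ := c.exists_rep w (m + n) t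
    rw [map_mul, ← hf, ← hg, ← map_mul, Ideal.Quotient.eq_zero_iff_mem, pow_add]
    exact Ideal.mul_mem_mul (c.mem_pow (Nat.le_add_right _ _) (hs w) hf)
      (c.mem_pow (Nat.le_add_left _ _) (ht w) hg)
  sep {s} hs := c.ext _ _ fun w n => by rw [hs n w, map_zero]
  complete s hs := by
    have hsub : ∀ m n, m ≤ n → c.comp q m (s n) = c.comp q m (s m) := by
      intro m n hmn
      induction n, hmn using Nat.le_induction with
      | base => rfl
      | succ n hmn ih =>
        rw [← ih]
        exact c.comp_eq_of_le hmn (sub_eq_zero.1 (by rw [← map_sub]; exact hs n q))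
    -- Representatives of `s n` modulo the `n`-th power are compatible because the sequence is
    -- Cauchy.
    choose r hr using fun n => c.exists_rep q n (s n)
    obtain ⟨t, ht⟩ := hq.exists_eq r fun m n hmn => by
      rw [← Ideal.Quotient.mk_eq_mk_iff_sub_mem, hr m, ← hsub m n hmn]
      exact c.compat q m n hmn (s n) (r n) (hr n)
    refine ⟨t, fun n => hq.mem_filtration_iff.2 ?_⟩
    rw [map_sub, ht, hr, sub_self]

lemma IsTerminal.exists_const (f : R q) : ∃ s, ∀ n, c.comp q n s = Ideal.Quotient.mk _ f :=
  hq.exists_eq (fun _ => f) fun _ _ _ => by rw [sub_self]; exact zero_mem _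

lemma IsTerminal.ext_of_comp {s t : B} (h : ∀ n, c.comp q n s = c.comp q n t) : s = t :=
  c.ext s t fun w n => hq.comp_eq s t n (h n) w

lemma IsTerminal.exists_const_hom :
    ∃ φ : R q →+* B, ∀ f n, c.comp q n (φ f) = Ideal.Quotient.mk (c.I q ^ n) f := by
  choose φ hφ using hq.exists_const
  exact ⟨{
    toFun := φ
    map_one' := hq.ext_of_comp fun n => by rw [hφ, map_one, map_one]
    map_zero' := hq.ext_of_comp fun n => by rw [hφ, map_zero, map_zero]
    map_mul' := fun f g => hq.ext_of_comp fun n => by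
      rw [map_mul (c.comp q n), hφ, hφ, hφ, map_mul]
    map_add' := fun f g => hq.ext_of_comp fun n => by
      rw [map_add (c.comp q n), hφ, hφ, hφ, map_add] }, hφ⟩

/-- The map from `R q` to the completion. -/
def IsTerminal.const : R q →+* B := hq.exists_const_hom.choose

lemma IsTerminal.comp_const (f : R q) (n : ℕ) :
    c.comp q n (hq.const f) = Ideal.Quotient.mk (c.I q ^ n) f :=
  hq.exists_const_hom.choose_spec f n

/-- Modulo step `n + 1` an element of step `n` is the image of some `f ∈ I^n`, and the map `R q → B`
sends `I` into step one. -/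
lemma IsTerminal.filtration_le_pow (n : ℕ) :
    c.filtration n ≤ c.filtration 1 ^ n ⊔ c.filtration (n + 1) := by
  intro s hs
  obtain ⟨f, hf⟩ := c.exists_rep q (n + 1) s
  have h1 : (c.I q).map hq.const ≤ c.filtration 1 :=
    Ideal.map_le_iff_le_comap.2 fun g hg => by
      rw [Ideal.mem_comap, hq.mem_filtration_iff, hq.comp_const, Ideal.Quotient.eq_zero_iff_mem,
        pow_one]
      exact hg
  have h2 := Ideal.pow_right_mono h1 n (by
    rw [← Ideal.map_pow]; exact Ideal.mem_map_of_mem _ (c.mem_pow (Nat.le_add_right n 1) (hs q) hf))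
  rw [← add_sub_cancel (hq.const f) s]
  refine Submodule.add_mem_sup h2 (hq.mem_filtration_iff.2 ?_)
  rw [map_sub, hq.comp_const, hf, sub_self]

omit hq

section Evaluation

variable {A : Type*} [CommRing A] [Algebra ℂ A] (π : R q →ₐ[ℂ] A) (hπ : RingHom.ker π = c.I q)

/-- Evaluation along the subscheme with ideal `c.I q`. -/
def eval : B →ₐ[ℂ] A :=
  (Ideal.Quotient.liftₐ (c.I q ^ 1) π fun f hf => by rwa [pow_one, ← hπ] at hf).comp (c.comp q 1)

lemma eval_eq {s : B} {f : R q} (hf : Ideal.Quotient.mk (c.I q ^ 1) f = c.comp q 1 s) :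
    eval π hπ s = π f := by
  rw [eval, AlgHom.comp_apply, ← hf]
  rfl

include hq hπ

lemma IsTerminal.eval_const (f : R q) : eval π hπ (hq.const f) = π f :=
  eval_eq π hπ (hq.comp_const f 1).symm

lemma IsTerminal.eval_surjective (hsurj : Function.Surjective π) :
    Function.Surjective (eval π hπ) := fun a =>
  let ⟨f, hf⟩ := hsurj a
  ⟨hq.const f, by rw [hq.eval_const, hf]⟩

lemma IsTerminal.eval_eq_zero_iff (s : B) : eval π hπ s = 0 ↔ s ∈ c.filtration 1 := by
  obtain ⟨f, hf⟩ := c.exists_rep q 1 s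
  rw [eval_eq π hπ hf, hq.mem_filtration_iff, ← hf, Ideal.Quotient.eq_zero_iff_mem, pow_one, ← hπ]
  rfl

lemma IsTerminal.bracket_mem_one
    (h : ∀ f g, π f = 0 → π g = 0 → π (c.ham q g f) = 0) {s t : B} (hs : s ∈ c.filtration 1)
    (ht : t ∈ c.filtration 1) : c.bracket s t ∈ c.filtration 1 := by
  obtain ⟨f, hf⟩ := c.exists_rep q 2 s
  obtain ⟨g, hg⟩ := c.exists_rep q 2 t
  have key : ∀ {f : R q}, f ∈ c.I q ^ 1 ↔ π f = 0 := fun {f} => by rw [pow_one, ← hπ]; rfl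
  rw [hq.mem_filtration_iff, c.comp_bracket q 1 s t f g hf hg, Ideal.Quotient.eq_zero_iff_mem, key]
  exact h f g (key.1 (c.mem_pow one_le_two (hs q) hf)) (key.1 (c.mem_pow one_le_two (ht q) hg))

/-- Transfers the second-order vanishing criterion from `R q` to the completion. Representatives
modulo `I^2` suffice, as the bracket is needed only modulo `I`. -/
lemma IsTerminal.mem_two {κ : Type*} {x : κ → B}
    (h : ∀ f (x' : κ → R q), (∀ k, π (x' k) = eval π hπ (x k)) → π f = 0 →
      (∀ k, π (c.ham q (x' k) f) = 0) → f ∈ c.I q ^ 2)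
    {s : B} (hs : s ∈ c.filtration 1) (hsx : ∀ k, c.bracket s (x k) ∈ c.filtration 1) :
    s ∈ c.filtration 2 := by
  obtain ⟨f, hf⟩ := c.exists_rep q 2 s
  choose x' hx' using fun k => c.exists_rep q 2 (x k)
  have key : ∀ {f : R q}, f ∈ c.I q ^ 1 ↔ π f = 0 := fun {f} => by rw [pow_one, ← hπ]; rfl
  rw [hq.mem_filtration_iff, ← hf, Ideal.Quotient.eq_zero_iff_mem]
  refine h f x' (fun k => (eval_eq π hπ (c.compat q 1 2 one_le_two _ _ (hx' k))).symm)
    (key.1 (c.mem_pow one_le_two (hs q) hf)) fun k => ?_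
  rw [← key, ← Ideal.Quotient.eq_zero_iff_mem, ← c.comp_bracket q 1 s (x k) f (x' k) hf (hx' k)]
  exact hsx k q

end Evaluation

end PoissonCompletion

end LagrangianNeighborhood

end

noncomputable section

namespace LagrangianNeighborhood

/-! ### Charts of the completion along a Lagrangian subvariety -/

section

variable {Y V : Scheme.{0}} [Y.Over SpecC] [V.Over SpecC] (i : V ⟶ Y) [i.IsOver SpecC]
  [IsClosedImmersion i] (W : V.Opens) (ω : SymplecticForm Y)

/-- The Poisson completion of the structure sheaf. -/
def poissonCompletion : PoissonCompletion (Completion i W)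
    (fun W' : {W' : Y.affineOpens // i ⁻¹ᵁ W'.1 ≤ W} => Γ(Y, W'.1.1)) where
  I W' := i.ker.ideal W'.1
  comp := component
  ext s t h := Subtype.ext (funext fun W' => funext fun n => h W' n)
  compat W' m n hmn s f hf := by
    rw [← resMod_val s (W₁ := W') (W₂ := W') le_rfl hmn, ← hf, resMod_mk, res_self]
  ham W' g := (ω.hamiltonian g).der W'.1.1 le_rfl
  skew W' f g := by rw [← ω.bracket_apply, ω.bracket_skew, ω.bracket_apply]
  jacobi W' f g h := by simpa only [← ω.bracket_apply] using ω.jacobi f g h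
  bracket := completionBracket ω i
  comp_bracket W' n s t f g hf hg := by
    rw [← ω.bracket_apply]
    exact ω.bracket_congr _ ((Quotient.out_eq (component W' (n + 1) s)).trans hf.symm)
      ((Quotient.out_eq (component W' (n + 1) t)).trans hg.symm)

/-- Restriction of sections of the completion. -/
def Completion.res {W W' : V.Opens} (h : W' ≤ W) : Completion i W →ₐ[ℂ] Completion i W' :=
  (completionRes i h : completion i W →ₐ[ℂ] completion i W')

variable {i W} in
lemma component_completionRes {W₀ : V.Opens} (h : W₀ ≤ W) (s : Completion i W)
    (W' : {W' : Y.affineOpens // i ⁻¹ᵁ W'.1 ≤ W₀}) (n : ℕ) :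
    component W' n (Completion.res i h s) = component ⟨W'.1, W'.2.trans h⟩ n s := rfl

lemma poissonCompletion_comp (W' : {W' : Y.affineOpens // i ⁻¹ᵁ W'.1 ≤ W}) (n : ℕ)
    (s : Completion i W) : (poissonCompletion i W ω).comp W' n s = component W' n s := rfl

lemma exists_rep {W} (W' : {W' : Y.affineOpens // i ⁻¹ᵁ W'.1 ≤ W}) (n : ℕ) (s : Completion i W) :
    ∃ f, Ideal.Quotient.mk (i.ker.ideal W'.1 ^ n) f = component W' n s :=
  Ideal.Quotient.mk_surjective _

variable (Q : Y.affineOpens)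

/-- An affine open, as an index of components of the completion over its trace. -/
abbrev trace : {W' : Y.affineOpens // i ⁻¹ᵁ W'.1 ≤ i ⁻¹ᵁ Q.1} := ⟨Q, le_rfl⟩

/-- Every other index has its trace inside `V ∩ Q`, so along `V` its components are determined by
those on `Q`. -/
lemma isTerminal_trace : (poissonCompletion i (i ⁻¹ᵁ Q.1) ω).IsTerminal (trace i Q) where
  comp_eq s t n h W' :=
    completion_component_eq (fun _ : Unit => trace i Q) (fun _ hx => ⟨(), hx⟩) (fun _ => h) W'
  exists_eq r hr := by
    have h := exists_completion i Q le_rfl r hr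
    exact h.imp fun s hs n => by
      rw [poissonCompletion_comp, hs (trace i Q) le_rfl n, res_self]
      rfl

/-- Restriction of sections of the completion to the subvariety. -/
def evalV : Completion i (i ⁻¹ᵁ Q.1) →ₐ[ℂ] Γ(V, i ⁻¹ᵁ Q.1) :=
  (PoissonCompletion.eval (c := poissonCompletion i (i ⁻¹ᵁ Q.1) ω) (q := trace i Q)
    (pull i Q.1) (ker_pull i Q.2) :)

variable {i Q} in
lemma evalV_eq {s : Completion i (i ⁻¹ᵁ Q.1)} {f : Γ(Y, Q.1)}
    (hf : Ideal.Quotient.mk (i.ker.ideal Q ^ 1) f = component (trace i Q) 1 s) :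
    evalV i ω Q s = pull i Q.1 f :=
  PoissonCompletion.eval_eq (c := poissonCompletion i (i ⁻¹ᵁ Q.1) ω) (q := trace i Q)
    (pull i Q.1) (ker_pull i Q.2) hf

variable {i W} in
lemma pull_res_eq (s : Completion i W) {W₁ W₂ : {W' : Y.affineOpens // i ⁻¹ᵁ W'.1 ≤ W}}
    {f : Γ(Y, W₁.1.1)} {g : Γ(Y, W₂.1.1)}
    (hf : Ideal.Quotient.mk (i.ker.ideal W₁.1 ^ 1) f = component W₁ 1 s)
    (hg : Ideal.Quotient.mk (i.ker.ideal W₂.1 ^ 1) g = component W₂ 1 s) {W' : Y.affineOpens}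
    (h1 : W'.1 ≤ W₁.1.1) (h2 : W'.1 ≤ W₂.1.1) :
    pull i W'.1 (res h1 f) = pull i W'.1 (res h2 g) := by
  have h3 := mk_res_eq s (W₂ := ⟨W', (i.preimage_mono h1).trans W₁.2⟩) h1 hf
  have h4 := mk_res_eq s (W₂ := ⟨W', (i.preimage_mono h1).trans W₁.2⟩) h2 hg
  have h5 := (Ideal.Quotient.mk_eq_mk_iff_sub_mem _ _).1 (h3.trans h4.symm)
  rw [pow_one, ← ker_pull i W'.2, RingHom.mem_ker, map_sub, sub_eq_zero] at h5
  exact h5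

/-- Restriction to the subvariety commutes with restriction to open subsets. -/
lemma evalV_completionRes {Q Q' : Y.affineOpens} (h : i ⁻¹ᵁ Q'.1 ≤ i ⁻¹ᵁ Q.1)
    (s : Completion i (i ⁻¹ᵁ Q.1)) :
    evalV i ω Q' (Completion.res i h s) = res h (evalV i ω Q s) := by
  have hf' := exists_rep i (trace i Q) 1 s
  have hg' := exists_rep i ⟨Q', h⟩ 1 s
  rcases hf' with ⟨f, hf⟩
  rcases hg' with ⟨g, hg⟩
  have hg' := hg
  rw [← component_completionRes h s (trace i Q')] at hg'
  rw [evalV_eq ω hf, evalV_eq ω hg']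
  refine presheaf_section_ext fun x hx => ?_
  obtain ⟨W', hle, hxW'⟩ := exists_affineOpens_mem (W := Q'.1 ⊓ Q.1) (x := i x) ⟨hx, h hx⟩
  have h1 : W'.1 ≤ Q'.1 := hle.trans inf_le_left
  have h2 : W'.1 ≤ Q.1 := hle.trans inf_le_right
  refine ⟨i ⁻¹ᵁ W'.1, i.preimage_mono h1, hxW', ?_⟩
  change res (i.preimage_mono h1) (pull i Q'.1 g) =
    res (i.preimage_mono h1) (res h (pull i Q.1 f))
  rw [res_res, res_pull i h1, res_pull i h2]
  exact pull_res_eq s hg hf h1 h2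

end

section Chart

variable {Y V : Scheme.{0}} [Y.Over SpecC] [V.Over SpecC] (i : V ⟶ Y) [i.IsOver SpecC]
  [IsClosedImmersion i] (d : ℕ) (ω : SymplecticForm Y)

/-- Darboux coordinates of the completion over an affine open of the subvariety, together with the
induced coordinates and vector fields on the subvariety. -/
structure DarbouxFrame (U : V.Opens) where
  isAffineOpen : IsAffineOpen U
  u : Fin d → Γ(V, U)
  isCoordinates : IsCoordinates u
  partial' : Fin d → VectorField V U
  partial_u : ∀ j k, (partial' j).der U le_rfl (u k) = if j = k then 1 else 0
  x : Fin d → Completion i U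
  y : Fin d → Completion i U
  evalV_x : ∀ (Q : Y.affineOpens) (h : i ⁻¹ᵁ Q.1 ≤ U) (j : Fin d),
    evalV i ω Q (Completion.res i h (x j)) = res h (u j)
  evalV_y : ∀ (Q : Y.affineOpens) (h : i ⁻¹ᵁ Q.1 ≤ U) (j : Fin d),
    evalV i ω Q (Completion.res i h (y j)) = 0
  bracket_x_x : ∀ j k, (poissonCompletion i U ω).bracket (x k) (x j) = 0
  bracket_y_x : ∀ j k, (poissonCompletion i U ω).bracket (y j) (x k) = if j = k then 1 else 0

variable {i d ω}

namespace DarbouxFrame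

variable {U : V.Opens} (D : DarbouxFrame i d ω U)

lemma isCoordinates_res {W : V.Opens} (h : W ≤ U) (hW : IsAffineOpen W) :
    IsCoordinates fun j => res h (D.u j) := by
  let _ : Algebra Γ(V, U) Γ(V, W) := (res h).toRingHom.toAlgebra
  have : IsScalarTower ℂ Γ(V, U) Γ(V, W) :=
    .of_algebraMap_eq fun z => ((res h).commutes z).symm
  have : Algebra.Etale Γ(V, U) Γ(V, W) := etale_res D.isAffineOpen hW h
  exact D.isCoordinates.of_formallyEtale (S := Γ(V, W))

lemma lie_u {W : V.Opens} (h : W ≤ U) (j k : Fin d) :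
    ⁅(D.partial' j).restrict h, res h (D.u k)⁆ = if j = k then (1 : Γ(V, W)) else 0 := by
  have := congrArg (res h) (D.partial_u j k)
  rw [VectorField.res_der] at this
  refine this.trans ?_
  split_ifs
  · exact map_one _
  · exact map_zero _

/-- A vector field on `W` is determined by its values on functions from the affine `U`, and a
derivation of these by its values on `u`. -/
lemma sum_partial {W : V.Opens} (h : W ≤ U) (v : VectorField V W) :
    ∑ j, ⁅v, res h (D.u j)⁆ • (D.partial' j).restrict h = v := by
  refine VectorField.ext_of_affine D.isAffineOpen h fun f => ?_
  let _ : Algebra Γ(V, U) Γ(V, W) := (res h).toRingHom.toAlgebra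
  have : IsScalarTower ℂ Γ(V, U) Γ(V, W) :=
    .of_algebraMap_eq fun z => ((res h).commutes z).symm
  have hsum : ∀ g : Γ(V, W),
      (∑ j, ⁅v, res h (D.u j)⁆ • (D.partial' j).restrict h).der W le_rfl g =
        ∑ j, ⁅v, res h (D.u j)⁆ * ((D.partial' j).restrict h).der W le_rfl g := fun g => by
    refine (map_sum (AddMonoidHom.mk' (fun F : VectorField V W => F.der W le_rfl g)
      fun _ _ => VectorField.add_der _ _ _ _) _ _).trans (Finset.sum_congr rfl fun j _ => ?_)
    change (⁅v, res h (D.u j)⁆ • (D.partial' j).restrict h).der W le_rfl g = _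
    rw [VectorField.smul_der, res_self]
  refine D.isCoordinates.derivation_ext
    (δ := ((∑ j, ⁅v, res h (D.u j)⁆ • (D.partial' j).restrict h).der W le_rfl).compAlgebraMap
      Γ(V, U)) (δ' := (v.der W le_rfl).compAlgebraMap Γ(V, U)) (fun k => ?_) f
  change (∑ j, ⁅v, res h (D.u j)⁆ • (D.partial' j).restrict h).der W le_rfl (res h (D.u k)) =
    ⁅v, res h (D.u k)⁆
  rw [hsum, Finset.sum_eq_single k, ← VectorField.lie_def, D.lie_u, if_pos rfl, mul_one]
  · intro j _ hj
    rw [← VectorField.lie_def, D.lie_u, if_neg hj, mul_zero]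
  · simp

lemma bracket_res {W : V.Opens} (h : W ≤ U) (s t : Completion i U) :
    (poissonCompletion i W ω).bracket (Completion.res i h s) (Completion.res i h t) =
      Completion.res i h ((poissonCompletion i U ω).bracket s t) := rfl

variable [SmoothOfRelativeDimension (2 * d) (Y ↘ SpecC)]
  [SmoothOfRelativeDimension d (V ↘ SpecC)] (hV : ω.toTwoForm.RestrictsToZero i)

/-- The charts of the completion given by Darboux coordinates. -/
def chart (Q : Y.affineOpens) (h : i ⁻¹ᵁ Q.1 ≤ U) :
    FormalChart Γ(V, i ⁻¹ᵁ Q.1) (VectorField V (i ⁻¹ᵁ Q.1)) (Completion i (i ⁻¹ᵁ Q.1)) d where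
  F := (poissonCompletion i (i ⁻¹ᵁ Q.1) ω).filtration
  complete := (isTerminal_trace i ω Q).isCompleteFiltration
  P := (poissonCompletion i (i ⁻¹ᵁ Q.1) ω).poisson
  ε := evalV i ω Q
  ε_surjective := (isTerminal_trace i ω Q).eval_surjective (pull i Q.1) (ker_pull i Q.2)
    (pull_surjective i Q.2)
  ε_eq_zero := (isTerminal_trace i ω Q).eval_eq_zero_iff (pull i Q.1) (ker_pull i Q.2)
  anchor v := v.der _ le_rfl
  anchor_apply _ _ := rfl
  u j := res h (D.u j)
  partial' j := (D.partial' j).restrict h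
  lie_u := D.lie_u h
  sum_partial := D.sum_partial h
  derivation_eq_zero δ hδ := (D.isCoordinates_res h (Q.2.preimage i)).derivation_ext (δ' := 0) hδ
  x j := Completion.res i h (D.x j)
  y j := Completion.res i h (D.y j)
  ε_x := D.evalV_x Q h
  y_mem j := ((isTerminal_trace i ω Q).eval_eq_zero_iff (pull i Q.1) (ker_pull i Q.2) _).1
    (D.evalV_y Q h j)
  ham_x_x j k := by
    rw [PoissonCompletion.poisson_ham, bracket_res, D.bracket_x_x, map_zero]
  ham_x_y j k := by
    rw [PoissonCompletion.poisson_ham, bracket_res, D.bracket_y_x]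
    split_ifs
    · exact map_one _
    · exact map_zero _
  coisotropic s hs t ht := (isTerminal_trace i ω Q).bracket_mem_one (pull i Q.1) (ker_pull i Q.2)
    (fun f g hf hg => by
      have := pull_bracket_eq_zero i d ω hV hg hf
      rwa [ω.bracket_apply] at this) hs ht
  mem_two s hs hsx := (isTerminal_trace i ω Q).mem_two (pull i Q.1) (ker_pull i Q.2)
    (x := fun j => Completion.res i h (D.x j)) (fun f x' hx' hf hfx => by
      have := mem_ker_sq_of_bracket_eq_zero i d ω hV Q.2
        (D.isCoordinates_res h (Q.2.preimage i)) (x := x') (fun j => (hx' j).trans (D.evalV_x Q h j))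
        hf (fun j => by rw [ω.bracket_apply]; exact hfx j)
      rwa [ker_pull i Q.2] at this) hs hsx
  le_pow := (isTerminal_trace i ω Q).filtration_le_pow

/-- Both charts use restrictions of the same `x`, `y` and `u` on `U`, so naturality applies. Only
the traces have to be nested, not `Q'` and `Q`. -/
lemma limitEquiv_res {Q Q' : Y.affineOpens} (h : i ⁻¹ᵁ Q.1 ≤ U) (h' : i ⁻¹ᵁ Q'.1 ≤ i ⁻¹ᵁ Q.1)
    (G : CompletedSym Γ(V, i ⁻¹ᵁ Q.1) (VectorField V (i ⁻¹ᵁ Q.1))) :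
    Completion.res i h' ((D.chart hV Q h).limitEquiv G) =
      (D.chart hV Q' (h'.trans h)).limitEquiv (symRes h' G) :=
  FormalChart.limitEquiv_map (D.chart hV Q h) (D.chart hV Q' (h'.trans h)) (res h')
    (VectorField.restrictₛₗ h') (Completion.res i h') (fun v a => v.res_der le_rfl h' a)
    (fun j => res_res h h' (D.u j)) (fun s => evalV_completionRes i ω h' s)
    (fun _ _ hs W' => hs ⟨W'.1, W'.2.trans h'⟩) (fun _ _ => rfl) (fun _ => rfl) (fun _ => rfl) G

end DarbouxFrame

end Chart

end LagrangianNeighborhood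

end

noncomputable section

namespace LagrangianNeighborhood

variable {Y V : Scheme.{0}} [Y.Over SpecC] [V.Over SpecC]

/-! ### Existence of Darboux coordinates -/

section Existence

variable (i : V ⟶ Y) [i.IsOver SpecC] [IsClosedImmersion i] (d : ℕ)
  [SmoothOfRelativeDimension (2 * d) (Y ↘ SpecC)] [SmoothOfRelativeDimension d (V ↘ SpecC)]
  (ω : SymplecticForm Y) (hV : ω.toTwoForm.RestrictsToZero i)

include hV in
/-- Every point of a Lagrangian subvariety has a neighbourhood with formal Darboux coordinates. -/
lemma exists_darbouxFrame (p : V) :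
    ∃ U : V.Opens, p ∈ U ∧ Nonempty (DarbouxFrame i d ω U) := by
  have : Smooth (Y ↘ SpecC) := SmoothOfRelativeDimension.smooth (2 * d) _
  have : Smooth (V ↘ SpecC) := SmoothOfRelativeDimension.smooth d _
  obtain ⟨Q', w, u, hQ', -, hp, -, hu⟩ :=
    exists_adapted_neighbourhood i (2 * d) d (W := ⊤) (p := p) trivial
  let Q : Y.affineOpens := ⟨Q', hQ'⟩
  obtain ⟨δ, hδ⟩ := hu.exists_partial
  choose v hv using fun j => VectorField.exists_of_derivation (hQ'.preimage i) (δ j)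
  choose f hf hfv using fun j => exists_hamiltonian_eq i ω hV hQ' (v j)
  have hq := isTerminal_trace i ω Q
  -- The sign in `-f j` cancels the one in `exists_hamiltonian_eq`: the bracket of `-f j` with any
  -- lift of `u k` restricts to `∂_j u_k` on `V`.
  have hηu : ∀ j k s, evalV i ω Q s = u k → evalV i ω Q
      ((poissonCompletion i (i ⁻¹ᵁ Q.1) ω).poisson.ham s (hq.const (-f j))) =
        if j = k then 1 else 0 := by
    intro j k s hs
    have hg := (poissonCompletion i (i ⁻¹ᵁ Q.1) ω).exists_rep (trace i Q) 2 s
    rcases hg with ⟨g, hg⟩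
    have h1 := (poissonCompletion i (i ⁻¹ᵁ Q.1) ω).comp_bracket (trace i Q) 1
      (hq.const (-f j)) s (-f j) g (hq.comp_const _ _).symm hg
    rw [PoissonCompletion.poisson_ham]
    have h2 : evalV i ω Q ((poissonCompletion i (i ⁻¹ᵁ Q.1) ω).bracket (hq.const (-f j)) s) =
        pull i Q.1 ((ω.hamiltonian g).der Q.1 le_rfl (-f j)) := evalV_eq ω h1.symm
    have h3 : evalV i ω Q s = pull i Q.1 g := evalV_eq ω
      ((poissonCompletion i (i ⁻¹ᵁ Q.1) ω).compat (trace i Q) 1 2 one_le_two s g hg)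
    have h4 := hfv j g
    rw [ω.bracket_apply] at h4
    rw [h2, map_neg, map_neg, h4, neg_neg, hv, ← h3, hs, hδ]
  obtain ⟨x, y, hx, hy, hxx, hxy⟩ :=
    (poissonCompletion i (i ⁻¹ᵁ Q.1) ω).poisson.exists_darboux hq.isCompleteFiltration
      (evalV i ω Q) (hq.eval_surjective (pull i Q.1) (ker_pull i Q.2) (pull_surjective i Q.2))
      (hq.eval_eq_zero_iff (pull i Q.1) (ker_pull i Q.2)) u (fun j => hq.const (-f j))
      (fun j => (hq.eval_eq_zero_iff (pull i Q.1) (ker_pull i Q.2) _).1 (by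
        exact (hq.eval_const (pull i Q.1) (ker_pull i Q.2) (-f j)).trans
          (by rw [map_neg]; exact (congrArg Neg.neg (hf j)).trans neg_zero))) hηu
  exact ⟨i ⁻¹ᵁ Q.1, hp, ⟨{
    isAffineOpen := Q.2.preimage i
    u := u
    isCoordinates := hu
    partial' := v
    partial_u := fun j k => by rw [hv, hδ]
    x := x
    y := y
    evalV_x := fun Q₁ h j => by rw [evalV_completionRes, hx]
    evalV_y := fun Q₁ h j => by
      have hyj : evalV i ω Q (y j) = 0 :=
        (hq.eval_eq_zero_iff (pull i Q.1) (ker_pull i Q.2) _).2 (hy j)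
      rw [evalV_completionRes, hyj, map_zero]
    bracket_x_x := hxx
    bracket_y_x := hxy }⟩⟩

/-- `V` carries the induced topology, so the traces of affine opens of `Y` form a basis of it. -/
lemma exists_trace_mem {W : V.Opens} {x : V} (hx : x ∈ W) :
    ∃ Q : Y.affineOpens, i ⁻¹ᵁ Q.1 ≤ W ∧ i x ∈ Q.1 := by
  obtain ⟨O, hO, hOW⟩ := i.isClosedEmbedding.isInducing.isOpen_iff.1 W.2
  have hmem : ∀ z : V, i z ∈ O ↔ z ∈ W := fun z => by
    change z ∈ (i : V → Y) ⁻¹' O ↔ z ∈ (W : Set V)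
    rw [hOW]
    rfl
  obtain ⟨Q, hle, hxQ⟩ := exists_affineOpens_mem (W := ⟨O, hO⟩) (x := i x) ((hmem x).2 hx)
  exact ⟨Q, fun z hz => (hmem z).1 (hle hz), hxQ⟩

end Existence

/-! ### The isomorphism -/

variable {i : V ⟶ Y} [i.IsOver SpecC] [IsClosedImmersion i] {d : ℕ} {ω : SymplecticForm Y}

namespace DarbouxFrame

variable {U W W' : V.Opens} (D : DarbouxFrame i d ω U)

/-- The coordinate vector fields form a basis of the vector fields. -/
def basis (h : W ≤ U) : Module.Basis (Fin d) Γ(V, W) (VectorField V W) :=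
  .ofEquivFun
    { toFun := fun v j => ⁅v, res h (D.u j)⁆
      map_add' := fun v v' => funext fun j => add_lie _ _ _
      map_smul' := fun a v => funext fun j => LieRinehartRing.lie_smul_eq_mul a _ v
      invFun := fun c => ∑ j, c j • (D.partial' j).restrict h
      left_inv := D.sum_partial h
      right_inv := fun c => funext fun k => by
        change ⁅∑ j, c j • (D.partial' j).restrict h, res h (D.u k)⁆ = c k
        rw [sum_lie, Finset.sum_eq_single k, LieRinehartRing.lie_smul_eq_mul, D.lie_u, if_pos rfl,
          mul_one]
        · intro j _ hj
          rw [LieRinehartRing.lie_smul_eq_mul, D.lie_u, if_neg hj, mul_zero]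
        · simp }

lemma basis_apply (h : W ≤ U) (j : Fin d) : D.basis h j = (D.partial' j).restrict h := by
  rw [basis, Module.Basis.coe_ofEquivFun]
  change ∑ k, (Pi.single j (1 : Γ(V, W)) : Fin d → Γ(V, W)) k • (D.partial' k).restrict h = _
  rw [Finset.sum_eq_single j]
  · rw [Pi.single_eq_same, one_smul]
  · intro k _ hk
    rw [Pi.single_eq_of_ne hk, zero_smul]
  · simp

lemma monomialCoeff_symRes (h : W ≤ U) (h' : W' ≤ W) (α : Fin d →₀ ℕ)
    (G : CompletedSym Γ(V, W) (VectorField V W)) :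
    CompletedSym.monomialCoeff (D.basis (h'.trans h)) α (symRes h' G) =
      res h' (CompletedSym.monomialCoeff (D.basis h) α G) :=
  CompletedSym.monomialCoeff_map (D.basis h) (D.basis (h'.trans h)) (res h').toRingHom
    (VectorField.restrictₛₗ h') (fun j => by rw [basis_apply, basis_apply]; rfl) α G

include D in
lemma completedSym_ext (h : W ≤ U) {G H : CompletedSym Γ(V, W) (VectorField V W)}
    (hGH : ∀ (Q : Y.affineOpens) (hQ : i ⁻¹ᵁ Q.1 ≤ W), symRes hQ G = symRes hQ H) : G = H := by
  refine CompletedSym.ext_monomialCoeff (D.basis h) fun α => presheaf_section_ext fun x hx => ?_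
  obtain ⟨Q, hQ, hxQ⟩ := exists_trace_mem i hx
  refine ⟨i ⁻¹ᵁ Q.1, hQ, hxQ, ?_⟩
  change res hQ _ = res hQ _
  rw [← monomialCoeff_symRes D h hQ, ← monomialCoeff_symRes D h hQ, hGH]

include D in
lemma symRes_symRes (h : W ≤ U) {W₁ W₂ : V.Opens} (h₁ : W₁ ≤ W) (h₂ : W₂ ≤ W₁)
    (G : CompletedSym Γ(V, W) (VectorField V W)) :
    symRes h₂ (symRes h₁ G) = symRes (h₂.trans h₁) G := by
  refine CompletedSym.ext_monomialCoeff (D.basis (h₂.trans (h₁.trans h))) fun α => ?_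
  rw [monomialCoeff_symRes D (h₁.trans h) h₂, monomialCoeff_symRes D h h₁, res_res]
  exact (monomialCoeff_symRes D h (h₂.trans h₁) α G).symm

include D in
-- In the frame `∂_j` an element of `∏ Sym^n` is an arbitrary family of functions, one for each
-- monomial, and these coefficients commute with restriction; each is glued in the structure sheaf
-- of `V`.
lemma exists_completedSym (h : W ≤ U)
    (G : ∀ Q : {Q : Y.affineOpens // i ⁻¹ᵁ Q.1 ≤ W},
      CompletedSym Γ(V, i ⁻¹ᵁ Q.1.1) (VectorField V (i ⁻¹ᵁ Q.1.1)))
    (hG : ∀ (Q Q' : {Q : Y.affineOpens // i ⁻¹ᵁ Q.1 ≤ W}) (h' : i ⁻¹ᵁ Q'.1.1 ≤ i ⁻¹ᵁ Q.1.1),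
      symRes h' (G Q) = G Q') :
    ∃ H : CompletedSym Γ(V, W) (VectorField V W), ∀ Q, symRes Q.2 H = G Q := by
  have hglue : ∀ α, ∃ a : Γ(V, W), ∀ Q : {Q : Y.affineOpens // i ⁻¹ᵁ Q.1 ≤ W}, res Q.2 a =
      CompletedSym.monomialCoeff (D.basis (Q.2.trans h)) α (G Q) := by
    intro α
    refine exists_section_glue (fun Q : {Q : Y.affineOpens // i ⁻¹ᵁ Q.1 ≤ W} => i ⁻¹ᵁ Q.1.1)
      (fun Q => Q.2) (fun x hx => ?_)
      (fun Q => CompletedSym.monomialCoeff (D.basis (Q.2.trans h)) α (G Q)) fun Q Q' x hx hx' => ?_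
    · obtain ⟨Q, hQ, hxQ⟩ := exists_trace_mem i hx
      exact ⟨⟨Q, hQ⟩, hxQ⟩
    · obtain ⟨Q₂, hQ₂, hxQ₂⟩ := exists_trace_mem i (W := i ⁻¹ᵁ Q.1.1 ⊓ i ⁻¹ᵁ Q'.1.1) ⟨hx, hx'⟩
      have h1 := hQ₂.trans inf_le_left
      have h2 := hQ₂.trans inf_le_right
      refine ⟨i ⁻¹ᵁ Q₂.1, h1, h2, hxQ₂, ?_⟩
      rw [← monomialCoeff_symRes D (Q.2.trans h) h1, ← monomialCoeff_symRes D (Q'.2.trans h) h2,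
        hG Q ⟨Q₂, h1.trans Q.2⟩, hG Q' ⟨Q₂, h1.trans Q.2⟩]
  choose a ha using hglue
  obtain ⟨H, hH⟩ := CompletedSym.exists_monomialCoeff_eq (D.basis h) a
  refine ⟨H, fun Q => CompletedSym.ext_monomialCoeff (D.basis (Q.2.trans h)) fun α => ?_⟩
  rw [monomialCoeff_symRes D h Q.2, hH, ha]

variable (i) in
/-- The trace of an affine open. -/
abbrev affineTrace (Q : Y.affineOpens) : V.affineOpens := ⟨i ⁻¹ᵁ Q.1, Q.2.preimage i⟩

/-- The value of a section of `∏_n Sym^n T_V` on the trace of an affine open. -/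
abbrev traceVal (s : symSections V W) (Q : Y.affineOpens) (h : i ⁻¹ᵁ Q.1 ≤ W) :
    CompletedSym Γ(V, i ⁻¹ᵁ Q.1) (VectorField V (i ⁻¹ᵁ Q.1)) :=
  s.1 ⟨affineTrace i Q, h⟩

lemma symRes_val (s : symSections V W) {Q Q' : V.affineOpens} (hQ : Q.1 ≤ W) (h : Q'.1 ≤ Q.1) :
    symRes h (s.1 ⟨Q, hQ⟩) = s.1 ⟨Q', h.trans hQ⟩ :=
  s.2 ⟨Q, hQ⟩ ⟨Q', h.trans hQ⟩ h

lemma symRes_traceVal (s : symSections V W) {Q Q' : Y.affineOpens} (hQ : i ⁻¹ᵁ Q.1 ≤ W)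
    (h : i ⁻¹ᵁ Q'.1 ≤ i ⁻¹ᵁ Q.1) :
    symRes h (traceVal s Q hQ) = traceVal s Q' (h.trans hQ) :=
  symRes_val s (Q := affineTrace i Q) (Q' := affineTrace i Q') hQ h

variable [SmoothOfRelativeDimension (2 * d) (Y ↘ SpecC)]
  [SmoothOfRelativeDimension d (V ↘ SpecC)] (hV : ω.toTwoForm.RestrictsToZero i)

lemma component_limitEquiv {Q Q' : Y.affineOpens} (h : i ⁻¹ᵁ Q.1 ≤ U)
    (h' : i ⁻¹ᵁ Q'.1 ≤ i ⁻¹ᵁ Q.1) (n : ℕ)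
    (G : CompletedSym Γ(V, i ⁻¹ᵁ Q.1) (VectorField V (i ⁻¹ᵁ Q.1))) :
    component ⟨Q', h'⟩ n ((D.chart hV Q h).limitEquiv G) =
      component (trace i Q') n ((D.chart hV Q' (h'.trans h)).limitEquiv (symRes h' G)) := by
  rw [← limitEquiv_res, component_completionRes]

end DarbouxFrame

end LagrangianNeighborhood

end

/-! ### The isomorphism of sheaves of Poisson algebras -/

noncomputable section

namespace LagrangianNeighborhood

variable {Y V : Scheme.{0}} [Y.Over SpecC] [V.Over SpecC]
  {i : V ⟶ Y} [i.IsOver SpecC] [IsClosedImmersion i] {d : ℕ} {ω : SymplecticForm Y}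

lemma completion_ext {W : V.Opens} {s t : Completion i W}
    (h : ∀ Q n, component Q n s = component Q n t) : s = t :=
  Subtype.ext (funext fun Q => funext fun n => h Q n)

lemma resMod_component {W : V.Opens} (s : Completion i W)
    {W₁ W₂ : {W' : Y.affineOpens // i ⁻¹ᵁ W'.1 ≤ W}} (h : W₂.1.1 ≤ W₁.1.1) {m n : ℕ}
    (hmn : m ≤ n) : resMod i.ker h hmn (component W₁ n s) = component W₂ m s :=
  resMod_val s h hmn

/-- The section of the completion with given components. -/
def Completion.ofComponents {W : V.Opens} (c : ∀ (Q : {Q : Y.affineOpens // i ⁻¹ᵁ Q.1 ≤ W}) (n : ℕ),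
      Γ(Y, Q.1.1) ⧸ i.ker.ideal Q.1 ^ n)
    (hc : ∀ (Q Q' : {Q : Y.affineOpens // i ⁻¹ᵁ Q.1 ≤ W}) (h : Q'.1.1 ≤ Q.1.1) (m n : ℕ)
      (hmn : m ≤ n), resMod i.ker h hmn (c Q n) = c Q' m) : Completion i W :=
  ⟨c, hc⟩

namespace DarbouxFrame

variable {U W W' : V.Opens} (D : DarbouxFrame i d ω U)
  [SmoothOfRelativeDimension (2 * d) (Y ↘ SpecC)]
  [SmoothOfRelativeDimension d (V ↘ SpecC)] (hV : ω.toTwoForm.RestrictsToZero i)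

lemma resMod_component_limitEquiv {Q Q' : Y.affineOpens} (hQ : i ⁻¹ᵁ Q.1 ≤ U)
    (hQ' : i ⁻¹ᵁ Q'.1 ≤ U) (h : Q'.1 ≤ Q.1) {m n : ℕ} (hmn : m ≤ n)
    {G : CompletedSym Γ(V, i ⁻¹ᵁ Q.1) (VectorField V (i ⁻¹ᵁ Q.1))}
    {G' : CompletedSym Γ(V, i ⁻¹ᵁ Q'.1) (VectorField V (i ⁻¹ᵁ Q'.1))}
    (hG : symRes (i.preimage_mono h) G = G') :
    resMod i.ker h hmn (component (trace i Q) n ((D.chart hV Q hQ).limitEquiv G)) =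
      component (trace i Q') m ((D.chart hV Q' hQ').limitEquiv G') := by
  rw [← hG, resMod_component (W₁ := trace i Q) (W₂ := ⟨Q', i.preimage_mono h⟩) _ h hmn]
  exact D.component_limitEquiv hV hQ (i.preimage_mono h) m G

/-- The section of the completion given by a section of `∏_n Sym^n T_V`. -/
def toCompletionFun (hW : W ≤ U) (s : symSections V W) : Completion i W :=
  Completion.ofComponents (fun Q n => component (trace i Q.1) n
      ((D.chart hV Q.1 (Q.2.trans hW)).limitEquiv (traceVal s Q.1 Q.2)))
    fun Q Q' h _ _ hmn => D.resMod_component_limitEquiv hV (Q.2.trans hW) (Q'.2.trans hW) h hmn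
      (symRes_traceVal s Q.2 (i.preimage_mono h))

lemma component_toCompletionFun (hW : W ≤ U) (s : symSections V W)
    (Q : {Q : Y.affineOpens // i ⁻¹ᵁ Q.1 ≤ W}) (n : ℕ) :
    component Q n (D.toCompletionFun hV hW s) = component (trace i Q.1) n
      ((D.chart hV Q.1 (Q.2.trans hW)).limitEquiv (traceVal s Q.1 Q.2)) := rfl

/-- The homomorphism from `∏_n Sym^n T_V` to the completion. -/
def toCompletion (hW : W ≤ U) : symSections V W →ₐ[ℂ] Completion i W where
  toFun := D.toCompletionFun hV hW
  map_one' := completion_ext fun Q n => by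
    rw [component_toCompletionFun, map_one,
      ← map_one ((component (trace i Q.1) n).comp (D.chart hV Q.1 (Q.2.trans hW)).limitEquiv.toAlgHom)]
    rfl
  map_zero' := completion_ext fun Q n => by
    rw [component_toCompletionFun, map_zero,
      ← map_zero ((component (trace i Q.1) n).comp (D.chart hV Q.1 (Q.2.trans hW)).limitEquiv.toAlgHom)]
    rfl
  map_mul' s t := completion_ext fun Q n => by
    rw [map_mul, component_toCompletionFun, component_toCompletionFun, component_toCompletionFun,
      ← map_mul, ← map_mul]
    rfl
  map_add' s t := completion_ext fun Q n => by
    rw [map_add, component_toCompletionFun, component_toCompletionFun, component_toCompletionFun,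
      ← map_add, ← map_add]
    rfl
  commutes' z := completion_ext fun Q n => by
    rw [component_toCompletionFun, AlgHom.commutes,
      ← AlgHom.commutes ((component (trace i Q.1) n).comp (D.chart hV Q.1 (Q.2.trans hW)).limitEquiv.toAlgHom)]
    rfl

lemma component_toCompletion (hW : W ≤ U) (s : symSections V W)
    (Q : {Q : Y.affineOpens // i ⁻¹ᵁ Q.1 ≤ W}) (n : ℕ) :
    component Q n (D.toCompletion hV hW s) = component (trace i Q.1) n
      ((D.chart hV Q.1 (Q.2.trans hW)).limitEquiv (traceVal s Q.1 Q.2)) := rfl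

/-- On the trace of an affine open the global map is the isomorphism of its chart; bijectivity and
brackets are reduced to charts through this. -/
lemma res_toCompletion (hW : W ≤ U) (s : symSections V W) (Q : Y.affineOpens)
    (h : i ⁻¹ᵁ Q.1 ≤ W) : Completion.res i h (D.toCompletion hV hW s) =
      (D.chart hV Q (h.trans hW)).limitEquiv (traceVal s Q h) :=
  completion_ext fun Q' n => by
    rw [component_completionRes, component_toCompletion]
    refine Eq.trans ?_ (D.component_limitEquiv hV (h.trans hW) Q'.2 n _).symm
    exact congrArg (fun G => component (trace i Q'.1) n
      ((D.chart hV Q'.1 (Q'.2.trans (h.trans hW))).limitEquiv G)) (symRes_traceVal s h Q'.2).symm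

lemma toCompletion_injective (hW : W ≤ U) : Function.Injective (D.toCompletion hV hW) := by
  intro s t hst
  refine Subtype.ext (funext fun W' => D.completedSym_ext (W'.2.trans hW) fun Q hQ => ?_)
  have h : traceVal s Q (hQ.trans W'.2) = traceVal t Q (hQ.trans W'.2) := by
    apply (D.chart hV Q (hQ.trans (W'.2.trans hW))).limitEquiv.injective
    rw [← res_toCompletion D hV hW, ← res_toCompletion D hV hW, hst]
  exact (symRes_val s (Q' := affineTrace i Q) W'.2 hQ).trans
    (h.trans (symRes_val t (Q' := affineTrace i Q) W'.2 hQ).symm)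

/-- The section of `∏_n Sym^n T_V` on the trace of an affine open given by a section of the
completion. -/
def ofCompletion (hW : W ≤ U) (t : Completion i W) (Q : {Q : Y.affineOpens // i ⁻¹ᵁ Q.1 ≤ W}) :
    CompletedSym Γ(V, i ⁻¹ᵁ Q.1.1) (VectorField V (i ⁻¹ᵁ Q.1.1)) :=
  (D.chart hV Q.1 (Q.2.trans hW)).limitEquiv.symm (Completion.res i Q.2 t)

lemma limitEquiv_ofCompletion (hW : W ≤ U) (t : Completion i W)
    (Q : {Q : Y.affineOpens // i ⁻¹ᵁ Q.1 ≤ W}) :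
    (D.chart hV Q.1 (Q.2.trans hW)).limitEquiv (D.ofCompletion hV hW t Q) =
      Completion.res i Q.2 t := AlgEquiv.apply_symm_apply _ _

lemma symRes_ofCompletion (hW : W ≤ U) (t : Completion i W)
    (Q Q' : {Q : Y.affineOpens // i ⁻¹ᵁ Q.1 ≤ W}) (h' : i ⁻¹ᵁ Q'.1.1 ≤ i ⁻¹ᵁ Q.1.1) :
    symRes h' (D.ofCompletion hV hW t Q) = D.ofCompletion hV hW t Q' := by
  apply (D.chart hV Q'.1 (Q'.2.trans hW)).limitEquiv.injective
  rw [limitEquiv_ofCompletion, ← limitEquiv_res D hV (Q.2.trans hW) h', limitEquiv_ofCompletion]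
  rfl

include D in
/-- Compatible sections on the traces of the affine opens come from a section of
`∏_n Sym^n T_V`. -/
lemma exists_symSections (hW : W ≤ U)
    (G : ∀ Q : {Q : Y.affineOpens // i ⁻¹ᵁ Q.1 ≤ W},
      CompletedSym Γ(V, i ⁻¹ᵁ Q.1.1) (VectorField V (i ⁻¹ᵁ Q.1.1)))
    (hG : ∀ (Q Q' : {Q : Y.affineOpens // i ⁻¹ᵁ Q.1 ≤ W}) (h' : i ⁻¹ᵁ Q'.1.1 ≤ i ⁻¹ᵁ Q.1.1),
      symRes h' (G Q) = G Q') :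
    ∃ s : symSections V W, ∀ Q : {Q : Y.affineOpens // i ⁻¹ᵁ Q.1 ≤ W},
      traceVal s Q.1 Q.2 = G Q := by
  obtain ⟨H, hH⟩ := D.exists_completedSym hW G hG
  have hcompat : ∀ (W₁ W₂ : {W' : V.affineOpens // W'.1 ≤ W}) (h : W₂.1.1 ≤ W₁.1.1),
      symRes h (symRes W₁.2 H) = symRes W₂.2 H := fun W₁ W₂ h =>
    D.symRes_symRes hW W₁.2 h H
  exact ⟨⟨fun W' => symRes W'.2 H, hcompat⟩, fun Q => hH Q⟩

/-- The inverse charts applied to the restrictions of `t` give a family on traces; it is compatible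
by `limitEquiv_res` and therefore glues. -/
lemma toCompletion_surjective (hW : W ≤ U) : Function.Surjective (D.toCompletion hV hW) := by
  intro t
  obtain ⟨s, hs⟩ := D.exists_symSections hW (D.ofCompletion hV hW t)
    (D.symRes_ofCompletion hV hW t)
  refine ⟨s, completion_ext fun Q n => ?_⟩
  rw [component_toCompletion, hs, limitEquiv_ofCompletion, component_completionRes]

lemma toCompletion_res (hW : W ≤ U) (h : W' ≤ W) (s : symSections V W) :
    D.toCompletion hV (h.trans hW) (symSectionsRes h s) =
      Completion.res i h (D.toCompletion hV hW s) := rfl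

lemma component_bracket {W₀ : V.Opens} (h : W₀ ≤ W) (s t : Completion i W)
    (Q : {Q : Y.affineOpens // i ⁻¹ᵁ Q.1 ≤ W₀}) (n : ℕ) :
    component Q n ((poissonCompletion i W₀ ω).bracket (Completion.res i h s)
      (Completion.res i h t)) =
    component ⟨Q.1, Q.2.trans h⟩ n ((poissonCompletion i W ω).bracket s t) := rfl

lemma toCompletion_bracket (hW : W ≤ U) (s t : symSections V W) :
    D.toCompletion hV hW (symSectionsBracket s t) =
      (poissonCompletion i W ω).bracket (D.toCompletion hV hW s) (D.toCompletion hV hW t) := by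
  refine completion_ext fun Q n => ?_
  refine Eq.trans ?_ (component_bracket (ω := ω) Q.2 (D.toCompletion hV hW s)
    (D.toCompletion hV hW t) (trace i Q.1) n)
  rw [component_toCompletion, res_toCompletion, res_toCompletion]
  exact congrArg (component (trace i Q.1) n)
    ((D.chart hV Q.1 (Q.2.trans hW)).limitEquiv_bracket (traceVal s Q.1 Q.2) (traceVal t Q.1 Q.2))

/-- The homomorphism from `∏_n Sym^n T_V` to the completion is an isomorphism. -/
def completionEquiv (hW : W ≤ U) : symSections V W ≃ₐ[ℂ] Completion i W :=
  .ofBijective (D.toCompletion hV hW)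
    ⟨D.toCompletion_injective hV hW, D.toCompletion_surjective hV hW⟩

lemma completionEquiv_symm_res (hW : W ≤ U) (h : W' ≤ W) (s : Completion i W) :
    (D.completionEquiv hV (h.trans hW)).symm (Completion.res i h s) =
      symSectionsRes h ((D.completionEquiv hV hW).symm s) := by
  rw [AlgEquiv.symm_apply_eq]
  refine Eq.trans ?_ (D.toCompletion_res hV hW h _).symm
  exact congrArg _ ((D.completionEquiv hV hW).apply_symm_apply s).symm

lemma completionEquiv_symm_bracket (hW : W ≤ U) (s t : Completion i W) :
    (D.completionEquiv hV hW).symm ((poissonCompletion i W ω).bracket s t) =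
      symSectionsBracket ((D.completionEquiv hV hW).symm s)
        ((D.completionEquiv hV hW).symm t) := by
  rw [AlgEquiv.symm_apply_eq]
  refine Eq.trans ?_ (D.toCompletion_bracket hV hW _ _).symm
  exact congrArg₂ _ ((D.completionEquiv hV hW).apply_symm_apply s).symm
    ((D.completionEquiv hV hW).apply_symm_apply t).symm

/-- The isomorphism of sheaves of Poisson algebras given by Darboux coordinates. -/
def poissonIso : PoissonIso ω i U where
  equiv _ hW := (D.completionEquiv hV hW).symm
  equiv_res hW h s := D.completionEquiv_symm_res hV hW h s
  equiv_bracket hW s t := D.completionEquiv_symm_bracket hV hW s t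

end DarbouxFrame

end LagrangianNeighborhood

end

theorem proposition3 (Y V : Scheme.{0})
    [Y.Over LagrangianNeighborhood.SpecC] [V.Over LagrangianNeighborhood.SpecC] (d : ℕ)
    [SmoothOfRelativeDimension (2 * d) (Y ↘ LagrangianNeighborhood.SpecC)]
    [SmoothOfRelativeDimension d (V ↘ LagrangianNeighborhood.SpecC)]
    (ω : LagrangianNeighborhood.SymplecticForm Y)
    (i : V ⟶ Y) [IsClosedImmersion i] [i.IsOver LagrangianNeighborhood.SpecC]
    (hV : ω.toTwoForm.RestrictsToZero i) (p : V) :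
    ∃ U : V.Opens, p ∈ U ∧ IsAffineOpen U ∧
      Nonempty (LagrangianNeighborhood.PoissonIso ω i U) := by
  obtain ⟨U, hp, ⟨D⟩⟩ := LagrangianNeighborhood.exists_darbouxFrame i d ω hV p
  exact ⟨U, hp, D.isAffineOpen, ⟨D.poissonIso hV⟩⟩
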